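/- Let $\sigma$ be a finite relational vocabulary. Structures may be empty, and formulas may use $\top$ and $\bot$ (the empty conjunction and disjunction). **Logics.** Let $^{+}\mathrm{FO}_k$ be the first-order formulas over $\sigma$ (with equality) of quantifier rank at most $k$ without negation symbol, i.e. built from atomic formulas with finite $\bigwedge,\bigvee$ and with $\exists,\forall$. Let $^{+}\mathcal L^k$ ($k\ge 1$) be the formulas without negation symbol of the infinitary logic $\mathcal L_{\infty,\omega}$ (with equality) that use only $k$ variables, free or bound; conjunctions and disjunctions range over arbitrary sets. If $\sigma$ is modal (all arities at most $2$), let $^{+}\mathrm{ML}_k$ be the modal formulas of modal depth at most $k$ without negation symbol, built from $\top,\bot$, the propositional variables (unary $P\in\sigma$), $\wedge,\vee$ and $\Diamond_R,\Box_R$ (binary $R\in\sigma$), with Kripke semantics. Write $A\Rrightarrow_{\mathbb L}B$ if every sentence of $\mathbb L$ true in $A$ is true in $B$, and $(A,a)\Rrightarrow_{\mathbb L}(B,b)$ if every formula of $\mathbb L$ true at $a$ in $A$ is true at $b$ in $B$. **Comonads.** $\mathbb E_k A$ is the set of non-empty sequences of elements of $A$ of length at most $k$; $R(s_1,\dots,s_n)$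 holds if the $s_i$ are pairwise comparable in the prefix order $\sqsubseteq$ and $R^A$ holds of their last elements. $\mathbb P_k A$ is the set of non-empty finite sequences of moves $(p,a)\in\{1,\dots,k\}\times A$; $R(s_1,\dots,s_n)$ holds if the $s_i$ are pairwise comparable, $R^A$ holds of the elements in their last moves, and whenever $s_i\sqsubseteq s_j$ the pebble of the last move of $s_i$ does not occur in the suffix of $s_i$ in $s_j$. For modal $\sigma$, $\mathbb M_k(A,a)$ is the set of labelled paths $a=a_0\xrightarrow{R_1}a_1\to\cdots\xrightarrow{R_i}a_i$ with $i\le k$ and $R_j^A(a_{j-1},a_j)$ for all $j$, pointed by the trivial path; a unary $P$ holds of a path if $P^A$ holds of its last element, a binary $R$ holds of $(s,t)$ if $t$ extends $s$ by one step labelled $R$, and nullary symbols are interpreted as false. In each case the counit sends a sequence or path to its last element, and the coextension $f^*$ of a homomorphism $f$ replaces each entry (keeping pebbles and labels) by the value of $f$ on the prefix ending at that entry. These are comonads on the category of $\sigma$-structures, respectively of pointed $\sigma$-structures (with point-preserving homomorphisms). Let $\mathrm{EM}(G)$ be the category of coalgebras of a comonad $G$, and $F_k$ the co-free coalgebra functor.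 Let $\sigma^I=\sigma\cup\{I\}$ with $I$ a fresh binary symbol, let $\mathbb E_k^I,\mathbb P_k^I$ be the corresponding comonads over $\sigma^I$, let $JA$ be $A$ with $I$ interpreted as equality, and let $F^I_k(A)$ be the co-free coalgebra on $JA$. **Positive bisimulations.** A coalgebra $(X,\alpha)$ carries the order $x\le y\iff\alpha(x)\sqsubseteq\alpha(y)$. A *path* is a coalgebra for which this order is finite and linear; for $\mathbb E_k,\mathbb P_k$ the empty coalgebra is a path. An *embedding* is a coalgebra morphism that is injective and reflects all relations, and a *path embedding* is an embedding whose domain is a path. A morphism $f\colon X\to Y$ is a *pathwise embedding* if $f\circ m$ is a path embedding for every path embedding $m\colon P\to X$. It is *open* if every commutative square $f\circ m=n\circ i$ with path embeddings $m\colon P\to X$, $i\colon P\to Q$, $n\colon Q\to Y$ has a morphism $d\colon Q\to X$ with $d\circ i=m$ and $f\circ d=n$. A *positive bisimulation* from $X$ to $Y$ consists of morphisms $X\xleftarrow{p}Z_1\xrightarrow{h}Z_2\xrightarrow{q}Y$ with $p,q$ open pathwise embeddings and $h$ bijective. Write $X\,\underline{\rightarrow}\,Y$ if one exists. **Theorem.**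 1. For all $k\in\mathbb N$ and all $\sigma$-structures $A,B$: $A\Rrightarrow_{^{+}\mathrm{FO}_k}B$ if and only if $F^I_k(A)\,\underline{\rightarrow}\,F^I_k(B)$ in $\mathrm{EM}(\mathbb E^I_k)$. 2. For all $k\ge 1$ and all $\sigma$-structures $A,B$: $A\Rrightarrow_{^{+}\mathcal L^k}B$ if and only if $F^I_k(A)\,\underline{\rightarrow}\,F^I_k(B)$ in $\mathrm{EM}(\mathbb P^I_k)$. 3. If $\sigma$ is modal, then for all $k\in\mathbb N$ and all pointed $\sigma$-structures $(A,a),(B,b)$: $(A,a)\Rrightarrow_{^{+}\mathrm{ML}_k}(B,b)$ if and only if $F_k(A,a)\,\underline{\rightarrow}\,F_k(B,b)$ in $\mathrm{EM}(\mathbb M_k)$. -/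

import Mathlib

open CategoryTheory
open scoped FirstOrder

universe u

namespace GameComonad

/-! ### Infinitary logic over a relational vocabulary

Vocabularies are Mathlib's first-order languages without function symbols, structures and
homomorphisms are Mathlib's. The carrier of a structure may be empty. -/

/-- Extend an assignment of the variables in `V` by sending the variable `x` to `a`. -/
def extendVal {A : Type u} {V : Set ℕ} (v : V → A) (x : ℕ) (a : A) :
    ↥(insert x V) → A :=
  fun y => if h : (y : ℕ) = x then a else v ⟨y, (Set.mem_insert_iff.1 y.2).resolve_left h⟩

/-- Infinitary first-order formulas in the variables `x₀, x₁, …` all of whose free variables are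
in `V`. Conjunctions and disjunctions are indexed by arbitrary small types; the empty ones are
`⊤` and `⊥`. -/
inductive Formula (σ : FirstOrder.Language.{0, 0}) : Set ℕ → Type (u + 1)
  | eq {V : Set ℕ} (x y : V) : Formula σ V
  | rel {V : Set ℕ} {n : ℕ} (R : σ.Relations n) (x : Fin n → V) : Formula σ V
  | neg {V : Set ℕ} (φ : Formula σ V) : Formula σ V
  | conj {V : Set ℕ} (ι : Type u) (φ : ι → Formula σ V) : Formula σ V
  | disj {V : Set ℕ} (ι : Type u) (φ : ι → Formula σ V) : Formula σ V
  | ex {V : Set ℕ} (x : ℕ) (φ : Formula σ (insert x V)) : Formula σ V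
  | all {V : Set ℕ} (x : ℕ) (φ : Formula σ (insert x V)) : Formula σ V

namespace Formula

variable {σ : FirstOrder.Language.{0, 0}}

/-- Satisfaction of a formula under an assignment of its free variables. -/
def Realize {A : Type u} [σ.Structure A] : {V : Set ℕ} → Formula.{u} σ V → (V → A) → Prop
  | _, .eq x y, v => v x = v y
  | _, .rel R x, v => FirstOrder.Language.Structure.RelMap R (fun i => v (x i))
  | _, .neg φ, v => ¬ φ.Realize v
  | _, .conj _ φ, v => ∀ i, (φ i).Realize v
  | _, .disj _ φ, v => ∃ i, (φ i).Realize v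
  | _, .ex x φ, v => ∃ a : A, φ.Realize (extendVal v x a)
  | _, .all x φ, v => ∀ a : A, φ.Realize (extendVal v x a)

/-- The negation symbol does not occur in the formula. -/
def NegFree : {V : Set ℕ} → Formula.{u} σ V → Prop
  | _, .eq _ _ => True
  | _, .rel _ _ => True
  | _, .neg _ => False
  | _, .conj _ φ => ∀ i, (φ i).NegFree
  | _, .disj _ φ => ∀ i, (φ i).NegFree
  | _, .ex _ φ => φ.NegFree
  | _, .all _ φ => φ.NegFree

/-- All conjunctions and disjunctions are finite: a formula of first-order logic. -/
def IsFirstOrder : {V : Set ℕ} → Formula.{u} σ V → Prop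
  | _, .eq _ _ => True
  | _, .rel _ _ => True
  | _, .neg φ => φ.IsFirstOrder
  | _, .conj ι φ => Finite ι ∧ ∀ i, (φ i).IsFirstOrder
  | _, .disj ι φ => Finite ι ∧ ∀ i, (φ i).IsFirstOrder
  | _, .ex _ φ => φ.IsFirstOrder
  | _, .all _ φ => φ.IsFirstOrder

/-- The maximum number of nested quantifiers (`⊤` if there is no finite bound). -/
noncomputable def quantifierRank : {V : Set ℕ} → Formula.{u} σ V → ℕ∞
  | _, .eq _ _ => 0
  | _, .rel _ _ => 0
  | _, .neg φ => φ.quantifierRank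
  | _, .conj _ φ => ⨆ i, (φ i).quantifierRank
  | _, .disj _ φ => ⨆ i, (φ i).quantifierRank
  | _, .ex _ φ => φ.quantifierRank + 1
  | _, .all _ φ => φ.quantifierRank + 1

/-- The variables that occur, free or bound. -/
def vars : {V : Set ℕ} → Formula.{u} σ V → Set ℕ
  | _, .eq x y => {(x : ℕ), (y : ℕ)}
  | _, .rel _ x => Set.range fun i => (x i : ℕ)
  | _, .neg φ => φ.vars
  | _, .conj _ φ => ⋃ i, (φ i).vars
  | _, .disj _ φ => ⋃ i, (φ i).vars
  | _, .ex x φ => insert x φ.vars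
  | _, .all x φ => insert x φ.vars

end Formula

/-- Formulas without free variables. -/
abbrev Sentence (σ : FirstOrder.Language.{0, 0}) := Formula.{u} σ ∅

/-- Truth of a sentence in a structure. -/
def Sentence.Holds {σ : FirstOrder.Language.{0, 0}} (φ : Sentence.{u} σ) (A : Type u) [σ.Structure A] : Prop :=
  φ.Realize (fun x : (∅ : Set ℕ) => (Set.notMem_empty _ x.2).elim : (∅ : Set ℕ) → A)

/-- The sentences of first-order logic with quantifier rank at most `k`. -/
def FOk (σ : FirstOrder.Language.{0, 0}) (k : ℕ) : Set (Sentence.{u} σ) :=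
  {φ | φ.IsFirstOrder ∧ φ.quantifierRank ≤ k}

/-- The sentences of infinitary logic that use only the `k` variables `x₀, …, x_{k-1}`. -/
def LLk (σ : FirstOrder.Language.{0, 0}) (k : ℕ) : Set (Sentence.{u} σ) :=
  {φ | φ.vars ⊆ Set.Iio k}

/-- The positive fragment of a set of sentences. -/
def positive {σ : FirstOrder.Language.{0, 0}} (𝕃 : Set (Sentence.{u} σ)) : Set (Sentence.{u} σ) :=
  {φ ∈ 𝕃 | φ.NegFree}

/-! ### Modal logic: unary symbols are propositional variables, binary symbols are modalities -/

/-- Modal formulas. -/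
inductive ModalFormula (σ : FirstOrder.Language.{0, 0}) : Type
  | var (P : σ.Relations 1) : ModalFormula σ
  | top : ModalFormula σ
  | bot : ModalFormula σ
  | neg (φ : ModalFormula σ) : ModalFormula σ
  | and (φ ψ : ModalFormula σ) : ModalFormula σ
  | or (φ ψ : ModalFormula σ) : ModalFormula σ
  | dia (R : σ.Relations 2) (φ : ModalFormula σ) : ModalFormula σ
  | box (R : σ.Relations 2) (φ : ModalFormula σ) : ModalFormula σ

namespace ModalFormula

variable {σ : FirstOrder.Language.{0, 0}}

/-- Kripke semantics. -/
def Holds {A : Type u} [σ.Structure A] : ModalFormula σ → A → Prop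
  | .var P, a => FirstOrder.Language.Structure.RelMap P ![a]
  | .top, _ => True
  | .bot, _ => False
  | .neg φ, a => ¬ φ.Holds a
  | .and φ ψ, a => φ.Holds a ∧ ψ.Holds a
  | .or φ ψ, a => φ.Holds a ∨ ψ.Holds a
  | .dia R φ, a => ∃ b : A, FirstOrder.Language.Structure.RelMap R ![a, b] ∧ φ.Holds b
  | .box R φ, a => ∀ b : A, FirstOrder.Language.Structure.RelMap R ![a, b] → φ.Holds b

/-- The negation symbol does not occur in the formula. -/
def NegFree : ModalFormula σ → Prop
  | .var _ => True
  | .top => True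
  | .bot => True
  | .neg _ => False
  | .and φ ψ => φ.NegFree ∧ ψ.NegFree
  | .or φ ψ => φ.NegFree ∧ ψ.NegFree
  | .dia _ φ => φ.NegFree
  | .box _ φ => φ.NegFree

/-- The maximum nesting of modalities. -/
def depth : ModalFormula σ → ℕ
  | .var _ => 0
  | .top => 0
  | .bot => 0
  | .neg φ => φ.depth
  | .and φ ψ => max φ.depth ψ.depth
  | .or φ ψ => max φ.depth ψ.depth
  | .dia _ φ => φ.depth + 1
  | .box _ φ => φ.depth + 1

end ModalFormula

/-- The modal formulas of modal depth at most `k`. -/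
def MLk (σ : FirstOrder.Language.{0, 0}) (k : ℕ) : Set (ModalFormula σ) := {φ | φ.depth ≤ k}

/-- The positive fragment of a set of modal formulas. -/
def positiveModal {σ : FirstOrder.Language.{0, 0}} (𝕃 : Set (ModalFormula σ)) : Set (ModalFormula σ) :=
  {φ ∈ 𝕃 | φ.NegFree}

/-! ### Categories of structures and of pointed structures -/

/-- A structure for the vocabulary `σ`. -/
structure Struct (σ : FirstOrder.Language.{0, 0}) where
  carrier : Type u
  [str : σ.Structure carrier]

attribute [instance] Struct.str

/-- The category of structures and homomorphisms. -/
instance Struct.category (σ : FirstOrder.Language.{0, 0}) : Category (Struct.{u} σ) where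
  Hom A B := A.carrier →[σ] B.carrier
  id A := FirstOrder.Language.Hom.id σ A.carrier
  comp f g := g.comp f

/-- The underlying map of a morphism of structures. -/
def Struct.fn {σ : FirstOrder.Language.{0, 0}} {A B : Struct.{u} σ} (f : A ⟶ B) :
    A.carrier → B.carrier :=
  (show A.carrier →[σ] B.carrier from f).toFun

/-- A pointed structure. -/
structure PtStruct (σ : FirstOrder.Language.{0, 0}) where
  toStruct : Struct.{u} σ
  pt : toStruct.carrier

/-- A point-preserving homomorphism. -/
@[ext]
structure PtStruct.Hom {σ : FirstOrder.Language.{0, 0}} (A B : PtStruct.{u} σ) where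
  hom : A.toStruct ⟶ B.toStruct
  map_pt : Struct.fn hom A.pt = B.pt

/-- The category of pointed structures and point-preserving homomorphisms. -/
instance PtStruct.category (σ : FirstOrder.Language.{0, 0}) : Category (PtStruct.{u} σ) where
  Hom A B := PtStruct.Hom A B
  id A := ⟨𝟙 A.toStruct, rfl⟩
  comp f g := ⟨f.hom ≫ g.hom, (congrArg (Struct.fn g.hom) f.map_pt).trans g.map_pt⟩
  id_comp f := PtStruct.Hom.ext (Category.id_comp f.hom)
  comp_id f := PtStruct.Hom.ext (Category.comp_id f.hom)
  assoc f g h := PtStruct.Hom.ext (Category.assoc f.hom g.hom h.hom)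

/-- The functor that forgets the point. -/
def forgetPt (σ : FirstOrder.Language.{0, 0}) : PtStruct.{u} σ ⥤ Struct.{u} σ where
  obj A := A.toStruct
  map f := PtStruct.Hom.hom f
  map_id _ := rfl
  map_comp _ _ := rfl

/-- Every sentence of `𝕃` true in `A` is true in `B`. -/
def Preserves {σ : FirstOrder.Language.{0, 0}} (𝕃 : Set (Sentence.{u} σ)) (A B : Struct.{u} σ) : Prop :=
  ∀ φ ∈ 𝕃, φ.Holds A.carrier → φ.Holds B.carrier

/-- Every modal formula of `𝕃` true at the point of `A` is true at the point of `B`. -/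
def PreservesModal {σ : FirstOrder.Language.{0, 0}} (𝕃 : Set (ModalFormula σ)) (A B : PtStruct.{u} σ) : Prop :=
  ∀ φ ∈ 𝕃, φ.Holds A.pt → φ.Holds B.pt

theorem Struct.hom_ext {σ : FirstOrder.Language.{0, 0}} {A B : Struct.{u} σ} {f g : A ⟶ B}
    (h : ∀ x, Struct.fn f x = Struct.fn g x) : f = g :=
  FirstOrder.Language.Hom.ext h

theorem Struct.fn_rel {σ : FirstOrder.Language.{0, 0}} {A B : Struct.{u} σ} (f : A ⟶ B) {n : ℕ}
    (R : σ.Relations n) (t : Fin n → A.carrier) (h : FirstOrder.Language.Structure.RelMap R t) :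
    FirstOrder.Language.Structure.RelMap R (fun i => Struct.fn f (t i)) :=
  (show A.carrier →[σ] B.carrier from f).map_rel' R t h

/-- Over a relational vocabulary a morphism is a map that preserves the relations. -/
def Struct.mkHom {σ : FirstOrder.Language.{0, 0}} [σ.IsRelational] {A B : Struct.{u} σ}
    (f : A.carrier → B.carrier)
    (hf : ∀ {n : ℕ} (R : σ.Relations n) (t : Fin n → A.carrier),
      FirstOrder.Language.Structure.RelMap R t → FirstOrder.Language.Structure.RelMap R (fun i => f (t i))) : A ⟶ B :=
  (show A.carrier →[σ] B.carrier from
    { toFun := f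
      map_fun' := fun g _ => isEmptyElim g
      map_rel' := fun R t h => hf R t h })

/-- A structure given by its relations, over a relational vocabulary. -/
abbrev relStructure (σ : FirstOrder.Language.{0, 0}) [σ.IsRelational] (X : Type u)
    (r : {n : ℕ} → σ.Relations n → (Fin n → X) → Prop) : σ.Structure X where
  funMap f _ := isEmptyElim f
  RelMap := r

/-! ### The expanded vocabulary with a binary symbol `I`, and the functor `J` -/

/-- The single relation symbol `I`, of arity two. -/
inductive IRel : ℕ → Type
  | I : IRel 2

/-- The vocabulary `{I}`. -/
def langI : FirstOrder.Language.{0, 0} := ⟨fun _ => Empty, IRel⟩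

instance : langI.IsRelational := fun _ => inferInstanceAs (IsEmpty Empty)

/-- The vocabulary `σ ∪ {I}`. -/
abbrev addI (σ : FirstOrder.Language.{0, 0}) : FirstOrder.Language.{0, 0} := σ.sum langI

/-- The structure on `A` over `σ ∪ {I}` that interprets `I` as the diagonal. -/
def J {σ : FirstOrder.Language.{0, 0}} [σ.IsRelational] (A : Struct.{u} σ) : Struct.{u} (addI σ) where
  carrier := A.carrier
  str := relStructure (addI σ) A.carrier fun {n} R =>
    match n, R with
    | _, Sum.inl R => fun t => FirstOrder.Language.Structure.RelMap R t
    | _, Sum.inr IRel.I => fun t => t 0 = t 1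

/-! ### Comonads in Kleisli form -/

/-- The comonad with object map `G`, counit `ε` and coextension `ext`. -/
def comonadOfKleisli {C : Type*} [Category C] (G : C → C) (ε : ∀ A, G A ⟶ A)
    (ext : ∀ {A B : C}, (G A ⟶ B) → (G A ⟶ G B))
    (ext_counit : ∀ A, ext (ε A) = 𝟙 (G A))
    (ext_comp_counit : ∀ {A B : C} (f : G A ⟶ B), ext f ≫ ε B = f)
    (ext_ext : ∀ {A B D : C} (f : G A ⟶ B) (g : G B ⟶ D), ext (ext f ≫ g) = ext f ≫ ext g) :
    Comonad C where
  obj := G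
  map {A _} f := ext (ε A ≫ f)
  map_id A := by simp [ext_counit]
  map_comp {A B D} f g := by
    rw [← ext_ext, ← Category.assoc (ext _), ext_comp_counit, Category.assoc]
  ε := { app := ε, naturality := fun A B f => ext_comp_counit _ }
  δ :=
    { app := fun A => ext (𝟙 (G A))
      naturality := fun A B f => by
        change ext (ε A ≫ f) ≫ ext (𝟙 (G B)) = ext (𝟙 (G A)) ≫ ext (ε (G A) ≫ ext (ε A ≫ f))
        rw [← ext_ext, ← ext_ext, ← Category.assoc (ext (𝟙 (G A))), ext_comp_counit]
        simp }
  coassoc A := by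
    change ext (𝟙 (G A)) ≫ ext (ε (G A) ≫ ext (𝟙 (G A))) = ext (𝟙 (G A)) ≫ ext (𝟙 (G (G A)))
    rw [← ext_ext, ← ext_ext, ← Category.assoc (ext (𝟙 (G A))), ext_comp_counit]
    simp
  left_counit A := ext_comp_counit _
  right_counit A := by
    change ext (𝟙 (G A)) ≫ ext (ε (G A) ≫ ε A) = 𝟙 (G A)
    rw [← ext_ext, ← Category.assoc, ext_comp_counit, Category.id_comp, ext_counit]

/-! ### The Ehrenfeucht–Fraïssé comonad -/

theorem take_succ_ne_nil {α : Type u} {s : List α} {j : ℕ} (hs : s ≠ []) :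
    s.take (j + 1) ≠ [] := by
  cases s with
  | nil => exact absurd rfl hs
  | cons a s => simp

theorem take_eq_of_prefix {α : Type u} {s t : List α} (h : s <+: t) {j : ℕ} (hj : j ≤ s.length) :
    s.take j = t.take j := by
  obtain ⟨w, rfl⟩ := h
  rw [List.take_append_of_le_length hj]

/-- Non-empty sequences of length at most `k`. -/
@[ext]
structure ESeq (k : ℕ) (A : Type u) : Type u where
  val : List A
  ne_nil : val ≠ []
  length_le : val.length ≤ k

namespace ESeq

variable {k : ℕ} {A B : Type u}

/-- The last element. -/
def last (s : ESeq k A) : A := s.val.getLast s.ne_nil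

/-- The prefix of length `j + 1` (the whole sequence if `j` is too large). -/
def pre (s : ESeq k A) (j : ℕ) : ESeq k A :=
  ⟨s.val.take (j + 1), take_succ_ne_nil s.ne_nil, (List.length_take_le' _ _).trans s.length_le⟩

/-- `[a₁, …, aᵢ] ↦ [f [a₁], f [a₁, a₂], …, f [a₁, …, aᵢ]]`. -/
def coext (f : ESeq k A → B) (s : ESeq k A) : ESeq k B :=
  ⟨List.ofFn fun j : Fin s.val.length => f (s.pre j), by
    have := List.length_pos_of_ne_nil s.ne_nil
    exact List.ne_nil_of_length_pos (by simpa using this), by simpa using s.length_le⟩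

theorem pre_last_index (s : ESeq k A) : s.pre (s.val.length - 1) = s := by
  have := List.length_pos_of_ne_nil s.ne_nil
  apply ESeq.ext
  change s.val.take _ = s.1
  exact List.take_of_length_le (by omega)

theorem last_coext (f : ESeq k A → B) (s : ESeq k A) : (coext f s).last = f s := by
  simp only [last, coext, List.getLast_eq_getElem, List.getElem_ofFn, List.length_ofFn]
  rw [pre_last_index]

theorem last_pre (s : ESeq k A) {j : ℕ} (hj : j < s.val.length) : (s.pre j).last = s.val[j] := by
  simp only [last, pre, List.getLast_eq_getElem, List.getElem_take, List.length_take]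
  congr 1
  omega

theorem coext_prefix (f : ESeq k A → B) {s t : ESeq k A} (h : s.1 <+: t.val) :
    (coext f s).val <+: (coext f t).val := by
  refine List.prefix_iff_getElem.2 ⟨by simpa [coext] using h.length_le, fun j hj => ?_⟩
  simp only [coext, List.getElem_ofFn]
  congr 1
  apply ESeq.ext
  simp only [coext, List.length_ofFn] at hj
  exact take_eq_of_prefix h hj

theorem coext_last (s : ESeq k A) : coext last s = s := by
  apply ESeq.ext
  refine List.ext_getElem (by simp [coext]) fun j _ hj => ?_
  simp only [coext, List.getElem_ofFn]
  exact last_pre s hj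

theorem getElem_coext (f : ESeq k A → B) (s : ESeq k A) (j : ℕ) (hj : j < (coext f s).val.length) :
    (coext f s).val[j] = f (s.pre j) := by
  simp [coext]

theorem length_coext (f : ESeq k A → B) (s : ESeq k A) : (coext f s).val.length = s.val.length := by
  simp [coext]

theorem pre_pre (s : ESeq k A) {i j : ℕ} (h : i ≤ j) : (s.pre j).pre i = s.pre i :=
  ESeq.ext (by
    change (s.val.take (j + 1)).take (i + 1) = s.val.take (i + 1)
    rw [List.take_take, min_eq_left (by omega)])

theorem pre_coext (f : ESeq k A → B) (s : ESeq k A) (j : ℕ) :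
    (coext f s).pre j = coext f (s.pre j) := by
  apply ESeq.ext
  refine List.ext_getElem (by simp [coext, pre]) fun i h₁ h₂ => ?_
  have hi : i < j + 1 := by
    simp only [pre, List.length_take] at h₁
    omega
  rw [getElem_coext, pre_pre s (by omega)]
  simp only [pre, List.getElem_take, getElem_coext]

theorem coext_coext {D : Type u} (f : ESeq k A → B) (g : ESeq k B → D) (s : ESeq k A) :
    coext (fun t => g (coext f t)) s = coext g (coext f s) := by
  apply ESeq.ext
  refine List.ext_getElem (by simp [coext]) fun j h₁ h₂ => ?_
  rw [getElem_coext, getElem_coext, pre_coext]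

end ESeq

/-- The structure of sequences: the members of a related tuple are pairwise comparable in the
prefix order and their last elements are related. -/
def EObj (σ : FirstOrder.Language.{0, 0}) [σ.IsRelational] (k : ℕ) (A : Struct.{u} σ) :
    Struct.{u} σ where
  carrier := ESeq k A.carrier
  str := relStructure σ _ fun R s =>
    (∀ i j, (s i).val <+: (s j).val ∨ (s j).val <+: (s i).1) ∧
      FirstOrder.Language.Structure.RelMap R (fun i => (s i).last)

/-- The Ehrenfeucht–Fraïssé comonad. -/
def EComonad (σ : FirstOrder.Language.{0, 0}) [σ.IsRelational] (k : ℕ) :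
    Comonad (Struct.{u} σ) :=
  comonadOfKleisli (EObj σ k)
    (fun A => Struct.mkHom (A := EObj σ k A) (B := A) ESeq.last fun _ _ h => h.2)
    (fun {A B} f => Struct.mkHom (A := EObj σ k A) (B := EObj σ k B) (ESeq.coext (Struct.fn f))
      fun R t h => ⟨fun i j => (h.1 i j).imp (ESeq.coext_prefix _) (ESeq.coext_prefix _), by
        have h' := Struct.fn_rel f R t h
        have e : (fun i => (ESeq.coext (Struct.fn f) (t i)).last) = fun i => Struct.fn f (t i) :=
          funext fun i => ESeq.last_coext (Struct.fn f) (t i)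
        rw [e]
        exact h'⟩)
    (fun A => Struct.hom_ext fun s => ESeq.coext_last s)
    (fun f => Struct.hom_ext fun s => ESeq.last_coext (Struct.fn f) s)
    (fun f g => Struct.hom_ext fun s => ESeq.coext_coext (Struct.fn f) (Struct.fn g) s)

/-! ### The pebbling comonad -/

/-- Non-empty sequences of moves; a move is a pebble and an element. -/
@[ext]
structure PSeq (k : ℕ) (A : Type u) : Type u where
  val : List (Fin k × A)
  ne_nil : val ≠ []

namespace PSeq

variable {k : ℕ} {A B : Type u}

/-- The last move. -/
def lastMove (s : PSeq k A) : Fin k × A := s.val.getLast s.ne_nil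

/-- The element chosen in the last move. -/
def last (s : PSeq k A) : A := s.lastMove.2

/-- The prefix of length `j + 1` (the whole sequence if `j` is too large). -/
def pre (s : PSeq k A) (j : ℕ) : PSeq k A := ⟨s.val.take (j + 1), take_succ_ne_nil s.ne_nil⟩

/-- The sequence with the same pebbles in which the `j`-th element is the value of `f` at the
prefix that ends in the `j`-th move. -/
def coext (f : PSeq k A → B) (s : PSeq k A) : PSeq k B :=
  ⟨List.ofFn fun j : Fin s.val.length => (s.val[j].1, f (s.pre j)), by
    have := List.length_pos_of_ne_nil s.ne_nil
    exact List.ne_nil_of_length_pos (by simpa using this)⟩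

/-- If `s i` is a prefix of `s j`, the pebble of the last move in `s i` does not appear in the
suffix of `s i` in `s j`. -/
def Active {n : ℕ} (s : Fin n → PSeq k A) : Prop :=
  ∀ i j, ∀ w : List (Fin k × A), (s i).val ++ w = (s j).val → ∀ m ∈ w, m.1 ≠ (s i).lastMove.1

theorem pre_last_index (s : PSeq k A) : s.pre (s.val.length - 1) = s := by
  have := List.length_pos_of_ne_nil s.ne_nil
  apply PSeq.ext
  change s.val.take _ = s.1
  exact List.take_of_length_le (by omega)

theorem lastMove_coext (f : PSeq k A → B) (s : PSeq k A) :
    (coext f s).lastMove = (s.lastMove.1, f s) := by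
  simp only [lastMove, coext, List.getLast_eq_getElem, List.getElem_ofFn, List.length_ofFn]
  rw [pre_last_index]
  rfl

theorem last_coext (f : PSeq k A → B) (s : PSeq k A) : (coext f s).last = f s := by
  rw [last, lastMove_coext]

theorem lastMove_pre (s : PSeq k A) {j : ℕ} (hj : j < s.val.length) :
    (s.pre j).lastMove = s.val[j] := by
  simp only [lastMove, pre, List.getLast_eq_getElem, List.getElem_take, List.length_take]
  congr 1
  omega

theorem coext_prefix (f : PSeq k A → B) {s t : PSeq k A} (h : s.1 <+: t.val) :
    (coext f s).val <+: (coext f t).val := by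
  refine List.prefix_iff_getElem.2 ⟨by simpa [coext] using h.length_le, fun j hj => ?_⟩
  simp only [coext, List.length_ofFn] at hj
  have h₁ : s.pre j = t.pre j := PSeq.ext (take_eq_of_prefix h hj)
  have h₂ : s.val[j] = t.val[j]'(hj.trans_le h.length_le) := h.getElem hj
  simp [coext, h₁, h₂]

theorem coext_last (s : PSeq k A) : coext last s = s := by
  apply PSeq.ext
  refine List.ext_getElem (by simp [coext]) fun j _ hj => ?_
  simp [coext, last, lastMove_pre s hj]

theorem map_fst_coext (f : PSeq k A → B) (s : PSeq k A) :
    (coext f s).val.map Prod.fst = s.val.map Prod.fst :=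
  List.ext_getElem (by simp [coext]) fun j _ hj => by simp [coext]

theorem getElem_coext (f : PSeq k A → B) (s : PSeq k A) (j : ℕ) (hj : j < (coext f s).val.length)
    (hj' : j < s.val.length) : (coext f s).val[j] = (s.val[j].1, f (s.pre j)) := by
  simp [coext]

theorem length_coext (f : PSeq k A → B) (s : PSeq k A) : (coext f s).val.length = s.val.length := by
  simp [coext]

theorem pre_pre (s : PSeq k A) {i j : ℕ} (h : i ≤ j) : (s.pre j).pre i = s.pre i :=
  PSeq.ext (by
    change (s.val.take (j + 1)).take (i + 1) = s.val.take (i + 1)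
    rw [List.take_take, min_eq_left (by omega)])

theorem pre_coext (f : PSeq k A → B) (s : PSeq k A) (j : ℕ) :
    (coext f s).pre j = coext f (s.pre j) := by
  apply PSeq.ext
  refine List.ext_getElem (by simp [coext, pre]) fun i h₁ h₂ => ?_
  have hi : i < j + 1 ∧ i < s.val.length := by
    simp only [pre, List.length_take, length_coext] at h₁
    omega
  have hi' : i < (s.pre j).1.length := by rwa [length_coext] at h₂
  rw [getElem_coext _ _ _ _ hi', pre_pre s (by omega)]
  simp only [pre, List.getElem_take]
  rw [getElem_coext _ _ _ _ hi.2]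
  rfl

theorem coext_coext {D : Type u} (f : PSeq k A → B) (g : PSeq k B → D) (s : PSeq k A) :
    coext (fun t => g (coext f t)) s = coext g (coext f s) := by
  apply PSeq.ext
  refine List.ext_getElem (by simp [coext]) fun j h₁ h₂ => ?_
  have h₃ : j < (coext f s).val.length := by rwa [length_coext] at h₂
  have h₄ : j < s.val.length := by rwa [length_coext] at h₃
  rw [getElem_coext _ _ _ _ h₄, getElem_coext _ _ _ _ h₃, getElem_coext _ _ _ _ h₄, pre_coext]

theorem active_coext (f : PSeq k A → B) {n : ℕ} {s : Fin n → PSeq k A}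
    (hc : ∀ i j, (s i).val <+: (s j).val ∨ (s j).val <+: (s i).1) (hs : Active s) :
    Active fun i => coext f (s i) := by
  intro i j w hw m hm
  simp only [lastMove_coext]
  have hmap : (s i).1.map Prod.fst ++ w.map Prod.fst = (s j).1.map Prod.fst := by
    rw [← map_fst_coext f (s i), ← map_fst_coext f (s j), ← hw, List.map_append]
  have hpre : (s i).val <+: (s j).val := by
    refine (hc i j).elim id fun h => ?_
    have hl := congrArg List.length hmap
    simp only [List.length_append, List.length_map] at hl
    rw [h.eq_of_length (le_antisymm h.length_le (by omega))]
  obtain ⟨w', hw'⟩ := hpre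
  rw [← hw', List.map_append, List.append_cancel_left_eq] at hmap
  have hm' : m.1 ∈ w'.map Prod.fst := hmap ▸ List.mem_map_of_mem hm
  obtain ⟨m', hm', he⟩ := List.mem_map.1 hm'
  exact he ▸ hs i j w' hw' m' hm'

end PSeq

/-- The structure of sequences of moves: the members of a related tuple are pairwise comparable
in the prefix order, their last pebbles have not been moved since, and their last elements are
related. -/
def PObj (σ : FirstOrder.Language.{0, 0}) [σ.IsRelational] (k : ℕ) (A : Struct.{u} σ) :
    Struct.{u} σ where
  carrier := PSeq k A.carrier
  str := relStructure σ _ fun R s =>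
    (∀ i j, (s i).val <+: (s j).val ∨ (s j).val <+: (s i).1) ∧ PSeq.Active s ∧
      FirstOrder.Language.Structure.RelMap R (fun i => (s i).last)

/-- The pebbling comonad. -/
def PComonad (σ : FirstOrder.Language.{0, 0}) [σ.IsRelational] (k : ℕ) :
    Comonad (Struct.{u} σ) :=
  comonadOfKleisli (PObj σ k)
    (fun A => Struct.mkHom (A := PObj σ k A) (B := A) PSeq.last fun _ _ h => h.2.2)
    (fun {A B} f => Struct.mkHom (A := PObj σ k A) (B := PObj σ k B) (PSeq.coext (Struct.fn f))
      fun R t h => ⟨fun i j => (h.1 i j).imp (PSeq.coext_prefix _) (PSeq.coext_prefix _),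
        PSeq.active_coext _ h.1 h.2.1, by
        have h' := Struct.fn_rel f R t h
        have e : (fun i => (PSeq.coext (Struct.fn f) (t i)).last) = fun i => Struct.fn f (t i) :=
          funext fun i => PSeq.last_coext (Struct.fn f) (t i)
        rw [e]
        exact h'⟩)
    (fun A => Struct.hom_ext fun s => PSeq.coext_last s)
    (fun f => Struct.hom_ext fun s => PSeq.last_coext (Struct.fn f) s)
    (fun f g => Struct.hom_ext fun s => PSeq.coext_coext (Struct.fn f) (Struct.fn g) s)

/-! ### The modal comonad -/

/-- The end point of a path that starts at `a`. A path is given by its steps: a binary relation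
symbol and the element reached. -/
def endPt {σ : FirstOrder.Language.{0, 0}} {A : Type u} (a : A) (s : List (σ.Relations 2 × A)) :
    A :=
  (s.getLast?.map Prod.snd).getD a

theorem endPt_take_succ {σ : FirstOrder.Language.{0, 0}} {A : Type u} (a : A)
    (s : List (σ.Relations 2 × A)) {j : ℕ} (hj : j < s.length) :
    endPt a (s.take (j + 1)) = s[j].2 := by
  rw [endPt, List.take_succ_eq_append_getElem hj, List.getLast?_concat]
  rfl

/-- The paths `a = a₀ → a₁ → ⋯ → aᵢ` with `i ≤ k`, each step labelled by a binary relation symbol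
that holds of it. -/
@[ext]
structure MPath {σ : FirstOrder.Language.{0, 0}} (k : ℕ) (A : PtStruct.{u} σ) : Type u where
  val : List (σ.Relations 2 × A.toStruct.carrier)
  length_le : val.length ≤ k
  rel : ∀ (j : ℕ) (hj : j < val.length),
    FirstOrder.Language.Structure.RelMap val[j].1 ![endPt A.pt (val.take j), val[j].2]

namespace MPath

variable {σ : FirstOrder.Language.{0, 0}} {k : ℕ} {A B : PtStruct.{u} σ}

/-- The end point of a path. -/
def last (s : MPath k A) : A.toStruct.carrier := endPt A.pt s.val

/-- The trivial path. -/
def nil : MPath k A := ⟨[], Nat.zero_le _, fun _ hj => absurd hj (Nat.not_lt_zero _)⟩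

/-- The path of the first `j` steps (the whole path if `j` is too large). -/
def pre (s : MPath k A) (j : ℕ) : MPath k A where
  val := s.val.take j
  length_le := (List.length_take_le' _ _).trans s.length_le
  rel i hi := by
    simp only [List.length_take] at hi
    rw [List.take_take, min_eq_left (by omega)]
    simpa only [List.getElem_take] using s.rel i (by omega)

/-- The path `t` extends `s` by one step along `R`. -/
def Step (R : σ.Relations 2) (s t : MPath k A) : Prop := ∃ b, t.val = s.val ++ [(R, b)]

/-- The relations on the set of paths. -/
def Rel : {n : ℕ} → σ.Relations n → (Fin n → MPath k A) → Prop
  | 1, P, s => FirstOrder.Language.Structure.RelMap P ![(s 0).last]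
  | 2, R, s => Step R (s 0) (s 1)
  | _, _, _ => False

end MPath

/-- The `k`-unravelling of a pointed structure. -/
def MObj (σ : FirstOrder.Language.{0, 0}) [σ.IsRelational] (k : ℕ) (A : PtStruct.{u} σ) :
    PtStruct.{u} σ where
  toStruct := { carrier := MPath k A, str := relStructure σ _ MPath.Rel }
  pt := MPath.nil

namespace MPath

variable {σ : FirstOrder.Language.{0, 0}} {k : ℕ} {A B D : PtStruct.{u} σ}

theorem pre_zero (s : MPath k A) : s.pre 0 = nil := MPath.ext (by simp [pre, nil])

theorem pre_length (s : MPath k A) : s.pre s.val.length = s := MPath.ext (by simp [pre])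

theorem pre_pre (s : MPath k A) {i j : ℕ} (h : i ≤ j) : (s.pre j).pre i = s.pre i :=
  MPath.ext (by simp [pre, List.take_take, min_eq_left h])

theorem step_pre (s : MPath k A) {j : ℕ} (hj : j < s.val.length) :
    Step s.val[j].1 (s.pre j) (s.pre (j + 1)) :=
  ⟨s.val[j].2, List.take_succ_eq_append_getElem hj⟩

theorem last_pre (s : MPath k A) {j : ℕ} (hj : j < s.val.length) :
    (s.pre (j + 1)).last = s.val[j].2 :=
  endPt_take_succ _ _ hj

theorem rel_of_step {R : σ.Relations 2} {s t : MPath k A} (h : Step R s t) :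
    FirstOrder.Language.Structure.RelMap R ![s.last, t.last] := by
  obtain ⟨b, hb⟩ := h
  have h := t.rel s.val.length (by simp [hb])
  simpa [hb, last, endPt] using h

/-- A list of labelled elements obtained by applying `f` along the path `s`. -/
def mapList (f : MPath k A → B.toStruct.carrier) (s : MPath k A) :
    List (σ.Relations 2 × B.toStruct.carrier) :=
  List.ofFn fun j : Fin s.val.length => (s.val[j].1, f (s.pre (j + 1)))

theorem getElem_mapList (f : MPath k A → B.toStruct.carrier) (s : MPath k A) (j : ℕ)
    (hj : j < (mapList f s).length) (hj' : j < s.val.length) :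
    (mapList f s)[j] = (s.val[j].1, f (s.pre (j + 1))) := by
  simp [mapList]

theorem length_mapList (f : MPath k A → B.toStruct.carrier) (s : MPath k A) :
    (mapList f s).length = s.val.length := by
  simp [mapList]

theorem endPt_mapList (f : MPath k A → B.toStruct.carrier) (hf : f nil = B.pt) (s : MPath k A)
    {j : ℕ} (hj : j ≤ s.val.length) : endPt B.pt ((mapList f s).take j) = f (s.pre j) := by
  cases j with
  | zero => rw [pre_zero, hf]; simp [endPt]
  | succ j =>
    have h : j < (mapList f s).length := by rw [length_mapList]; omega
    rw [endPt_take_succ _ _ h, getElem_mapList _ _ _ _ (by omega)]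

/-- The path with the same labels in which the element reached in each step is the value of `f`
at the part of the path that ends with this step. -/
def coext (f : MPath k A → B.toStruct.carrier) (hf : f nil = B.pt)
    (hR : ∀ (R : σ.Relations 2) (s t : MPath k A), Step R s t →
      FirstOrder.Language.Structure.RelMap R ![f s, f t]) (s : MPath k A) : MPath k B where
  val := mapList f s
  length_le := (length_mapList _ _).trans_le s.length_le
  rel j hj := by
    have hj' : j < s.val.length := by rwa [length_mapList] at hj
    rw [getElem_mapList _ _ _ _ hj', endPt_mapList _ hf s hj'.le]
    exact hR _ _ _ (step_pre s hj')

section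

variable (f : MPath k A → B.toStruct.carrier) (hf : f nil = B.pt)
  (hR : ∀ (R : σ.Relations 2) (s t : MPath k A), Step R s t →
      FirstOrder.Language.Structure.RelMap R ![f s, f t])

theorem last_coext (s : MPath k A) : (coext f hf hR s).last = f s := by
  have h := endPt_mapList f hf s le_rfl
  rwa [pre_length, List.take_of_length_le (length_mapList _ _).le] at h

theorem pre_coext (s : MPath k A) (j : ℕ) :
    (coext f hf hR s).pre j = coext f hf hR (s.pre j) := by
  apply MPath.ext
  refine List.ext_getElem (by simp [coext, pre, length_mapList]) fun i h₁ h₂ => ?_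
  have hi : i < j ∧ i < s.val.length := by
    simp only [pre, coext, List.length_take, length_mapList] at h₁
    omega
  have hi' : i < (s.pre j).val.length := by simp only [pre, List.length_take]; omega
  simp only [coext]
  rw [getElem_mapList _ _ _ _ hi', pre_pre s (by omega)]
  simp only [pre, List.getElem_take]
  rw [getElem_mapList _ _ _ _ hi.2]
  rfl

theorem coext_step {R : σ.Relations 2} {s t : MPath k A} (h : Step R s t) :
    Step R (coext f hf hR s) (coext f hf hR t) := by
  obtain ⟨b, hb⟩ := h
  have hl : s.val.length < t.val.length := by simp [hb]
  have hl' : s.val.length < (coext f hf hR t).val.length := by simpa [coext, length_mapList] using hl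
  have hs : t.pre s.val.length = s := MPath.ext (by simp [pre, hb])
  have ht' : t.pre (s.val.length + 1) = t := MPath.ext (by simp [pre, hb])
  have h := step_pre (coext f hf hR t) hl'
  rw [pre_coext, pre_coext, hs, ht'] at h
  have e : ((coext f hf hR t).val[s.val.length]'hl').1 = R := by
    simp only [coext]
    rw [getElem_mapList _ _ _ _ hl]
    simp [hb]
  rwa [e] at h

end

theorem coext_last (hf : (nil : MPath k A).last = A.pt)
    (hR : ∀ (R : σ.Relations 2) (s t : MPath k A), Step R s t →
      FirstOrder.Language.Structure.RelMap R ![s.last, t.last]) (s : MPath k A) :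
    coext last hf hR s = s := by
  apply MPath.ext
  refine List.ext_getElem (length_mapList _ _) fun j _ hj => ?_
  simp only [coext]
  rw [getElem_mapList _ _ _ _ hj, last_pre s hj]

theorem coext_coext (f : MPath k A → B.toStruct.carrier) (hf hR)
    (g : MPath k B → D.toStruct.carrier) (hg hS) (h : MPath k A → D.toStruct.carrier) (hh hT)
    (e : ∀ s, h s = g (coext f hf hR s)) (s : MPath k A) :
    coext h hh hT s = coext g hg hS (coext f hf hR s) := by
  apply MPath.ext
  refine List.ext_getElem (by simp [coext, length_mapList]) fun j h₁ h₂ => ?_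
  have h₄ : j < s.val.length := by simpa [coext, length_mapList] using h₁
  have h₃ : j < (coext f hf hR s).val.length := by simpa [coext, length_mapList] using h₄
  have e₁ := getElem_mapList h s j (by rwa [length_mapList]) h₄
  have e₂ := getElem_mapList g (coext f hf hR s) j (by rwa [length_mapList]) h₃
  have e₃ := getElem_mapList f s j (by rwa [length_mapList]) h₄
  refine e₁.trans (Eq.trans ?_ e₂.symm)
  rw [e, pre_coext]
  exact congrArg (fun r => (r, _)) (congrArg Prod.fst e₃).symm

end MPath

theorem MObj.rel_of_step {σ : FirstOrder.Language.{0, 0}} [σ.IsRelational] {k : ℕ}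
    {A B : PtStruct.{u} σ} (f : MObj σ k A ⟶ B) (R : σ.Relations 2) (s t : MPath k A)
    (h : MPath.Step R s t) :
    FirstOrder.Language.Structure.RelMap R ![Struct.fn f.hom s, Struct.fn f.hom t] := by
  have h' := Struct.fn_rel f.hom R ![s, t] h
  convert h' using 1
  ext i
  fin_cases i <;> rfl

/-- The counit of the modal comonad: the end point of a path. -/
def MCounit (σ : FirstOrder.Language.{0, 0}) [σ.IsRelational] (k : ℕ) (A : PtStruct.{u} σ) :
    MObj σ k A ⟶ A where
  hom := Struct.mkHom (A := (MObj σ k A).toStruct) (B := A.toStruct) MPath.last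
    fun {n} R t h => by
      match n, R, t, h with
      | 1, R, t, h =>
        change FirstOrder.Language.Structure.RelMap R ![(t 0).last] at h
        convert h using 1
        ext i
        fin_cases i
        rfl
      | 2, R, t, h =>
        convert MPath.rel_of_step h using 1
        ext i
        fin_cases i <;> rfl
  map_pt := rfl

/-- The coextension operation of the modal comonad. -/
def MCoext {σ : FirstOrder.Language.{0, 0}} [σ.IsRelational] {k : ℕ} {A B : PtStruct.{u} σ}
    (f : MObj σ k A ⟶ B) : MObj σ k A ⟶ MObj σ k B where
  hom := Struct.mkHom (A := (MObj σ k A).toStruct) (B := (MObj σ k B).toStruct) 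
    (MPath.coext (Struct.fn f.hom) f.map_pt (MObj.rel_of_step f))
    fun {n} R t h => by
      match n, R, t, h with
      | 1, R, t, h =>
        have h' := Struct.fn_rel f.hom R t h
        change FirstOrder.Language.Structure.RelMap R 
          ![(MPath.coext (Struct.fn f.hom) f.map_pt (MObj.rel_of_step f) (t 0)).last]
        convert h' using 1
        ext i
        fin_cases i
        exact MPath.last_coext _ _ _ (t 0)
      | 2, R, t, h => exact MPath.coext_step _ _ _ h
  map_pt := rfl

/-- The modal comonad. -/
def MComonad (σ : FirstOrder.Language.{0, 0}) [σ.IsRelational] (k : ℕ) :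
    Comonad (PtStruct.{u} σ) :=
  comonadOfKleisli (MObj σ k) (MCounit σ k) MCoext
    (fun _ => PtStruct.Hom.ext (Struct.hom_ext fun s =>
      MPath.coext_last rfl (fun _ _ _ h => MPath.rel_of_step h) s))
    (fun f => PtStruct.Hom.ext (Struct.hom_ext fun s => MPath.last_coext (Struct.fn f.hom) f.map_pt (MObj.rel_of_step f) s))
    (fun f g => PtStruct.Hom.ext (Struct.hom_ext fun s =>
      
      MPath.coext_coext (Struct.fn f.hom) f.map_pt (MObj.rel_of_step f) (Struct.fn g.hom) g.map_pt
        (MObj.rel_of_step g) (Struct.fn (MCoext f ≫ g).hom) (MCoext f ≫ g).map_pt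
        (MObj.rel_of_step (MCoext f ≫ g)) (fun _ => rfl) s))

/-! ### Paths, embeddings, open pathwise embeddings and positive bisimulations

These are defined for a category with a functor `U` to structures and a notion of path. -/

section Bisimulation

variable {σ : FirstOrder.Language.{0, 0}} {C : Type*} [Category C] (U : C ⥤ Struct.{u} σ)
  (IsPath : C → Prop)

/-- The underlying homomorphism is injective and reflects the relations. -/
def IsEmb {X Y : C} (f : X ⟶ Y) : Prop :=
  Function.Injective (Struct.fn (U.map f)) ∧
    ∀ (n : ℕ) (R : σ.Relations n) (t : Fin n → (U.obj X).carrier),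
      FirstOrder.Language.Structure.RelMap R (fun i => Struct.fn (U.map f) (t i)) →
        FirstOrder.Language.Structure.RelMap R t

/-- An embedding whose domain is a path. -/
def IsPathEmb {X Y : C} (f : X ⟶ Y) : Prop := IsPath X ∧ IsEmb U f

/-- The composite with every path embedding is a path embedding. -/
def IsPathwiseEmb {X Y : C} (f : X ⟶ Y) : Prop :=
  ∀ (P : C) (m : P ⟶ X), IsPathEmb U IsPath m → IsPathEmb U IsPath (m ≫ f)

/-- Every commutative square `m ≫ f = i ≫ n` of path embeddings `i`, `m`, `n` has a diagonal
filler. -/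
def IsOpenMor {X Y : C} (f : X ⟶ Y) : Prop :=
  ∀ (P Q : C) (m : P ⟶ X) (i : P ⟶ Q) (n : Q ⟶ Y),
    IsPathEmb U IsPath m → IsPathEmb U IsPath i → IsPathEmb U IsPath n → m ≫ f = i ≫ n →
      ∃ d : Q ⟶ X, i ≫ d = m ∧ d ≫ f = n

/-- There is a positive bisimulation from `X` to `Y`. -/
def PosBisim (X Y : C) : Prop :=
  ∃ (Z₁ Z₂ : C) (p : Z₁ ⟶ X) (h : Z₁ ⟶ Z₂) (q : Z₂ ⟶ Y),
    (IsOpenMor U IsPath p ∧ IsPathwiseEmb U IsPath p) ∧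
    (IsOpenMor U IsPath q ∧ IsPathwiseEmb U IsPath q) ∧
    Function.Bijective (Struct.fn (U.map h))

end Bisimulation

/-! ### The Eilenberg–Moore categories

A coalgebra `α` carries the forest order in which `x ≤ y` when `α x` is a prefix of `α y`. A path is
a coalgebra on which this order is finite and linear; the empty coalgebra is a path. -/

/-- The forest order of a coalgebra of the Ehrenfeucht–Fraïssé comonad. -/
def ELe {σ : FirstOrder.Language.{0, 0}} [σ.IsRelational] {k : ℕ}
    (X : (EComonad.{u} σ k).Coalgebra) (x y : X.A.carrier) : Prop :=
  (show ESeq k X.A.carrier from Struct.fn X.a x).val <+: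
    (show ESeq k X.A.carrier from Struct.fn X.a y).val

/-- The forest order of a coalgebra of the pebbling comonad. -/
def PLe {σ : FirstOrder.Language.{0, 0}} [σ.IsRelational] {k : ℕ}
    (X : (PComonad.{u} σ k).Coalgebra) (x y : X.A.carrier) : Prop :=
  (show PSeq k X.A.carrier from Struct.fn X.a x).val <+:
    (show PSeq k X.A.carrier from Struct.fn X.a y).val

/-- The tree order of a coalgebra of the modal comonad. -/
def MLe {σ : FirstOrder.Language.{0, 0}} [σ.IsRelational] {k : ℕ}
    (X : (MComonad.{u} σ k).Coalgebra) (x y : X.A.toStruct.carrier) : Prop :=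
  (show MPath k X.A from Struct.fn X.a.hom x).val <+:
    (show MPath k X.A from Struct.fn X.a.hom y).val

/-- Existence of a positive bisimulation in the category of coalgebras of the
Ehrenfeucht–Fraïssé comonad. -/
def EPosBisim {σ : FirstOrder.Language.{0, 0}} [σ.IsRelational] {k : ℕ}
    (X Y : (EComonad.{u} σ k).Coalgebra) : Prop :=
  PosBisim (EComonad.{u} σ k).forget
    (fun P => Finite P.A.carrier ∧ ∀ x y, ELe P x y ∨ ELe P y x) X Y

/-- Existence of a positive bisimulation in the category of coalgebras of the pebbling comonad. -/
def PPosBisim {σ : FirstOrder.Language.{0, 0}} [σ.IsRelational] {k : ℕ}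
    (X Y : (PComonad.{u} σ k).Coalgebra) : Prop :=
  PosBisim (PComonad.{u} σ k).forget
    (fun P => Finite P.A.carrier ∧ ∀ x y, PLe P x y ∨ PLe P y x) X Y

/-- Existence of a positive bisimulation in the category of coalgebras of the modal comonad. -/
def MPosBisim {σ : FirstOrder.Language.{0, 0}} [σ.IsRelational] {k : ℕ}
    (X Y : (MComonad.{u} σ k).Coalgebra) : Prop :=
  PosBisim ((MComonad.{u} σ k).forget ⋙ forgetPt σ)
    (fun P => Finite P.A.toStruct.carrier ∧ ∀ x y, MLe P x y ∨ MLe P y x) X Y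

end GameComonad

namespace GameComonad

open FirstOrder.Language.Structure (RelMap)

/-! ### Labelled forests -/

/-! All three equivalences pass through a positive game: Spoiler may move in either structure,
Duplicator answers in the other one, and the chosen pairs need only preserve relations from left to
right.

On the categorical side, a coalgebra of any of the three comonads is a structure with a labelled
forest order in which related elements are comparable. `ForestCat` records what the three categories
share, so that bisimulations are analysed once. Open pathwise embeddings are exactly the morphisms
that lift roots and children and reflect relations between comparable elements (`IsCover.isOpenMor`,
`IsCover.isPathwiseEmb`, `isCover_of_open`). Hence positive bisimulations amount to back-and-forth
relations (`posBisim_iff`). Given a bisimulation, relate `p z` to `q (h z)`. Given a relation, put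
two structures on the forest of related pairs, one pulled back from `X` and one from `Y`; the
identity on pairs is the bijective morphism `h`. Two structures are needed because preservation is
one-sided. On co-free coalgebras the nodes are sequences of moves, so a back-and-forth relation is a
winning strategy for Duplicator (`EPosBisim_cofree_iff`, `PPosBisim_cofree_iff`,
`MPosBisim_cofree_iff`).

On the logical side, a strategy preserves positive formulas by induction: forth moves serve `∃` and
`◇`, back moves serve `∀` and `□`. Conversely, if formulas are preserved, a good answer to `a` is
found by existentially quantifying a conjunction of formulas true of `a`, and a good answer to `b`
by universally quantifying a disjunction of formulas false of `b`. In infinitary logic these are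
indexed by the other structure. In first-order and modal logic they must be finite, and a finite
family of formulas that decides the game is built by induction on the number of rounds
(`exists_family`, `exists_modal_family`).

Equality atoms are matched by the symbol `I`: preserving the diagonal means that the pairs in play
form a partial function (`PHom_J_iff`). Modal logic has no equality and needs no `I`. -/

/-- A labelled forest of finite height: `par y x` says that `y` is the parent of `x`. -/
structure Forest (Λ : Type) (X : Type u) where
  par : X → X → Prop
  ht : X → ℕ
  lab : X → Λ
  ht_of_par : ∀ {x y}, par y x → ht x = ht y + 1
  par_unique : ∀ {x y y'}, par y x → par y' x → y = y'
  exists_par : ∀ {x}, ht x ≠ 0 → ∃ y, par y x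

/-- A map that preserves parents, heights and labels. -/
structure Forest.IsMap {Λ : Type} {X Y : Type u} (F : Forest Λ X) (G : Forest Λ Y)
    (f : X → Y) : Prop where
  par : ∀ {x y}, F.par x y → G.par (f x) (f y)
  ht : ∀ x, G.ht (f x) = F.ht x
  lab : ∀ x, G.lab (f x) = F.lab x

namespace Forest

variable {Λ : Type} {X Y : Type u} (F : Forest Λ X) {G : Forest Λ Y}

/-- The order of a forest. -/
def le (x y : X) : Prop := Relation.ReflTransGen F.par x y

variable {F}

theorem le.refl (x : X) : F.le x x := Relation.ReflTransGen.refl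

theorem le.trans {x y z : X} (h : F.le x y) (h' : F.le y z) : F.le x z :=
  Relation.ReflTransGen.trans h h'

theorem le.tail {x y z : X} (h : F.le x y) (h' : F.par y z) : F.le x z :=
  Relation.ReflTransGen.tail h h'

theorem le_of_par {x y : X} (h : F.par x y) : F.le x y := Relation.ReflTransGen.single h

theorem le.ht {x y : X} (h : F.le x y) : F.ht x ≤ F.ht y := by
  induction h with
  | refl => exact le_rfl
  | tail _ h ih => have := F.ht_of_par h; omega

theorem le.eq_or {x y z : X} (h : F.le x z) (hp : F.par y z) : x = z ∨ F.le x y := by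
  rcases Relation.ReflTransGen.cases_tail h with h | ⟨y', h, h'⟩
  · exact .inl h.symm
  · rw [F.par_unique hp h']; exact .inr h

theorem le.eq_of_ht {x y : X} (h : F.le x y) (e : F.ht y ≤ F.ht x) : x = y := by
  rcases Relation.ReflTransGen.cases_tail h with h | ⟨y', h, h'⟩
  · exact h.symm
  · have := F.ht_of_par h'; have := le.ht h; omega

theorem le.total {x y z : X} (h : F.le x z) (h' : F.le y z) : F.le x y ∨ F.le y x := by
  induction h with
  | refl => exact .inr h'
  | tail h hp ih =>
    rcases le.eq_or h' hp with rfl | h''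
    · exact .inl (le.tail h hp)
    · exact ih h''

/-- Heights separate the elements of a chain. This gives injectivity of forest maps on paths,
finiteness of branches, and the identification of lifted tuples. -/
theorem eq_of_comparable {x y : X} (h : F.le x y ∨ F.le y x) (e : F.ht x = F.ht y) : x = y :=
  h.elim (fun h => h.eq_of_ht e.ge) fun h => (h.eq_of_ht e.le).symm

theorem le.of_ht {x y : X} (h : F.le x y ∨ F.le y x) (e : F.ht x ≤ F.ht y) : F.le x y := by
  rcases h with h | h
  · exact h
  · rw [h.eq_of_ht e]; exact le.refl x

theorem par_of_comparable {x y : X} (h : F.le x y ∨ F.le y x) (e : F.ht y = F.ht x + 1) :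
    F.par x y := by
  obtain ⟨x', hx'⟩ := F.exists_par (x := y) (by omega)
  rcases (le.of_ht h (by omega)).eq_or hx' with rfl | h
  · omega
  · have := F.ht_of_par hx'
    rwa [h.eq_of_ht (by omega)]

theorem exists_le_ht {x : X} {n : ℕ} (h : n ≤ F.ht x) : ∃ y, F.le y x ∧ F.ht y = n := by
  induction e : F.ht x generalizing x with
  | zero => exact ⟨x, le.refl x, by omega⟩
  | succ m ih =>
    by_cases hn : n = m + 1
    · exact ⟨x, le.refl x, by omega⟩
    · obtain ⟨y, hy⟩ := F.exists_par (x := x) (by omega)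
      have := F.ht_of_par hy
      obtain ⟨z, hz, h⟩ := ih (x := y) (by omega) (by omega)
      exact ⟨z, hz.tail hy, h⟩

/-- Induction along a forest. -/
theorem induct {p : X → Prop} (root : ∀ x, F.ht x = 0 → p x)
    (step : ∀ x y, F.par y x → p y → p x) (x : X) : p x := by
  induction e : F.ht x generalizing x with
  | zero => exact root x e
  | succ m ih =>
    obtain ⟨y, hy⟩ := F.exists_par (x := x) (by omega)
    have := F.ht_of_par hy
    exact step x y hy (ih y (by omega))

theorem IsMap.le {f : X → Y} (h : F.IsMap G f) {x y : X} (hxy : F.le x y) :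
    G.le (f x) (f y) := by
  induction hxy with
  | refl => exact le.refl _
  | tail _ hp ih => exact ih.tail (h.par hp)

theorem IsMap.comparable {f : X → Y} (h : F.IsMap G f) {x y : X}
    (hxy : F.le x y ∨ F.le y x) : G.le (f x) (f y) ∨ G.le (f y) (f x) :=
  hxy.imp h.le h.le

/-- Heights are preserved, so `x` is not a root, and its parent goes to the unique parent of `f x`.
In particular the image of a forest map is closed under parents. -/
theorem IsMap.exists_par {f : X → Y} (h : F.IsMap G f) {x : X} {y' : Y}
    (hp : G.par y' (f x)) : ∃ y, F.par y x ∧ f y = y' := by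
  have := G.ht_of_par hp
  have := h.ht x
  obtain ⟨y, hy⟩ := F.exists_par (x := x) (by omega)
  exact ⟨y, hy, G.par_unique (h.par hy) hp⟩

/-- A dependent choice along a forest. -/
theorem exists_map {Z : Type u} {p : X → Z → Prop} {r : Z → Z → Prop}
    (root : ∀ x, F.ht x = 0 → ∃ z, p x z)
    (step : ∀ x y z, F.par y x → p y z → ∃ z', p x z' ∧ r z z') :
    ∃ f : X → Z, (∀ x, p x (f x)) ∧ ∀ x y, F.par y x → r (f y) (f x) := by
  classical
  -- Recursion on the height. The subtype carries `p` along because `step` asks for `p` at the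
  -- parent.
  let q : ∀ x, {z // p x z} := (measure F.ht).wf.fix fun x ih =>
    if h : F.ht x = 0 then ⟨_, (root x h).choose_spec⟩ else
      let y := (F.exists_par h).choose
      have hy : F.par y x := (F.exists_par h).choose_spec
      have hlt : (measure F.ht).rel y x := by
        change F.ht y < F.ht x
        rw [F.ht_of_par hy]
        omega
      ⟨_, (step x y (ih y hlt).1 hy (ih y hlt).2).choose_spec.1⟩
  refine ⟨fun x => (q x).1, fun x => (q x).2, fun x y hy => ?_⟩
  have h : F.ht x ≠ 0 := by rw [F.ht_of_par hy]; omega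
  -- The recursion used some chosen parent of `x`; by uniqueness it is `y`.
  obtain rfl : y = (F.exists_par h).choose := F.par_unique hy (F.exists_par h).choose_spec
  have e : q x = _ := (measure F.ht).wf.fix_eq _ x
  change r _ (q x).1
  rw [e, dif_neg h]
  exact (step x _ _ hy (q _).2).choose_spec.2

/-- The elements below an element form a finite set. -/
theorem finite_below (x : X) : Finite {y // F.le y x} := by
  refine Finite.of_injective (β := Fin (F.ht x + 1))
    (fun y => ⟨F.ht y.1, Nat.lt_succ_of_le y.2.ht⟩) fun y z h => Subtype.ext ?_
  exact eq_of_comparable (y.2.total z.2) (congrArg Fin.val h)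

variable (F)

/-- The restriction of a forest to a downward closed set. -/
def restrict (D : X → Prop) (hD : ∀ x y, F.par y x → D x → D y) : Forest Λ {x // D x} where
  par x y := F.par x.1 y.1
  ht x := F.ht x.1
  lab x := F.lab x.1
  ht_of_par h := F.ht_of_par h
  par_unique h h' := Subtype.ext (F.par_unique h h')
  exists_par {x} h := by
    obtain ⟨y, hy⟩ := F.exists_par h
    exact ⟨⟨y, hD _ _ hy x.2⟩, hy⟩

theorem restrict_isMap (D : X → Prop) (hD) : (F.restrict D hD).IsMap F Subtype.val :=
  ⟨fun h => h, fun _ => rfl, fun _ => rfl⟩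

variable {F}

theorem restrict_le {D : X → Prop} {hD} {x y : {x // D x}} (h : F.le x.1 y.1) :
    (F.restrict D hD).le x y := by
  obtain ⟨y, hy⟩ := y
  change F.le x.1 y at h
  induction h with
  | refl => exact le.refl _
  | tail _ hp ih => exact (ih (hD _ _ hp hy)).tail hp

/-- A nonempty finite tuple of pairwise comparable elements has a greatest one. -/
theorem exists_max {n : ℕ} {t : Fin n → X} (hn : n ≠ 0)
    (h : ∀ i j, F.le (t i) (t j) ∨ F.le (t j) (t i)) : ∃ j, ∀ i, F.le (t i) (t j) := by
  have : Nonempty (Fin n) := ⟨⟨0, Nat.pos_of_ne_zero hn⟩⟩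
  obtain ⟨j, hj⟩ := Finite.exists_max fun i => F.ht (t i)
  exact ⟨j, fun i => le.of_ht (h i j) (hj i)⟩

end Forest

/-! ### Categories of forest-ordered structures -/

/-- `C` is, by way of the functor `U`, the category of structures with a compatible labelled
forest order. If `rooted` holds, the forests are trees. -/
structure ForestCat {τ : FirstOrder.Language.{0, 0}} {C : Type*} [Category C]
    (U : C ⥤ Struct.{u} τ) (Λ : Type) (rooted : Prop) where
  forest : ∀ X : C, Forest Λ (U.obj X).carrier
  isMap : ∀ {X Y : C} (f : X ⟶ Y), (forest X).IsMap (forest Y) (Struct.fn (U.map f))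
  hom_ext : ∀ {X Y : C} {f g : X ⟶ Y},
    (∀ x, Struct.fn (U.map f) x = Struct.fn (U.map g) x) → f = g
  lift : ∀ {X Y : C} (g : U.obj X ⟶ U.obj Y), (forest X).IsMap (forest Y) (Struct.fn g) →
    ∃ f : X ⟶ Y, U.map f = g
  comparable : ∀ {X : C} {n : ℕ} {R : τ.Relations n} {t : Fin n → (U.obj X).carrier},
    RelMap R t → ∀ i j, (forest X).le (t i) (t j) ∨ (forest X).le (t j) (t i)
  -- The pointed case, where coalgebras are trees. When `rooted` fails, the empty object is
  -- available as a path.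
  root : rooted → ∀ X : C, (∃ x, (forest X).ht x = 0) ∧
    ∀ x y, (forest X).ht x = 0 → (forest X).ht y = 0 → x = y
  -- Relations are pulled back along `π` and then cut down to comparable tuples, since related
  -- elements of an object have to be comparable.
  pull : ∀ (X : C) (Z : Type u) (F : Forest Λ Z) (π : Z → (U.obj X).carrier),
    F.IsMap (forest X) π → (rooted → Nonempty Z ∧ ∀ x y, F.ht x = 0 → F.ht y = 0 → x = y) →
    ∃ (W : C) (e : Z ≃ (U.obj W).carrier), F.IsMap (forest W) e ∧
      ∀ {n : ℕ} (R : τ.Relations n) (t : Fin n → Z), RelMap R (fun i => e (t i)) ↔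
        (∀ i j, F.le (t i) (t j) ∨ F.le (t j) (t i)) ∧ RelMap R fun i => π (t i)

theorem Forest.IsMap.symm {Λ : Type} {X Y : Type u} {F : Forest Λ X} {G : Forest Λ Y} {e : X ≃ Y}
    (h : F.IsMap G e) : G.IsMap F e.symm where
  par {x y} hp := by
    obtain ⟨x, rfl⟩ := e.surjective x
    obtain ⟨y, rfl⟩ := e.surjective y
    obtain ⟨z, hz, e'⟩ := h.exists_par hp
    simpa [← e.injective e'] using hz
  ht x := by simpa using (h.ht (e.symm x)).symm
  lab x := by simpa using (h.lab (e.symm x)).symm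

theorem Forest.IsMap.comp {Λ : Type} {X Y Z : Type u} {F : Forest Λ X} {G : Forest Λ Y}
    {H : Forest Λ Z} {f : X → Y} {g : Y → Z} (hf : F.IsMap G f) (hg : G.IsMap H g) :
    F.IsMap H (g ∘ f) where
  par h := hg.par (hf.par h)
  ht x := (hg.ht _).trans (hf.ht x)
  lab x := (hg.lab _).trans (hf.lab x)

namespace ForestCat

section

variable {τ : FirstOrder.Language.{0, 0}} {C : Type*} [Category C]
  {U : C ⥤ Struct.{u} τ} {Λ : Type} {rooted : Prop}

theorem fn_comp {X Y Z : C} (f : X ⟶ Y) (g : Y ⟶ Z) (x : (U.obj X).carrier) :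
    Struct.fn (U.map (f ≫ g)) x = Struct.fn (U.map g) (Struct.fn (U.map f) x) := by
  rw [U.map_comp]; rfl

theorem fn_eq_of_comp_eq {X Y Y' Z : C} {f : X ⟶ Y} {g : Y ⟶ Z} {f' : X ⟶ Y'} {g' : Y' ⟶ Z}
    (h : f ≫ g = f' ≫ g') (x : (U.obj X).carrier) :
    Struct.fn (U.map g) (Struct.fn (U.map f) x) =
      Struct.fn (U.map g') (Struct.fn (U.map f') x) := by
  rw [← fn_comp, h, fn_comp]

/-- The paths: the objects on which the order is finite and linear. -/
def IsPath (𝓕 : ForestCat U Λ rooted) (P : C) : Prop :=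
  Finite (U.obj P).carrier ∧ ∀ x y, (𝓕.forest P).le x y ∨ (𝓕.forest P).le y x

/-- A back-and-forth relation between the forests of two objects. -/
structure GameRel (𝓕 : ForestCat U Λ rooted) (X Y : C)
    (r : (U.obj X).carrier → (U.obj Y).carrier → Prop) : Prop where
  lab : ∀ {x y}, r x y → (𝓕.forest X).lab x = (𝓕.forest Y).lab y
  ht : ∀ {x y}, r x y → (𝓕.forest X).ht x = (𝓕.forest Y).ht y
  par : ∀ {x y x' y'}, r x y → (𝓕.forest X).par x' x → (𝓕.forest Y).par y' y → r x' y'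
  forth : ∀ {x y x'}, r x y → (𝓕.forest X).par x x' → ∃ y', (𝓕.forest Y).par y y' ∧ r x' y'
  back : ∀ {x y y'}, r x y → (𝓕.forest Y).par y y' → ∃ x', (𝓕.forest X).par x x' ∧ r x' y'
  root_forth : ∀ {x}, (𝓕.forest X).ht x = 0 → ∃ y, (𝓕.forest Y).ht y = 0 ∧ r x y
  root_back : ∀ {y}, (𝓕.forest Y).ht y = 0 → ∃ x, (𝓕.forest X).ht x = 0 ∧ r x y
  -- Only greatest entries need to be related by `r`; equal heights make the other entries
  -- corresponding ancestors. For `n = 0` the condition is empty, so nullary symbols are preserved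
  -- outright.
  rel : ∀ {n : ℕ} {R : τ.Relations n} {t : Fin n → (U.obj X).carrier}
    {t' : Fin n → (U.obj Y).carrier},
    (n ≠ 0 → ∃ j, r (t j) (t' j) ∧ ∀ i, (𝓕.forest X).le (t i) (t j) ∧
      (𝓕.forest Y).le (t' i) (t' j) ∧ (𝓕.forest X).ht (t i) = (𝓕.forest Y).ht (t' i)) →
    RelMap R t → RelMap R t'

/-- `f` is a fibration of forests that reflects relations between comparable elements. -/
structure IsCover (𝓕 : ForestCat U Λ rooted) {X Y : C} (f : X ⟶ Y) : Prop where
  par : ∀ {x y}, (𝓕.forest Y).par (Struct.fn (U.map f) x) y →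
    ∃ x', (𝓕.forest X).par x x' ∧ Struct.fn (U.map f) x' = y
  root : ∀ {y}, (𝓕.forest Y).ht y = 0 →
    ∃ x, (𝓕.forest X).ht x = 0 ∧ Struct.fn (U.map f) x = y
  rel : ∀ {n : ℕ} {R : τ.Relations n} {t : Fin n → (U.obj X).carrier},
    (∀ i j, (𝓕.forest X).le (t i) (t j) ∨ (𝓕.forest X).le (t j) (t i)) →
    RelMap R (fun i => Struct.fn (U.map f) (t i)) → RelMap R t

/-- The elements of a path are pairwise comparable, so injectivity comes from preservation of
heights and reflection from `IsCover.rel`. -/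
theorem IsCover.isPathwiseEmb {𝓕 : ForestCat U Λ rooted} {X Y : C} {f : X ⟶ Y}
    (h : 𝓕.IsCover f) : IsPathwiseEmb U 𝓕.IsPath f := by
  refine fun P m hm => ⟨hm.1, fun x y e => ?_, fun n R t ht => ?_⟩
  · have e' := congrArg (𝓕.forest Y).ht e
    rw [(𝓕.isMap _).ht, (𝓕.isMap _).ht] at e'
    exact Forest.eq_of_comparable (hm.1.2 x y) e'
  · refine hm.2.2 n R t (h.rel (fun i j => (𝓕.isMap m).comparable (hm.1.2 _ _)) ?_)
    simpa only [fn_comp] using ht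

theorem isEmb_of_comp {X Y Z : C} {f : X ⟶ Y} {g : Y ⟶ Z} (h : IsEmb U (f ≫ g)) : IsEmb U f := by
  refine ⟨fun x y e => h.1 (by rw [fn_comp, fn_comp, e]), fun n R t ht => h.2 n R t ?_⟩
  simp only [fn_comp]
  exact Struct.fn_rel (U.map g) R _ ht

/-- Relations of a pulled-back object are reflected by construction, so only the lifting of children
and of roots is left to assume. -/
theorem isCover_over (𝓕 : ForestCat U Λ rooted) {X W : C} {Z : Type u} {F : Forest Λ Z}
    {π : Z → (U.obj X).carrier} {e : Z ≃ (U.obj W).carrier} {f : W ⟶ X}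
    (he : F.IsMap (𝓕.forest W) e) (hf : ∀ z, Struct.fn (U.map f) (e z) = π z)
    (hR : ∀ {n : ℕ} (R : τ.Relations n) (t : Fin n → Z), RelMap R (fun i => e (t i)) ↔
        (∀ i j, F.le (t i) (t j) ∨ F.le (t j) (t i)) ∧ RelMap R fun i => π (t i))
    (hp : ∀ z x, (𝓕.forest X).par (π z) x → ∃ z', F.par z z' ∧ π z' = x)
    (hr : ∀ x, (𝓕.forest X).ht x = 0 → ∃ z, F.ht z = 0 ∧ π z = x) : 𝓕.IsCover f := by
  refine ⟨fun {x y} hxy => ?_, fun {y} hy => ?_, fun {n R t} hc ht => ?_⟩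
  · obtain ⟨z, rfl⟩ := e.surjective x
    rw [hf] at hxy
    obtain ⟨z', hz', rfl⟩ := hp z y hxy
    exact ⟨e z', he.par hz', hf z'⟩
  · obtain ⟨z, hz, rfl⟩ := hr y hy
    exact ⟨e z, by rw [he.ht, hz], hf z⟩
  · have h := (hR R fun i => e.symm (t i)).2
      ⟨fun i j => he.symm.comparable (hc i j), by
        convert ht using 2 with i
        rw [← hf, e.apply_symm_apply]⟩
    simpa using h

end

/-! ### Open pathwise embeddings as covers, and positive bisimulations as back-and-forth relations
-/

section

variable {τ : FirstOrder.Language.{0, 0}} [τ.IsRelational] {C : Type*} [Category C]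
  {U : C ⥤ Struct.{u} τ} {Λ : Type} {rooted : Prop}

/-- The filler is chosen node by node. On the image of `i` it is forced by `m`; elsewhere `f` lifts
children and roots. The choices fit together because the image of `i` is closed under parents. The
result preserves relations because related elements of `Q` are comparable and `f` reflects relations
between comparable elements. -/
theorem IsCover.isOpenMor {𝓕 : ForestCat U Λ rooted} {X Y : C} {f : X ⟶ Y}
    (h : 𝓕.IsCover f) : IsOpenMor U 𝓕.IsPath f := by
  intro P Q m i n hm hi hn e
  have e' := fn_eq_of_comp_eq (U := U) e
  obtain ⟨d, hd, hd'⟩ := (𝓕.forest Q).exists_map (Z := (U.obj X).carrier)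
    (p := fun q x => Struct.fn (U.map f) x = Struct.fn (U.map n) q ∧
      ∀ p, Struct.fn (U.map i) p = q → x = Struct.fn (U.map m) p)
    (r := (𝓕.forest X).par)
    (fun q hq => by
      by_cases hp : ∃ p, Struct.fn (U.map i) p = q
      · obtain ⟨p, rfl⟩ := hp
        exact ⟨_, e' p, fun p' hp' => by rw [hi.2.1 hp']⟩
      · obtain ⟨x, -, hx⟩ := h.root (y := Struct.fn (U.map n) q) (by rw [(𝓕.isMap n).ht, hq])
        exact ⟨x, hx, fun p hp' => (hp ⟨p, hp'⟩).elim⟩)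
    (fun q q' x hq hx => by
      by_cases hp : ∃ p, Struct.fn (U.map i) p = q
      · obtain ⟨p, rfl⟩ := hp
        obtain ⟨p', hp', rfl⟩ := (𝓕.isMap i).exists_par hq
        refine ⟨_, ⟨e' p, fun p' hp' => by rw [hi.2.1 hp']⟩, ?_⟩
        rw [hx.2 p' rfl]
        exact (𝓕.isMap m).par hp'
      · obtain ⟨x', hx', hx''⟩ := h.par (x := x) (y := Struct.fn (U.map n) q) (by
          rw [hx.1]; exact (𝓕.isMap n).par hq)
        exact ⟨x', ⟨hx'', fun p hp' => (hp ⟨p, hp'⟩).elim⟩, hx'⟩)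
  have hmap : (𝓕.forest Q).IsMap (𝓕.forest X) d :=
    ⟨fun hp => hd' _ _ hp, fun q => by rw [← (𝓕.isMap f).ht, (hd q).1, (𝓕.isMap n).ht],
      fun q => by rw [← (𝓕.isMap f).lab, (hd q).1, (𝓕.isMap n).lab]⟩
  obtain ⟨d', hd''⟩ := 𝓕.lift (X := Q) (Y := X) (Struct.mkHom d fun {k} R t ht => by
    refine h.rel (fun i j => hmap.comparable (𝓕.comparable ht i j)) ?_
    simp only [(hd _).1]
    exact Struct.fn_rel (U.map n) R t ht) hmap
  have hfn : ∀ q, Struct.fn (U.map d') q = d q := fun q => by rw [hd'']; rfl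
  refine ⟨d', 𝓕.hom_ext fun p => ?_, 𝓕.hom_ext fun q => ?_⟩
  · rw [fn_comp, hfn]; exact (hd _).2 p rfl
  · rw [fn_comp, hfn]; exact (hd q).1

/-- The object with a prescribed forest over the forest of an object. -/
theorem exists_over (𝓕 : ForestCat U Λ rooted) (X : C) {Z : Type u} (F : Forest Λ Z)
    (π : Z → (U.obj X).carrier) (hπ : F.IsMap (𝓕.forest X) π)
    (hr : rooted → Nonempty Z ∧ ∀ x y, F.ht x = 0 → F.ht y = 0 → x = y) :
    ∃ (W : C) (e : Z ≃ (U.obj W).carrier) (f : W ⟶ X), F.IsMap (𝓕.forest W) e ∧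
      (∀ z, Struct.fn (U.map f) (e z) = π z) ∧
      ∀ {n : ℕ} (R : τ.Relations n) (t : Fin n → Z), RelMap R (fun i => e (t i)) ↔
        (∀ i j, F.le (t i) (t j) ∨ F.le (t j) (t i)) ∧ RelMap R fun i => π (t i) := by
  obtain ⟨W, e, he, hR⟩ := 𝓕.pull X Z F π hπ hr
  obtain ⟨f, hf⟩ := 𝓕.lift (X := W) (Y := X) (Struct.mkHom (π ∘ e.symm) fun {n} R t ht => by
    refine ((hR R fun i => e.symm (t i)).1 ?_).2
    simpa using ht) (he.symm.comp hπ)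
  refine ⟨W, e, f, he, fun z => ?_, hR⟩
  rw [hf]
  exact congrArg π (e.symm_apply_apply z)

/-- The path on a finite down-closed chain. -/
theorem exists_path (𝓕 : ForestCat U Λ rooted) (X : C) (D : (U.obj X).carrier → Prop)
    (hD : ∀ x y, (𝓕.forest X).par y x → D x → D y) (hf : Finite {x // D x})
    (hc : ∀ x y, D x → D y → (𝓕.forest X).le x y ∨ (𝓕.forest X).le y x)
    (hne : rooted → ∃ x, D x) :
    ∃ (P : C) (m : P ⟶ X), IsPathEmb U 𝓕.IsPath m ∧
      ∀ x, D x ↔ ∃ p, Struct.fn (U.map m) p = x := by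
  obtain ⟨W, e, f, he, hf', hR⟩ := 𝓕.exists_over X ((𝓕.forest X).restrict D hD) Subtype.val
    (Forest.restrict_isMap _ _ _) fun h => ⟨let ⟨x, hx⟩ := hne h; ⟨⟨x, hx⟩⟩,
      fun x y hx hy => Subtype.ext ((𝓕.root h X).2 _ _ hx hy)⟩
  have hc' : ∀ x y, ((𝓕.forest X).restrict D hD).le x y ∨ ((𝓕.forest X).restrict D hD).le y x :=
    fun x y => (hc _ _ x.2 y.2).imp Forest.restrict_le Forest.restrict_le
  refine ⟨W, f, ⟨⟨Finite.of_equiv _ e, fun x y => ?_⟩, fun x y h => ?_, fun n R t ht => ?_⟩,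
    fun x => ⟨fun hx => ⟨e ⟨x, hx⟩, hf' _⟩, ?_⟩⟩
  · have := he.comparable (hc' (e.symm x) (e.symm y))
    simpa using this
  · obtain ⟨x, rfl⟩ := e.surjective x
    obtain ⟨y, rfl⟩ := e.surjective y
    rw [hf', hf'] at h
    rw [Subtype.ext h]
  · have h := (hR R fun i => e.symm (t i)).2 ⟨fun i j => hc' _ _, by
      convert ht using 2 with i
      rw [← hf', e.apply_symm_apply]⟩
    simpa using h
  · rintro ⟨p, rfl⟩
    obtain ⟨z, rfl⟩ := e.surjective p
    rw [hf']
    exact z.2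

theorem exists_path_below (𝓕 : ForestCat U Λ rooted) (X : C) (x : (U.obj X).carrier) :
    ∃ (P : C) (m : P ⟶ X), IsPathEmb U 𝓕.IsPath m ∧
      ∀ y, (𝓕.forest X).le y x ↔ ∃ p, Struct.fn (U.map m) p = y :=
  𝓕.exists_path X (fun y => (𝓕.forest X).le y x)
    (fun _ _ hp h => (Forest.le_of_par hp).trans h) (Forest.finite_below x)
    (fun _ _ h h' => h.total h') fun _ => ⟨x, .refl x⟩

/-- A morphism between the domains of embeddings is given by inclusion of the images. -/
theorem exists_factor (𝓕 : ForestCat U Λ rooted) {P Q X : C} {m : P ⟶ X} {n : Q ⟶ X}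
    (hQ : IsPathEmb U 𝓕.IsPath n)
    (h : ∀ p, ∃ q, Struct.fn (U.map n) q = Struct.fn (U.map m) p) : ∃ i : P ⟶ Q, m = i ≫ n := by
  choose g hg using h
  have hmap : (𝓕.forest P).IsMap (𝓕.forest Q) g :=
    { ht := fun p => by rw [← (𝓕.isMap n).ht, hg, (𝓕.isMap m).ht]
      lab := fun p => by rw [← (𝓕.isMap n).lab, hg, (𝓕.isMap m).lab]
      par := fun {x y} hp => by
        have := (𝓕.isMap m).par hp
        rw [← hg y, ← hg x] at this
        obtain ⟨q, hq, e⟩ := (𝓕.isMap n).exists_par this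
        rwa [hQ.2.1 e] at hq }
  obtain ⟨i, hi⟩ := 𝓕.lift (X := P) (Y := Q) (Struct.mkHom g fun R t ht => by
    refine hQ.2.2 _ R _ ?_
    simp only [hg]
    exact Struct.fn_rel (U.map m) R t ht) hmap
  refine ⟨i, 𝓕.hom_ext fun p => ?_⟩
  rw [fn_comp, hi]
  exact (hg p).symm

/-- To lift a child `y` of `f x`, compare the path below `x` with the path below `y`: a filler sends
the top of the latter to a child of `x`. For reflection, a comparable tuple lies on the path below
its greatest entry, and `f` restricts to an embedding there. -/
theorem isCover_of_open (𝓕 : ForestCat U Λ rooted) {X Y : C} {f : X ⟶ Y}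
    (ho : IsOpenMor U 𝓕.IsPath f) (hp : IsPathwiseEmb U 𝓕.IsPath f) : 𝓕.IsCover f := by
  -- Stated for an arbitrary path `m` whose image lies below `y`, so that the empty path is
  -- included; that case lifts roots.
  have key : ∀ (P : C) (m : P ⟶ X), IsPathEmb U 𝓕.IsPath m → ∀ y,
      (∀ p, (𝓕.forest Y).le (Struct.fn (U.map f) (Struct.fn (U.map m) p)) y) →
      ∃ x, Struct.fn (U.map f) x = y ∧ ∀ p x', (𝓕.forest Y).par
        (Struct.fn (U.map f) (Struct.fn (U.map m) p)) y → x' = Struct.fn (U.map m) p →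
        (𝓕.forest X).par x' x := by
    intro P m hm y hy
    obtain ⟨Q, n, hn, hQ⟩ := 𝓕.exists_path_below Y y
    obtain ⟨i, hi⟩ := 𝓕.exists_factor (m := m ≫ f) hn fun p => by
      rw [fn_comp]; exact (hQ _).1 (hy p)
    -- The square is admissible only if `i` is an embedding. This follows from `m ≫ f` being one,
    -- which is where `f` must be a pathwise embedding.
    have hmf := hp P m hm
    have hi' : IsEmb U i := by
      have h := hmf.2
      rw [hi] at h
      exact isEmb_of_comp h
    obtain ⟨d, hd, hd'⟩ := ho P Q m i n hm ⟨hm.1, hi'⟩ hn hi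
    obtain ⟨q, rfl⟩ := (hQ y).1 (.refl y)
    refine ⟨Struct.fn (U.map d) q, by rw [← fn_comp, hd'], ?_⟩
    rintro p _ hpar rfl
    rw [fn_eq_of_comp_eq hi] at hpar
    obtain ⟨q', hq', e⟩ := (𝓕.isMap n).exists_par hpar
    rw [← hd, fn_comp, ← hn.2.1 e]
    exact (𝓕.isMap d).par hq'
  refine ⟨fun {x y} hxy => ?_, fun {y} hy => ?_, fun {n R t} hc ht => ?_⟩
  · obtain ⟨P, m, hm, hP⟩ := 𝓕.exists_path_below X x
    obtain ⟨p, hp'⟩ := (hP x).1 (.refl x)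
    obtain ⟨x', hx', h⟩ := key P m hm y fun p' =>
      ((𝓕.isMap f).le ((hP _).2 ⟨p', rfl⟩)).tail hxy
    exact ⟨x', h p x (by rwa [hp']) hp'.symm, hx'⟩
  · by_cases hr : rooted
    · obtain ⟨x, hx⟩ := (𝓕.root hr X).1
      exact ⟨x, hx, (𝓕.root hr Y).2 _ _ (by rw [(𝓕.isMap f).ht, hx]) hy⟩
    -- Without distinguished roots, the square that starts at the empty path lifts `y`.
    · obtain ⟨P, m, hm, hP⟩ := 𝓕.exists_path X (fun _ => False) (fun _ _ _ h => h)
        (Finite.of_injective (β := Fin 0) (fun x => x.2.elim) fun x => x.2.elim)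
        (fun _ _ h => h.elim) fun h => (hr h).elim
      obtain ⟨x, hx, -⟩ := key P m hm y fun p => ((hP _).2 ⟨p, rfl⟩).elim
      exact ⟨x, by rw [← (𝓕.isMap f).ht, hx, hy], hx⟩
  · have main : ∀ (P : C) (m : P ⟶ X), IsPathEmb U 𝓕.IsPath m →
        (∀ i, ∃ p, Struct.fn (U.map m) p = t i) → RelMap R t := by
      intro P m hm h
      choose s hs using h
      have e : t = fun i => Struct.fn (U.map m) (s i) := funext fun i => (hs i).symm
      subst e
      refine Struct.fn_rel (U.map m) R s ((hp P m hm).2.2 n R s ?_)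
      simpa only [fn_comp] using ht
    -- A nullary tuple has no greatest entry. Any path reflects its relation: the path below the
    -- root, or the empty one.
    by_cases hn : n = 0
    · subst hn
      by_cases hr : rooted
      · obtain ⟨x, hx⟩ := (𝓕.root hr X).1
        obtain ⟨P, m, hm, -⟩ := 𝓕.exists_path_below X x
        exact main P m hm fun i => i.elim0
      · obtain ⟨P, m, hm, hP⟩ := 𝓕.exists_path X (fun _ => False) (fun _ _ _ h => h)
          (Finite.of_injective (β := Fin 0) (fun x => x.2.elim) fun x => x.2.elim)
          (fun _ _ h => h.elim) fun h => (hr h).elim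
        exact main P m hm fun i => i.elim0
    · obtain ⟨j, hj⟩ := Forest.exists_max hn hc
      obtain ⟨P, m, hm, hP⟩ := 𝓕.exists_path_below X (t j)
      exact main P m hm fun i => (hP _).1 (hj i)

/-- The relation consists of the pairs of `p z` and `q (h z)`. The cover `p` lifts moves in `X`, the
cover `q` lifts moves in `Y`, and bijectivity of `h` carries the latter back to `Z₁`. -/
theorem gameRel_of_posBisim (𝓕 : ForestCat U Λ rooted) {X Y : C}
    (h : PosBisim U 𝓕.IsPath X Y) : ∃ r, 𝓕.GameRel X Y r := by
  obtain ⟨Z₁, Z₂, p, h, q, ⟨hp, hp'⟩, ⟨hq, hq'⟩, hb⟩ := h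
  have cp := 𝓕.isCover_of_open hp hp'
  have cq := 𝓕.isCover_of_open hq hq'
  let g : (U.obj Z₁).carrier → (U.obj Y).carrier :=
    fun z => Struct.fn (U.map q) (Struct.fn (U.map h) z)
  have mp := 𝓕.isMap p
  have mh := 𝓕.isMap h
  have mg : (𝓕.forest Z₁).IsMap (𝓕.forest Y) g := mh.comp (𝓕.isMap q)
  refine ⟨fun x y => ∃ z, Struct.fn (U.map p) z = x ∧ g z = y, ?_, ?_, ?_, ?_, ?_, ?_, ?_, ?_⟩
  · rintro _ _ ⟨z, rfl, rfl⟩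
    rw [mp.lab, mg.lab]
  · rintro _ _ ⟨z, rfl, rfl⟩
    rw [mp.ht, mg.ht]
  · rintro _ _ x' y' ⟨z, rfl, rfl⟩ hx hy
    obtain ⟨z', hz', e⟩ := mp.exists_par hx
    exact ⟨z', e, (𝓕.forest Y).par_unique (mg.par hz') hy⟩
  · rintro _ _ x' ⟨z, rfl, rfl⟩ hx
    obtain ⟨z', hz', e⟩ := cp.par hx
    exact ⟨g z', mg.par hz', z', e, rfl⟩
  · rintro _ _ y' ⟨z, rfl, rfl⟩ hy
    obtain ⟨w', hw', e⟩ := cq.par hy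
    -- Surjectivity of `h` brings `w'` into `Z₁`, and injectivity shows that the parent found there
    -- is `z`.
    obtain ⟨z', rfl⟩ := hb.2 w'
    obtain ⟨z'', hz'', e'⟩ := mh.exists_par hw'
    rw [hb.1 e'] at hz''
    exact ⟨_, mp.par hz'', z', rfl, e⟩
  · intro x hx
    obtain ⟨z, hz, e⟩ := cp.root hx
    exact ⟨g z, by rw [mg.ht, hz], z, e, rfl⟩
  · intro y hy
    obtain ⟨w, hw, e⟩ := cq.root hy
    obtain ⟨z, rfl⟩ := hb.2 w
    rw [mh.ht] at hw
    exact ⟨_, by rw [mp.ht, hw], z, rfl, e⟩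
  · intro n R t t' hr ht
    -- Both tuples are images of one chain in `Z₁`: below `z` take the element of the height of `t
    -- i`. Its images are `t i` and `t' i`, as a chain has one element of each height. A relation is
    -- then reflected by `p` and preserved by `h` and `q`.
    have main : ∃ s : Fin n → (U.obj Z₁).carrier,
        (∀ i j, (𝓕.forest Z₁).le (s i) (s j) ∨ (𝓕.forest Z₁).le (s j) (s i)) ∧
        (∀ i, Struct.fn (U.map p) (s i) = t i) ∧ ∀ i, g (s i) = t' i := by
      by_cases hn : n = 0
      · subst hn
        exact ⟨fun i => i.elim0, fun i => i.elim0, fun i => i.elim0, fun i => i.elim0⟩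
      obtain ⟨j, ⟨z, hz, hz'⟩, hi⟩ := hr hn
      have hs : ∀ i, ∃ s, (𝓕.forest Z₁).le s z ∧ (𝓕.forest Z₁).ht s = (𝓕.forest X).ht (t i) :=
        fun i => Forest.exists_le_ht (by rw [← mp.ht z, hz]; exact (hi i).1.ht)
      choose s hs hs' using hs
      refine ⟨s, fun i j => (hs i).total (hs j), fun i => ?_, fun i => ?_⟩
      · exact Forest.eq_of_comparable ((mp.le (hs i)).total (hz ▸ (hi i).1)) (by
          rw [mp.ht, hs'])
      · exact Forest.eq_of_comparable ((mg.le (hs i)).total (hz' ▸ (hi i).2.1)) (by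
          rw [mg.ht, hs', (hi i).2.2])
    obtain ⟨s, hc, hs, hs'⟩ := main
    obtain rfl : t = fun i => Struct.fn (U.map p) (s i) := funext fun i => (hs i).symm
    obtain rfl : t' = fun i => g (s i) := funext fun i => (hs' i).symm
    exact Struct.fn_rel (U.map q) R _ (Struct.fn_rel (U.map h) R s (cp.rel hc ht))

/-- The forest of the pairs in a back-and-forth relation. -/
def GameRel.forest {𝓕 : ForestCat U Λ rooted} {X Y : C}
    {r : (U.obj X).carrier → (U.obj Y).carrier → Prop} (h : 𝓕.GameRel X Y r) :
    Forest Λ {z : (U.obj X).carrier × (U.obj Y).carrier // r z.1 z.2} where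
  par z z' := (𝓕.forest X).par z.1.1 z'.1.1 ∧ (𝓕.forest Y).par z.1.2 z'.1.2
  ht z := (𝓕.forest X).ht z.1.1
  lab z := (𝓕.forest X).lab z.1.1
  ht_of_par hp := (𝓕.forest X).ht_of_par hp.1
  par_unique hp hp' := Subtype.ext (Prod.ext ((𝓕.forest X).par_unique hp.1 hp'.1)
    ((𝓕.forest Y).par_unique hp.2 hp'.2))
  exists_par {z} hz := by
    obtain ⟨x, hx⟩ := (𝓕.forest X).exists_par hz
    obtain ⟨y, hy⟩ := (𝓕.forest Y).exists_par (x := z.1.2) (by rwa [← h.ht z.2])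
    exact ⟨⟨(x, y), h.par z.2 hx hy⟩, hx, hy⟩

/-- Both middle objects live on the forest of related pairs, `Z₁` with the relations of `X` and `Z₂`
with those of `Y`. The clauses `forth`, `back` and those for roots make the projections covers, and
the clause `rel` makes the identity on pairs a morphism from `Z₁` to `Z₂`. -/
theorem GameRel.posBisim {𝓕 : ForestCat U Λ rooted} {X Y : C}
    {r : (U.obj X).carrier → (U.obj Y).carrier → Prop} (h : 𝓕.GameRel X Y r) :
    PosBisim U 𝓕.IsPath X Y := by
  have hroot : rooted → Nonempty {z : (U.obj X).carrier × (U.obj Y).carrier // r z.1 z.2} ∧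
      ∀ x y, h.forest.ht x = 0 → h.forest.ht y = 0 → x = y := fun hr => by
    obtain ⟨x, hx⟩ := (𝓕.root hr X).1
    obtain ⟨y, -, hxy⟩ := h.root_forth hx
    refine ⟨⟨⟨(x, y), hxy⟩⟩, fun z z' hz hz' => Subtype.ext (Prod.ext ?_ ?_)⟩
    · exact (𝓕.root hr X).2 _ _ hz hz'
    · exact (𝓕.root hr Y).2 _ _ ((h.ht z.2).symm.trans hz) ((h.ht z'.2).symm.trans hz')
  have m₁ : h.forest.IsMap (𝓕.forest X) fun z => z.1.1 :=
    ⟨fun hp => hp.1, fun _ => rfl, fun _ => rfl⟩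
  have m₂ : h.forest.IsMap (𝓕.forest Y) fun z => z.1.2 :=
    ⟨fun hp => hp.2, fun z => (h.ht z.2).symm, fun z => (h.lab z.2).symm⟩
  obtain ⟨Z₁, e₁, p, he₁, hp, hR₁⟩ := 𝓕.exists_over X h.forest _ m₁ hroot
  obtain ⟨Z₂, e₂, q, he₂, hq, hR₂⟩ := 𝓕.exists_over Y h.forest _ m₂ hroot
  have cp : 𝓕.IsCover p := 𝓕.isCover_over he₁ hp hR₁
    (fun z x hx => let ⟨y, hy, hr⟩ := h.forth z.2 hx; ⟨⟨(x, y), hr⟩, ⟨hx, hy⟩, rfl⟩)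
    (fun x hx => let ⟨y, _, hr⟩ := h.root_forth hx; ⟨⟨(x, y), hr⟩, hx, rfl⟩)
  have cq : 𝓕.IsCover q := 𝓕.isCover_over he₂ hq hR₂
    (fun z y hy => let ⟨x, hx, hr⟩ := h.back z.2 hy; ⟨⟨(x, y), hr⟩, ⟨hx, hy⟩, rfl⟩)
    (fun y hy => let ⟨x, hx, hr⟩ := h.root_back hy; ⟨⟨(x, y), hr⟩, hx, rfl⟩)
  obtain ⟨g, hg⟩ := 𝓕.lift (X := Z₁) (Y := Z₂) (Struct.mkHom (e₂ ∘ e₁.symm) fun {n} R t ht => by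
    have h₁ := (hR₁ R fun i => e₁.symm (t i)).1 (by simpa using ht)
    refine (hR₂ R fun i => e₁.symm (t i)).2 ⟨h₁.1, h.rel (fun hn => ?_) h₁.2⟩
    obtain ⟨j, hj⟩ := Forest.exists_max hn h₁.1
    exact ⟨j, (e₁.symm (t j)).2, fun i =>
      ⟨m₁.le (hj i), m₂.le (hj i), h.ht (e₁.symm (t i)).2⟩⟩) (he₁.symm.comp he₂)
  refine ⟨Z₁, Z₂, p, g, q, ⟨cp.isOpenMor, cp.isPathwiseEmb⟩, ⟨cq.isOpenMor, cq.isPathwiseEmb⟩, ?_⟩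
  rw [hg]
  exact (e₁.symm.trans e₂).bijective

/-- Positive bisimulations are back-and-forth relations. -/
theorem posBisim_iff (𝓕 : ForestCat U Λ rooted) {X Y : C} :
    PosBisim U 𝓕.IsPath X Y ↔ ∃ r, 𝓕.GameRel X Y r :=
  ⟨𝓕.gameRel_of_posBisim, fun ⟨_, h⟩ => h.posBisim⟩

end

end ForestCat

/-! ### Forests given by branches -/

/-- An assignment to each element of the labelled branch that ends in it. -/
structure BranchSystem (Λ : Type) (X : Type u) where
  branch : X → List (Λ × X)
  -- For a coalgebra this is the counit law, and the next field is coassociativity.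
  exists_last : ∀ x, ∃ l c, branch x = l ++ [(c, x)]
  branch_of_mem : ∀ {x l c y l'}, branch x = l ++ (c, y) :: l' → branch y = l ++ [(c, y)]

namespace BranchSystem

variable {Λ : Type} {X Y : Type u} (S : BranchSystem Λ X)

theorem branch_ne_nil (x : X) : S.branch x ≠ [] := by
  obtain ⟨l, c, h⟩ := S.exists_last x
  simp [h]

theorem branch_injective : Function.Injective S.branch := fun x y h => by
  obtain ⟨l, c, h₁⟩ := S.exists_last x
  obtain ⟨l', c', h₂⟩ := S.exists_last y
  rw [h₁, h₂] at h
  have h' := (List.append_inj' h rfl).2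
  simp only [List.cons.injEq, Prod.mk.injEq] at h'
  exact h'.1.2

/-- The forest order in which the elements below `x` are those on the branch of `x`. -/
def toForest : Forest Λ X where
  par y x := ∃ c, S.branch x = S.branch y ++ [(c, x)]
  ht x := (S.branch x).length - 1
  lab x := ((S.branch x).getLast (S.branch_ne_nil x)).1
  ht_of_par := by
    rintro x y ⟨c, h⟩
    have := List.length_pos_of_ne_nil (S.branch_ne_nil y)
    simp only [h, List.length_append, List.length_singleton]
    omega
  par_unique := by
    rintro x y y' ⟨c, h⟩ ⟨c', h'⟩
    exact S.branch_injective (List.append_inj' (h.symm.trans h') rfl).1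
  exists_par := by
    intro x hx
    obtain ⟨l, c, h⟩ := S.exists_last x
    rcases List.eq_nil_or_concat l with rfl | ⟨l, ⟨c', y⟩, rfl⟩
    · simp [h] at hx
    · refine ⟨y, c, ?_⟩
      rw [S.branch_of_mem (l := l) (c := c') (y := y) (l' := [(c, x)]) (x := x) (by simp [h]), h]
      simp

theorem le_iff {x y : X} : S.toForest.le x y ↔ S.branch x <+: S.branch y := by
  constructor
  · intro h
    induction h with
    | refl => exact List.prefix_rfl
    | tail _ hp ih =>
      obtain ⟨c, hc⟩ := hp
      exact ih.trans ⟨_, hc.symm⟩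
  · induction y using S.toForest.induct with
    | root y hy =>
      rintro ⟨w, hw⟩
      have := List.length_pos_of_ne_nil (S.branch_ne_nil x)
      have hl := congrArg List.length hw
      change (S.branch y).length - 1 = 0 at hy
      rw [List.length_append] at hl
      obtain rfl : w = [] := List.length_eq_zero_iff.1 (by omega)
      rw [List.append_nil] at hw
      rw [S.branch_injective hw]
      exact .refl y
    | step y y' hp ih =>
      rintro ⟨w, hw⟩
      rcases List.eq_nil_or_concat w with rfl | ⟨w, a, rfl⟩
      · rw [List.append_nil] at hw
        rw [S.branch_injective hw]
        exact .refl y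
      · obtain ⟨c, hc⟩ := id hp
        rw [hc, List.concat_eq_append, ← List.append_assoc] at hw
        exact (ih ⟨w, (List.append_inj' hw rfl).1⟩).tail hp

theorem isMap {S : BranchSystem Λ X} {T : BranchSystem Λ Y} {f : X → Y}
    (h : ∀ x, T.branch (f x) = (S.branch x).map (Prod.map id f)) :
    S.toForest.IsMap T.toForest f where
  par := by
    rintro x y ⟨c, hc⟩
    exact ⟨c, by rw [h, h, hc]; simp⟩
  ht x := by simp [toForest, h]
  lab x := by simp [toForest, h]

end BranchSystem

namespace Forest

variable {Λ : Type} {X Y : Type u} (F : Forest Λ X)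

/-- Each labelled element is appended to the branch of its parent. Recording the length pins down
the branch of a root, about which the condition on parents says nothing. -/
theorem exists_branch : ∃ b : X → List (Λ × X),
    (∀ x, (∃ l, b x = l ++ [(F.lab x, x)]) ∧ (b x).length = F.ht x + 1) ∧
      ∀ x y, F.par y x → ∃ m, b x = b y ++ [m] :=
  F.exists_map (p := fun x l => (∃ l₀, l = l₀ ++ [(F.lab x, x)]) ∧ l.length = F.ht x + 1)
    (r := fun l l' => ∃ m, l' = l ++ [m])
    (fun x hx => ⟨[(F.lab x, x)], ⟨[], rfl⟩, by simp [hx]⟩)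
    fun x y l hp hl => ⟨l ++ [(F.lab x, x)], ⟨⟨l, rfl⟩, by simp [hl.2, F.ht_of_par hp]⟩, _, rfl⟩

/-- The labelled branch of a forest that ends in a given element. -/
noncomputable def branch : X → List (Λ × X) := F.exists_branch.choose

theorem length_branch (x : X) : (F.branch x).length = F.ht x + 1 :=
  (F.exists_branch.choose_spec.1 x).2

theorem exists_branch_eq (x : X) : ∃ l, F.branch x = l ++ [(F.lab x, x)] :=
  (F.exists_branch.choose_spec.1 x).1

theorem branch_of_root {x : X} (h : F.ht x = 0) : F.branch x = [(F.lab x, x)] := by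
  obtain ⟨⟨l, hl⟩, h'⟩ := F.exists_branch.choose_spec.1 x
  change F.branch x = _ at hl
  have := F.length_branch x
  rw [hl, h, List.length_append, List.length_singleton] at this
  rw [hl, List.length_eq_zero_iff.1 (by omega : l.length = 0), List.nil_append]

theorem branch_of_par {x y : X} (h : F.par y x) : F.branch x = F.branch y ++ [(F.lab x, x)] := by
  obtain ⟨⟨l, hl⟩, -⟩ := F.exists_branch.choose_spec.1 x
  obtain ⟨m, hm⟩ := F.exists_branch.choose_spec.2 x y h
  change F.branch x = F.branch y ++ [m] at hm
  change F.branch x = _ at hl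
  rw [hm, ← (List.append_inj' (hm.symm.trans hl) rfl).2]

/-- The branches of a forest. -/
noncomputable def branchSystem : BranchSystem Λ X where
  branch := F.branch
  exists_last x := let ⟨l, hl⟩ := (F.exists_branch.choose_spec.1 x).1; ⟨l, _, hl⟩
  branch_of_mem {x l c y l'} h := by
    induction x using F.induct generalizing l' with
    | root x hx =>
      rw [F.branch_of_root hx] at h
      rcases List.singleton_eq_append_iff.1 h with ⟨rfl, h'⟩ | ⟨-, h'⟩
      · simp only [List.cons.injEq, Prod.mk.injEq] at h'
        obtain ⟨⟨rfl, rfl⟩, -⟩ := h'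
        rw [F.branch_of_root hx, List.nil_append]
      · simp at h'
    | step x x' hp ih =>
      rw [F.branch_of_par hp] at h
      rcases List.eq_nil_or_concat l' with rfl | ⟨w, a, rfl⟩
      · have h' := List.append_inj' h rfl
        simp only [List.cons.injEq, Prod.mk.injEq] at h'
        obtain ⟨h₁, ⟨rfl, rfl⟩, -⟩ := h'
        rw [F.branch_of_par hp, h₁]
      · rw [List.concat_eq_append, ← List.cons_append, ← List.append_assoc] at h
        exact ih (List.append_inj' h rfl).1

theorem isMap_toForest {S : BranchSystem Λ X} (h : ∀ x, S.branch x = F.branch x) :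
    F.IsMap S.toForest id where
  par {x y} hp := ⟨F.lab y, by simp only [id, h]; exact F.branch_of_par hp⟩
  ht x := by simp [BranchSystem.toForest, h, F.length_branch]
  lab x := by
    obtain ⟨l, hl⟩ := (F.exists_branch.choose_spec.1 x).1
    change F.branch x = _ at hl
    simp [BranchSystem.toForest, h, hl]

variable {F}

theorem le_iff_branch {x y : X} : F.le x y ↔ F.branch x <+: F.branch y := by
  have h : F.IsMap F.branchSystem.toForest (Equiv.refl X) := F.isMap_toForest fun _ => rfl
  exact ⟨fun h' => F.branchSystem.le_iff.1 (h.le h'), fun h' =>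
    h.symm.le (F.branchSystem.le_iff.2 h')⟩

theorem IsMap.branch {G : Forest Λ Y} {f : X → Y} (h : F.IsMap G f) (x : X) :
    G.branch (f x) = (F.branch x).map (Prod.map id f) := by
  induction x using F.induct with
  | root x hx =>
    rw [F.branch_of_root hx, G.branch_of_root (by rw [h.ht, hx]), h.lab]
    rfl
  | step x y hp ih =>
    rw [F.branch_of_par hp, G.branch_of_par (h.par hp), ih, h.lab]
    simp

end Forest

/-- Together with `Forest.isMap_toForest`, this makes forests and branch systems two forms of the
same data. -/
theorem BranchSystem.branch_toForest {Λ : Type} {X : Type u} (S : BranchSystem Λ X) (x : X) :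
    S.toForest.branch x = S.branch x := by
  induction x using S.toForest.induct with
  | root x hx =>
    rw [Forest.branch_of_root _ hx]
    obtain ⟨l, c, h⟩ := S.exists_last x
    change (S.branch x).length - 1 = 0 at hx
    rw [h, List.length_append, List.length_singleton] at hx
    obtain rfl : l = [] := List.length_eq_zero_iff.1 (by omega)
    simp [toForest, h]
  | step x y hp ih =>
    rw [Forest.branch_of_par _ hp, ih]
    obtain ⟨c, h⟩ := hp
    simp [toForest, h]

theorem BranchSystem.branch_map {Λ : Type} {X Y : Type u} {S : BranchSystem Λ X}
    {T : BranchSystem Λ Y} {f : X → Y} (h : S.toForest.IsMap T.toForest f) (x : X) :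
    T.branch (f x) = (S.branch x).map (Prod.map id f) := by
  rw [← T.branch_toForest, h.branch, S.branch_toForest]

/-- Label the entries of a list by the only element of `Unit`. -/
def unitLabel {X : Type u} (l : List X) : List (Unit × X) := l.map fun a => ((), a)

theorem map_snd_unitLabel {X : Type u} (l : List X) : (unitLabel l).map Prod.snd = l := by
  simp [unitLabel, Function.comp_def]

theorem unitLabel_map_snd {X : Type u} (l : List (Unit × X)) : unitLabel (l.map Prod.snd) = l := by
  simp [unitLabel, Function.comp_def]

theorem unitLabel_map {X Y : Type u} (f : X → Y) (l : List X) :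
    unitLabel (l.map f) = (unitLabel l).map (Prod.map id f) := by
  simp [unitLabel, Function.comp_def]

theorem eq_map_of_unitLabel {X Y : Type u} {f : X → Y} {l : List X} {l' : List Y}
    (h : unitLabel l' = (unitLabel l).map (Prod.map id f)) : l' = l.map f := by
  rw [← unitLabel_map] at h
  rw [← map_snd_unitLabel l', h, map_snd_unitLabel]

theorem unitLabel_prefix {X : Type u} {l l' : List X} :
    unitLabel l <+: unitLabel l' ↔ l <+: l' := by
  refine ⟨fun h => ?_, fun h => h.map _⟩
  have h' := h.map Prod.snd
  rwa [map_snd_unitLabel, map_snd_unitLabel] at h'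

/-! ### Coalgebras of the Ehrenfeucht–Fraïssé comonad -/

section E

variable {τ : FirstOrder.Language.{0, 0}} [τ.IsRelational] {k : ℕ}

/-- The structure map of a coalgebra. -/
def Eα (X : (EComonad.{u} τ k).Coalgebra) (x : X.A.carrier) : ESeq k X.A.carrier :=
  Struct.fn X.a x

theorem Eα_last (X : (EComonad.{u} τ k).Coalgebra) (x : X.A.carrier) : (Eα X x).last = x :=
  congrFun (congrArg Struct.fn X.counit) x

/-- The coassociativity law, read at the `j`-th entry. -/
theorem Eα_pre (X : (EComonad.{u} τ k).Coalgebra) (x : X.A.carrier) {j : ℕ}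
    (hj : j < (Eα X x).val.length) : Eα X (Eα X x).val[j] = (Eα X x).pre j := by
  have h : ESeq.coext id (Eα X x) = ESeq.coext (fun s => Eα X s.last) (Eα X x) :=
    congrFun (congrArg Struct.fn X.coassoc) x
  have h' := (List.ext_getElem_iff.1 (congrArg ESeq.val h)).2 j
    (by simpa [ESeq.length_coext] using hj) (by simpa [ESeq.length_coext] using hj)
  rw [ESeq.getElem_coext, ESeq.getElem_coext, ESeq.last_pre _ hj] at h'
  exact h'.symm

theorem Eα_hom {X Y : (EComonad.{u} τ k).Coalgebra} (f : X ⟶ Y) (x : X.A.carrier) :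
    (Eα Y (Struct.fn f.f x)).val = (Eα X x).val.map (Struct.fn f.f) := by
  have h : ESeq.coext (fun s => Struct.fn f.f s.last) (Eα X x) = Eα Y (Struct.fn f.f x) :=
    congrFun (congrArg Struct.fn f.h) x
  rw [← h]
  refine List.ext_getElem (by simp [ESeq.length_coext]) fun j h₁ h₂ => ?_
  rw [ESeq.getElem_coext, List.getElem_map, ESeq.last_pre]

/-- The branches of a coalgebra. -/
def EBranch (X : (EComonad.{u} τ k).Coalgebra) : BranchSystem Unit X.A.carrier where
  branch x := unitLabel (Eα X x).val
  exists_last x := ⟨unitLabel (Eα X x).val.dropLast, (), by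
    have h := Eα_last X x
    rw [ESeq.last] at h
    conv_lhs => rw [← List.dropLast_append_getLast (Eα X x).ne_nil, h]
    simp [unitLabel]⟩
  branch_of_mem {x l c y l'} h := by
    have h₁ : (Eα X x).val = l.map Prod.snd ++ y :: l'.map Prod.snd := by
      rw [← map_snd_unitLabel (Eα X x).val, h]
      simp
    have hj : l.length < (Eα X x).val.length := by simp [h₁]
    have h₂ : (Eα X x).val[l.length] = y := by simp [h₁]
    have h₃ := Eα_pre X x hj
    rw [h₂] at h₃
    rw [h₃, ESeq.pre, unitLabel, List.map_take, ← unitLabel, h]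
    simp [List.take_append]

theorem ELe_iff (X : (EComonad.{u} τ k).Coalgebra) (x y : X.A.carrier) :
    ELe X x y ↔ (EBranch X).toForest.le x y := by
  rw [BranchSystem.le_iff]
  exact unitLabel_prefix.symm

/-- The coalgebra given by a forest over the forest of a coalgebra. -/
noncomputable def EOver (X : (EComonad.{u} τ k).Coalgebra) {Z : Type u} (F : Forest Unit Z)
    (π : Z → X.A.carrier) (hπ : F.IsMap (EBranch X).toForest π) : (EComonad.{u} τ k).Coalgebra :=
  let α : Z → ESeq k Z := fun z => ⟨(F.branch z).map Prod.snd,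
    fun h => F.branchSystem.branch_ne_nil z (List.map_eq_nil_iff.1 h), by
      -- `π` carries branches to branches of the same length, so the bound `k` is inherited from
      -- `X`.
      have h := (Eα X (π z)).length_le
      have h' := BranchSystem.branch_toForest (EBranch X) (π z)
      rw [hπ.branch] at h'
      have h'' := congrArg List.length h'
      change _ = (unitLabel _).length at h''
      rw [unitLabel, List.length_map, List.length_map] at h''
      rw [List.length_map, h'']
      exact h⟩
  have hlast : ∀ z, (α z).last = z := fun z => by
    obtain ⟨l, c, h⟩ := F.branchSystem.exists_last z
    change F.branch z = _ at h
    simp [α, ESeq.last, h]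
  have hpre : ∀ z j (hj : j < (α z).val.length), α (α z).val[j] = (α z).pre j := fun z j hj => by
    have hj' : j < (F.branch z).length := by simpa [α] using hj
    have h := F.branchSystem.branch_of_mem (x := z) (l := (F.branch z).take j)
      (c := (F.branch z)[j].1) (y := (F.branch z)[j].2) (l' := (F.branch z).drop (j + 1)) (by
        change F.branch z = _
        simp)
    apply ESeq.ext
    change (F.branch (α z).val[j]).map Prod.snd = _
    have e : (α z).val[j] = (F.branch z)[j].2 := by simp [α]
    rw [e]
    change F.branch _ = _ at h
    rw [h]
    change _ = ((F.branch z).map Prod.snd).take (j + 1)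
    rw [← List.map_take, List.take_succ_eq_append_getElem hj']
  { A := { carrier := Z
           str := relStructure τ Z fun {n} R t =>
            (∀ i j, F.le (t i) (t j) ∨ F.le (t j) (t i)) ∧ RelMap R fun i => π (t i) }
    a := Struct.mkHom (B := EObj τ k _) α fun R t h =>
      ⟨fun i j => (h.1 i j).imp (fun h => (Forest.le_iff_branch.1 h).map _)
        fun h => (Forest.le_iff_branch.1 h).map _,
        ⟨fun i j => by simpa only [hlast] using h.1 i j, by simpa only [hlast] using h.2⟩⟩
    counit := Struct.hom_ext hlast
    coassoc := Struct.hom_ext fun z => by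
      change ESeq.coext id (α z) = ESeq.coext (fun s => α s.last) (α z)
      apply ESeq.ext
      refine List.ext_getElem (by simp [ESeq.length_coext]) fun j h₁ h₂ => ?_
      have hj : j < (α z).val.length := by simpa [ESeq.length_coext] using h₁
      rw [ESeq.getElem_coext, ESeq.getElem_coext, ESeq.last_pre _ hj, hpre]
      rfl }

theorem EBranch_hom {X Y : (EComonad.{u} τ k).Coalgebra} (f : X ⟶ Y) (x : X.A.carrier) :
    (EBranch Y).branch (Struct.fn f.f x) =
      ((EBranch X).branch x).map (Prod.map id (Struct.fn f.f)) := by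
  change unitLabel _ = _
  rw [Eα_hom, unitLabel_map]
  rfl

/-- The coalgebra square says that branches are mapped to branches, which holds for every map of
forests. -/
theorem ELift {X Y : (EComonad.{u} τ k).Coalgebra} (g : X.A ⟶ Y.A)
    (hg : (EBranch X).toForest.IsMap (EBranch Y).toForest (Struct.fn g)) :
    ∃ f : X ⟶ Y, f.f = g := by
  refine ⟨{ f := g, h := Struct.hom_ext fun x => ?_ }, rfl⟩
  change ESeq.coext (fun s => Struct.fn g s.last) (Eα X x) = Eα Y (Struct.fn g x)
  apply ESeq.ext
  rw [eq_map_of_unitLabel (BranchSystem.branch_map hg x)]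
  refine List.ext_getElem (by simp [ESeq.length_coext]) fun j h₁ h₂ => ?_
  rw [ESeq.getElem_coext, List.getElem_map, ESeq.last_pre]

/-- The coalgebras of the Ehrenfeucht–Fraïssé comonad are forest-ordered structures. -/
def EForestCat (τ : FirstOrder.Language.{0, 0}) [τ.IsRelational] (k : ℕ) :
    ForestCat (EComonad.{u} τ k).forget Unit False where
  forest X := (EBranch X).toForest
  isMap f := BranchSystem.isMap fun x => EBranch_hom f x
  hom_ext h := Comonad.Coalgebra.Hom.ext (Struct.hom_ext h)
  lift g hg := ELift g hg
  comparable {X n R t} h i j := by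
    have h' := Struct.fn_rel X.a R t h
    exact (h'.1 i j).imp (ELe_iff X _ _).1 (ELe_iff X _ _).1
  root h := h.elim
  pull X Z F π hπ _ := ⟨EOver X F π hπ, Equiv.refl Z,
    F.isMap_toForest (S := EBranch (EOver X F π hπ)) fun z => unitLabel_map_snd (F.branch z),
    fun R t => Iff.rfl⟩

theorem EPosBisim_iff {X Y : (EComonad.{u} τ k).Coalgebra} :
    EPosBisim X Y ↔ ∃ r, (EForestCat τ k).GameRel X Y r := by
  rw [← ForestCat.posBisim_iff, EPosBisim]
  simp only [ELe_iff]
  rfl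

end E

/-! ### Coalgebras of the pebbling comonad -/

section P

variable {τ : FirstOrder.Language.{0, 0}} [τ.IsRelational] {k : ℕ}

/-- The structure map of a coalgebra. -/
def Pα (X : (PComonad.{u} τ k).Coalgebra) (x : X.A.carrier) : PSeq k X.A.carrier :=
  Struct.fn X.a x

theorem Pα_last (X : (PComonad.{u} τ k).Coalgebra) (x : X.A.carrier) : (Pα X x).last = x :=
  congrFun (congrArg Struct.fn X.counit) x

theorem Pα_pre (X : (PComonad.{u} τ k).Coalgebra) (x : X.A.carrier) {j : ℕ}
    (hj : j < (Pα X x).val.length) : Pα X (Pα X x).val[j].2 = (Pα X x).pre j := by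
  have h : PSeq.coext id (Pα X x) = PSeq.coext (fun s => Pα X s.last) (Pα X x) :=
    congrFun (congrArg Struct.fn X.coassoc) x
  have h' := (List.ext_getElem_iff.1 (congrArg PSeq.val h)).2 j
    (by simpa [PSeq.length_coext] using hj) (by simpa [PSeq.length_coext] using hj)
  rw [PSeq.getElem_coext _ _ _ _ hj, PSeq.getElem_coext _ _ _ _ hj, PSeq.last,
    PSeq.lastMove_pre _ hj] at h'
  exact (congrArg Prod.snd h').symm

theorem PSeq.coext_last_eq_map {A B : Type u} (f : A → B) (s : PSeq k A) :
    (PSeq.coext (fun s => f s.last) s).val = s.val.map (Prod.map id f) := by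
  refine List.ext_getElem (by simp [PSeq.length_coext]) fun j h₁ h₂ => ?_
  have h : j < s.val.length := by simpa using h₂
  rw [PSeq.getElem_coext _ _ _ _ h, List.getElem_map, PSeq.last, PSeq.lastMove_pre _ h]
  rfl

theorem Pα_hom {X Y : (PComonad.{u} τ k).Coalgebra} (f : X ⟶ Y) (x : X.A.carrier) :
    (Pα Y (Struct.fn f.f x)).val = (Pα X x).val.map (Prod.map id (Struct.fn f.f)) := by
  have h : PSeq.coext (fun s => Struct.fn f.f s.last) (Pα X x) = Pα Y (Struct.fn f.f x) :=
    congrFun (congrArg Struct.fn f.h) x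
  rw [← h, PSeq.coext_last_eq_map]

/-- The branches of a coalgebra. -/
def PBranch (X : (PComonad.{u} τ k).Coalgebra) : BranchSystem (Fin k) X.A.carrier where
  branch x := (Pα X x).val
  exists_last x := ⟨(Pα X x).val.dropLast, (Pα X x).lastMove.1, by
    have h := Pα_last X x
    conv_lhs => rw [← List.dropLast_append_getLast (Pα X x).ne_nil]
    congr 2
    exact Prod.ext rfl h⟩
  branch_of_mem {x l c y l'} h := by
    have hj : l.length < (Pα X x).val.length := by simp [h]
    have h₂ : (Pα X x).val[l.length].2 = y := by simp [h]
    have h₃ := Pα_pre X x hj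
    rw [h₂] at h₃
    rw [h₃]
    change (Pα X x).val.take (l.length + 1) = _
    rw [h]
    simp [List.take_append]

theorem PLe_iff (X : (PComonad.{u} τ k).Coalgebra) (x y : X.A.carrier) :
    PLe X x y ↔ (PBranch X).toForest.le x y := by
  rw [BranchSystem.le_iff]
  rfl

/-- The coalgebra given by a forest over the forest of a coalgebra. -/
noncomputable def POver (X : (PComonad.{u} τ k).Coalgebra) {Z : Type u} (F : Forest (Fin k) Z)
    (π : Z → X.A.carrier) (hπ : F.IsMap (PBranch X).toForest π) : (PComonad.{u} τ k).Coalgebra :=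
  let α : Z → PSeq k Z := fun z => ⟨F.branch z, F.branchSystem.branch_ne_nil z⟩
  have hlastMove : ∀ z, (α z).lastMove = (F.lab z, z) := fun z => by
    obtain ⟨l, h⟩ := F.exists_branch_eq z
    simp [α, PSeq.lastMove, h]
  have hlast : ∀ z, (α z).last = z := fun z => by rw [PSeq.last, hlastMove]
  have hpre : ∀ z j (hj : j < (α z).val.length), α (α z).val[j].2 = (α z).pre j :=
    fun z j hj => by
      have h := F.branchSystem.branch_of_mem (x := z) (l := (F.branch z).take j)
        (c := (F.branch z)[j].1) (y := (F.branch z)[j].2) (l' := (F.branch z).drop (j + 1)) (by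
          change F.branch z = _
          simp)
      apply PSeq.ext
      change F.branch _ = _ at h
      change F.branch (F.branch z)[j].2 = (F.branch z).take (j + 1)
      rw [h, List.take_succ_eq_append_getElem hj]
  have hX : ∀ z, (Pα X (π z)).val = (F.branch z).map (Prod.map id π) := fun z => by
    rw [← hπ.branch, BranchSystem.branch_toForest]
    rfl
  { A := { carrier := Z
           str := relStructure τ Z fun {n} R t =>
            (∀ i j, F.le (t i) (t j) ∨ F.le (t j) (t i)) ∧ RelMap R fun i => π (t i) }
    a := Struct.mkHom (B := PObj τ k _) α fun R t h =>
      ⟨fun i j => (h.1 i j).imp Forest.le_iff_branch.1 Forest.le_iff_branch.1, by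
        -- The pebble condition is inherited from `X`: its structure map is a homomorphism, so
        -- related tuples of `X` are active, and `π` preserves pebbles and branches.
        intro i j w hw m hm
        have h' : PSeq.Active fun i => Pα X (π (t i)) := (Struct.fn_rel X.a R _ h.2).2.1
        have hlm : (Pα X (π (t i))).lastMove.1 = F.lab (t i) := by
          have := hX (t i)
          obtain ⟨l, hl⟩ := F.exists_branch_eq (t i)
          rw [hl] at this
          simp [PSeq.lastMove, this]
        have := h' i j (w.map (Prod.map id π)) (by
          rw [hX, hX]
          change F.branch (t i) ++ w = F.branch (t j) at hw
          rw [← hw, List.map_append]) _ (List.mem_map_of_mem hm)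
        rw [hlastMove]
        rw [hlm] at this
        exact this,
        ⟨fun i j => by simpa only [hlast] using h.1 i j, by simpa only [hlast] using h.2⟩⟩
    counit := Struct.hom_ext hlast
    coassoc := Struct.hom_ext fun z => by
      change PSeq.coext id (α z) = PSeq.coext (fun s => α s.last) (α z)
      apply PSeq.ext
      refine List.ext_getElem (by simp [PSeq.length_coext]) fun j h₁ h₂ => ?_
      have hj : j < (α z).val.length := by simpa [PSeq.length_coext] using h₁
      rw [PSeq.getElem_coext _ _ _ _ hj, PSeq.getElem_coext _ _ _ _ hj, PSeq.last,
        PSeq.lastMove_pre _ hj, hpre]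
      rfl }

theorem PLift {X Y : (PComonad.{u} τ k).Coalgebra} (g : X.A ⟶ Y.A)
    (hg : (PBranch X).toForest.IsMap (PBranch Y).toForest (Struct.fn g)) :
    ∃ f : X ⟶ Y, f.f = g := by
  refine ⟨{ f := g, h := Struct.hom_ext fun x => ?_ }, rfl⟩
  change PSeq.coext (fun s => Struct.fn g s.last) (Pα X x) = Pα Y (Struct.fn g x)
  apply PSeq.ext
  rw [PSeq.coext_last_eq_map]
  exact (BranchSystem.branch_map hg x).symm

/-- The coalgebras of the pebbling comonad are forest-ordered structures. -/
def PForestCat (τ : FirstOrder.Language.{0, 0}) [τ.IsRelational] (k : ℕ) :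
    ForestCat (PComonad.{u} τ k).forget (Fin k) False where
  forest X := (PBranch X).toForest
  isMap {X Y} f := BranchSystem.isMap (S := PBranch X) (T := PBranch Y) fun x => Pα_hom f x
  hom_ext h := Comonad.Coalgebra.Hom.ext (Struct.hom_ext h)
  lift g hg := PLift g hg
  comparable {X n R t} h i j := by
    have h' := Struct.fn_rel X.a R t h
    exact (h'.1 i j).imp (PLe_iff X _ _).1 (PLe_iff X _ _).1
  root h := h.elim
  pull X Z F π hπ _ := ⟨POver X F π hπ, Equiv.refl Z,
    F.isMap_toForest (S := PBranch (POver X F π hπ)) fun z => rfl, fun R t => Iff.rfl⟩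

theorem PPosBisim_iff {X Y : (PComonad.{u} τ k).Coalgebra} :
    PPosBisim X Y ↔ ∃ r, (PForestCat τ k).GameRel X Y r := by
  rw [← ForestCat.posBisim_iff, PPosBisim]
  simp only [PLe_iff]
  rfl

end P

/-! ### Coalgebras of the modal comonad -/

section RootedBranch

variable {σ : FirstOrder.Language.{0, 0}}

/-- The branch of a tree given by its root and its labelled edges. -/
def rootedBranch {X : Type u} (r : X) (l : List (σ.Relations 2 × X)) :
    List (Option (σ.Relations 2) × X) := (none, r) :: l.map (Prod.map some id)

theorem rootedBranch_map {X Y : Type u} (f : X → Y) (r : X) (l : List (σ.Relations 2 × X)) :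
    rootedBranch (f r) (l.map (Prod.map id f)) = (rootedBranch r l).map (Prod.map id f) := by
  simp [rootedBranch, Function.comp_def]

theorem rootedBranch_inj {X : Type u} {r r' : X} {l l' : List (σ.Relations 2 × X)} :
    rootedBranch r l = rootedBranch r' l' ↔ r = r' ∧ l = l' := by
  have h : Function.Injective (Prod.map some id : σ.Relations 2 × X → Option _ × X) :=
    (Option.some_injective _).prodMap Function.injective_id
  simp [rootedBranch, h.list_map.eq_iff]

theorem rootedBranch_append {X : Type u} (r : X) (l l' : List (σ.Relations 2 × X)) :
    rootedBranch r (l ++ l') = rootedBranch r l ++ l'.map (Prod.map some id) := by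
  simp [rootedBranch]

theorem rootedBranch_prefix {X : Type u} {r : X} {l l' : List (σ.Relations 2 × X)} :
    rootedBranch r l <+: rootedBranch r l' ↔ l <+: l' := by
  have h : Function.Injective (Prod.map some id : σ.Relations 2 × X → Option _ × X) :=
    (Option.some_injective _).prodMap Function.injective_id
  rw [rootedBranch, rootedBranch, List.prefix_cons_inj, List.prefix_map_iff_of_injective h]

theorem MPath.mapList_congr_last {k : ℕ} {A : PtStruct.{u} σ} {B : Type u}
    (f : A.toStruct.carrier → B) (s : MPath k A) :
    (List.ofFn fun j : Fin s.val.length => (s.val[j].1, f (s.pre (j + 1)).last)) =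
      s.val.map (Prod.map id f) := by
  refine List.ext_getElem (by simp) fun j h₁ h₂ => ?_
  have h : j < s.val.length := by simpa using h₂
  rw [List.getElem_ofFn, List.getElem_map, MPath.last_pre s h]
  rfl

/-- A labelled list that lies over a list of edges can carry no label `none`, so it is itself a list
of edges. -/
theorem exists_edges {X Z : Type u} {π : Z → X} {l : List (Option (σ.Relations 2) × Z)}
    {w : List (σ.Relations 2 × X)}
    (h : w.map (Prod.map some id) = l.map (Prod.map id π)) :
    ∃ l' : List (σ.Relations 2 × Z), l = l'.map (Prod.map some id) ∧
      w = l'.map (Prod.map id π) := by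
  induction l generalizing w with
  | nil => exact ⟨[], rfl, by simpa using h⟩
  | cons a l ih =>
    obtain ⟨⟨R, x⟩, w, rfl, h₁, h₂⟩ := List.map_eq_cons_iff.1 h
    obtain ⟨l', rfl, rfl⟩ := ih h₂
    obtain ⟨c, z⟩ := a
    simp only [Prod.map_apply, id, Prod.mk.injEq] at h₁
    obtain ⟨rfl, rfl⟩ := h₁
    exact ⟨(R, z) :: l', rfl, rfl⟩

end RootedBranch

section M

variable {σ : FirstOrder.Language.{0, 0}} [σ.IsRelational] {k : ℕ}

/-- The structure map of a coalgebra. -/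
def Mα (X : (MComonad.{u} σ k).Coalgebra) (x : X.A.toStruct.carrier) : MPath k X.A :=
  Struct.fn X.a.hom x

theorem Mα_last (X : (MComonad.{u} σ k).Coalgebra) (x : X.A.toStruct.carrier) :
    (Mα X x).last = x :=
  congrFun (congrArg (fun f => Struct.fn (PtStruct.Hom.hom f)) X.counit) x

theorem Mα_pt (X : (MComonad.{u} σ k).Coalgebra) : Mα X X.A.pt = MPath.nil := X.a.map_pt

theorem Mα_pre (X : (MComonad.{u} σ k).Coalgebra) (x : X.A.toStruct.carrier) {j : ℕ}
    (hj : j < (Mα X x).val.length) : Mα X (Mα X x).val[j].2 = (Mα X x).pre (j + 1) := by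
  have h := congrFun (congrArg (fun f => Struct.fn (PtStruct.Hom.hom f)) X.coassoc) x
  have h₁ : List.ofFn (fun j : Fin (Mα X x).val.length =>
      ((Mα X x).val[j].1, (Mα X x).pre (j + 1))) =
      List.ofFn fun j : Fin (Mα X x).val.length =>
      ((Mα X x).val[j].1, Mα X ((Mα X x).pre (j + 1)).last) := congrArg MPath.val h
  have h' := (List.ext_getElem_iff.1 h₁).2 j (by simpa using hj) (by simpa using hj)
  rw [List.getElem_ofFn, List.getElem_ofFn] at h'
  have h'' := congrArg Prod.snd h'
  simp only [MPath.last_pre _ hj] at h''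
  exact h''.symm

theorem Mα_hom {X Y : (MComonad.{u} σ k).Coalgebra} (f : X ⟶ Y) (x : X.A.toStruct.carrier) :
    (Mα Y (Struct.fn f.f.hom x)).val = (Mα X x).val.map (Prod.map id (Struct.fn f.f.hom)) := by
  have h := congrFun (congrArg (fun f => Struct.fn (PtStruct.Hom.hom f)) f.h) x
  have h₁ : List.ofFn (fun j : Fin (Mα X x).val.length =>
      ((Mα X x).val[j].1, Struct.fn f.f.hom ((Mα X x).pre (j + 1)).last)) =
      (Mα Y (Struct.fn f.f.hom x)).val := congrArg MPath.val h
  rw [← h₁, MPath.mapList_congr_last]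

/-- The branches of a coalgebra. -/
def MBranch (X : (MComonad.{u} σ k).Coalgebra) :
    BranchSystem (Option (σ.Relations 2)) X.A.toStruct.carrier where
  -- A path records its steps but not its starting point, while a branch must contain its root.
  -- Hence the extra first entry with label `none`; heights become lengths of paths.
  branch x := rootedBranch X.A.pt (Mα X x).val
  exists_last x := by
    have h := Mα_last X x
    rcases List.eq_nil_or_concat (Mα X x).val with e | ⟨l, ⟨R, y⟩, e⟩
    · refine ⟨[], none, ?_⟩
      rw [MPath.last, e] at h
      rw [e, ← h]
      rfl
    · rw [List.concat_eq_append] at e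
      refine ⟨rootedBranch X.A.pt l, some R, ?_⟩
      rw [MPath.last, e] at h
      rw [e, rootedBranch_append, ← h]
      simp [endPt]
  branch_of_mem {x l c y l'} h := by
    cases l with
    | nil =>
      simp only [rootedBranch, List.nil_append, List.cons.injEq, Prod.mk.injEq] at h
      obtain ⟨⟨rfl, rfl⟩, -⟩ := h
      rw [Mα_pt]
      rfl
    | cons a l =>
      simp only [rootedBranch, List.cons_append, List.cons.injEq] at h
      obtain ⟨rfl, h⟩ := h
      obtain ⟨l₁, l₂, hl, rfl, h₂⟩ := List.map_eq_append_iff.1 h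
      obtain ⟨⟨R, z⟩, l₃, rfl, h₃, -⟩ := List.map_eq_cons_iff.1 h₂
      simp only [Prod.map_apply, id, Prod.mk.injEq] at h₃
      obtain ⟨rfl, rfl⟩ := h₃
      have hj : l₁.length < (Mα X x).val.length := by simp [hl]
      have h₂ : (Mα X x).val[l₁.length].2 = z := by simp [hl]
      have h₃ := Mα_pre X x hj
      rw [h₂] at h₃
      rw [h₃]
      change rootedBranch _ ((Mα X x).val.take (l₁.length + 1)) = _
      rw [hl]
      simp [rootedBranch, List.take_append]

theorem MLe_iff (X : (MComonad.{u} σ k).Coalgebra) (x y : X.A.toStruct.carrier) :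
    MLe X x y ↔ (MBranch X).toForest.le x y := by
  rw [BranchSystem.le_iff]
  exact rootedBranch_prefix.symm

theorem MBranch_ht (X : (MComonad.{u} σ k).Coalgebra) (x : X.A.toStruct.carrier) :
    (MBranch X).toForest.ht x = (Mα X x).val.length := by
  change (rootedBranch _ _).length - 1 = _
  simp [rootedBranch]

theorem MBranch_root (X : (MComonad.{u} σ k).Coalgebra) {x : X.A.toStruct.carrier}
    (h : (MBranch X).toForest.ht x = 0) : x = X.A.pt := by
  rw [MBranch_ht, List.length_eq_zero_iff] at h
  rw [← Mα_last X x, MPath.last, h]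
  rfl

/-- The first entry of a branch has height zero, so it is the one root `r`. The remaining entries
carry edge labels because their images in `X` do. -/
theorem exists_rootedBranch (X : (MComonad.{u} σ k).Coalgebra) {Z : Type u}
    (F : Forest (Option (σ.Relations 2)) Z) (π : Z → X.A.toStruct.carrier)
    (hπ : F.IsMap (MBranch X).toForest π)
    (hr : Nonempty Z ∧ ∀ x y, F.ht x = 0 → F.ht y = 0 → x = y) :
    ∃ (r : Z) (E : Z → List (σ.Relations 2 × Z)), (∀ z, F.branch z = rootedBranch r (E z)) ∧
      ∀ z, (Mα X (π z)).val = (E z).map (Prod.map id π) := by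
  obtain ⟨⟨z⟩, hr⟩ := hr
  obtain ⟨r, -, hr₀⟩ := Forest.exists_le_ht (F := F) (x := z) (Nat.zero_le _)
  have h : ∀ z, ∃ l, F.branch z = rootedBranch r l ∧
      (Mα X (π z)).val = l.map (Prod.map id π) := fun z => by
    have h := hπ.branch z
    rw [BranchSystem.branch_toForest] at h
    obtain ⟨⟨c, r'⟩, l, hl, h₁, h₂⟩ := List.map_eq_cons_iff.1 h.symm
    obtain ⟨l', rfl, h₃⟩ := exists_edges h₂.symm
    simp only [Prod.map_apply, id, Prod.mk.injEq] at h₁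
    obtain ⟨rfl, h₁⟩ := h₁
    have h₄ := F.branchSystem.branch_of_mem (x := z) (l := []) hl
    change F.branch r' = _ at h₄
    have h₅ := F.length_branch r'
    rw [h₄] at h₅
    rw [hr r r' hr₀ (by simpa using h₅.symm)]
    exact ⟨l', hl, h₃⟩
  choose E h₁ h₂ using h
  exact ⟨r, E, h₁, h₂⟩

/-- The coalgebra given by a tree over the tree of a coalgebra. -/
theorem exists_MOver (X : (MComonad.{u} σ k).Coalgebra) {Z : Type u}
    (F : Forest (Option (σ.Relations 2)) Z) (π : Z → X.A.toStruct.carrier)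
    (hπ : F.IsMap (MBranch X).toForest π)
    (hr : Nonempty Z ∧ ∀ x y, F.ht x = 0 → F.ht y = 0 → x = y) :
    ∃ (W : (MComonad.{u} σ k).Coalgebra) (e : Z ≃ W.A.toStruct.carrier),
      F.IsMap (MBranch W).toForest e ∧
      ∀ {n : ℕ} (R : σ.Relations n) (t : Fin n → Z), RelMap R (fun i => e (t i)) ↔
        (∀ i j, F.le (t i) (t j) ∨ F.le (t j) (t i)) ∧ RelMap R fun i => π (t i) := by
  obtain ⟨r, E, hE, hX⟩ := exists_rootedBranch X F π hπ hr
  have hle : ∀ {x y}, F.le x y ↔ E x <+: E y := fun {x y} => by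
    rw [Forest.le_iff_branch, hE, hE, rootedBranch_prefix]
  have hpre : ∀ z j (hj : j < (E z).length), E (E z)[j].2 = (E z).take (j + 1) := fun z j hj => by
    have h := F.branchSystem.branch_of_mem (x := z) (l := rootedBranch r ((E z).take j))
      (c := some (E z)[j].1) (y := (E z)[j].2)
      (l' := ((E z).drop (j + 1)).map (Prod.map some id)) (by
        change F.branch z = _
        have e : E z = (E z).take j ++ (E z)[j] :: (E z).drop (j + 1) := by
          rw [← List.drop_eq_getElem_cons hj, List.take_append_drop]
        rw [hE]
        exact (congrArg (rootedBranch r) e).trans (rootedBranch_append _ _ _))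
    change F.branch _ = _ at h
    rw [hE] at h
    have h' : rootedBranch r (E (E z)[j].2) = rootedBranch r ((E z).take (j + 1)) := by
      rw [h, List.take_succ_eq_append_getElem hj, rootedBranch_append]
      rfl
    exact (rootedBranch_inj.1 h').2
  have hr₀ : E r = [] := by
    have h := F.branchSystem.branch_of_mem (x := r) (l := []) (hE r)
    change F.branch r = _ at h
    rw [hE] at h
    simpa [rootedBranch] using h
  have hend : ∀ z j, j ≤ (E z).length → E (endPt r ((E z).take j)) = (E z).take j := by
    intro z j hj
    cases j with
    | zero => simpa [endPt] using hr₀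
    | succ j => rw [endPt_take_succ _ _ hj, hpre z j hj]
  have hlast : ∀ z, endPt r (E z) = z := fun z => by
    obtain ⟨l, h⟩ := F.exists_branch_eq z
    rw [hE] at h
    rcases List.eq_nil_or_concat (E z) with e | ⟨l', ⟨R, y⟩, e⟩
    · rw [e] at h ⊢
      have := (List.append_inj' (s₁ := []) h rfl).2
      simp only [List.map_nil, List.cons.injEq, Prod.mk.injEq] at this
      exact this.1.2
    · rw [e, List.concat_eq_append, rootedBranch_append] at h
      have := (List.append_inj' h rfl).2
      simp only [List.map_cons, List.map_nil, Prod.map_apply, id, List.cons.injEq,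
        Prod.mk.injEq] at this
      rw [e]
      simp [endPt, this.1.2]
  let A : PtStruct.{u} σ :=
    { toStruct :=
      { carrier := Z
        str := relStructure σ Z fun {n} R t =>
          (∀ i j, F.le (t i) (t j) ∨ F.le (t j) (t i)) ∧ RelMap R fun i => π (t i) }
      pt := r }
  let α : Z → MPath k A := fun z =>
    { val := E z
      length_le := by
        have h := (Mα X (π z)).length_le
        rwa [hX, List.length_map] at h
      rel := fun j hj => by
        have h₁ := hend z j hj.le
        have h₂ := hpre z j hj
        -- A step of `E z` has to be related in `A`, that is, comparable and related in `X`. The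
        -- second holds because it lies over a step between paths in the image of `Mα X`.
        refine ⟨?_, ?_⟩
        · have h : F.le (endPt r ((E z).take j)) (E z)[j].2 := by
            rw [hle, h₁, h₂]
            exact List.take_prefix_take_left (by omega)
          intro a b
          fin_cases a <;> fin_cases b
          · exact .inl (.refl _)
          · exact .inl h
          · exact .inr h
          · exact .inl (.refl _)
        · have h : MPath.Step (E z)[j].1 (Mα X (π (endPt r ((E z).take j))))
              (Mα X (π (E z)[j].2)) := ⟨π (E z)[j].2, by
            rw [hX, hX, h₁, h₂, List.take_succ_eq_append_getElem hj, List.map_append]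
            rfl⟩
          have h := MPath.rel_of_step h
          rw [Mα_last, Mα_last] at h
          convert h using 1
          ext i
          fin_cases i <;> rfl }
  have hαlast : ∀ z, (α z).last = z := hlast
  have hα : ∀ {n : ℕ} (R : σ.Relations n) (t : Fin n → Z),
      (∀ i j, F.le (t i) (t j) ∨ F.le (t j) (t i)) → RelMap R (fun i => π (t i)) →
      MPath.Rel R fun i => α (t i) := by
    intro n R t hc ht
    have h' : MPath.Rel R fun i => Mα X (π (t i)) := Struct.fn_rel X.a.hom R _ ht
    match n, R, t, hc, ht, h' with
    | 1, R, t, hc, ht, h' =>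
      change (∀ i j, F.le (![(α (t 0)).last] i) (![(α (t 0)).last] j) ∨ _) ∧
        RelMap R fun i => π (![(α (t 0)).last] i)
      rw [hαlast]
      have e : ![t 0] = t := by
        ext i
        fin_cases i
        rfl
      rw [e]
      exact ⟨hc, ht⟩
    | 2, R, t, hc, ht, h' =>
      -- In `X` the second path is the first one extended by a step along `R`. Comparability in `Z`
      -- makes `E (t 0)` a prefix of `E (t 1)`, and the one remaining edge has its label read off in
      -- `X`.
      obtain ⟨b, hb⟩ := h'
      rw [hX, hX] at hb
      have hl := congrArg List.length hb
      simp only [List.length_map, List.length_append, List.length_singleton] at hl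
      have hp : E (t 0) <+: E (t 1) := by
        rcases hc 0 1 with h | h
        · exact hle.1 h
        · have := (hle.1 h).length_le
          omega
      obtain ⟨w, hw⟩ := hp
      rw [← hw, List.map_append, List.append_cancel_left_eq] at hb
      obtain ⟨⟨R', y⟩, w', rfl, h₁, h₂⟩ := List.map_eq_cons_iff.1 hb
      simp only [Prod.map_apply, id, Prod.mk.injEq] at h₁
      obtain ⟨rfl, -⟩ := h₁
      rw [List.map_eq_nil_iff] at h₂
      subst h₂
      exact ⟨y, hw.symm⟩
    -- Symbols that are neither unary nor binary are false on paths, so `h'` is already absurd here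
    -- and in the next case.
    | 0, R, t, hc, ht, h' => exact h'
    | n + 3, R, t, hc, ht, h' => exact h'
  let a : A ⟶ MObj σ k A :=
    { hom := Struct.mkHom (A := A.toStruct) (B := (MObj σ k A).toStruct) α
        fun R t h => hα R t h.1 h.2
      map_pt := MPath.ext hr₀ }
  let W : (MComonad.{u} σ k).Coalgebra :=
    { A := A
      a := a
      counit := PtStruct.Hom.ext (Struct.hom_ext hαlast)
      coassoc := PtStruct.Hom.ext (Struct.hom_ext fun z => by
        apply MPath.ext
        change List.ofFn (fun j : Fin (α z).val.length => ((α z).val[j].1, (α z).pre (j + 1))) =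
          List.ofFn fun j : Fin (α z).val.length => ((α z).val[j].1, α ((α z).pre (j + 1)).last)
        refine List.ext_getElem (by simp) fun j h₁ h₂ => ?_
        have hj : j < (α z).val.length := by simpa using h₁
        rw [List.getElem_ofFn, List.getElem_ofFn]
        congr 1
        apply MPath.ext
        simp only [MPath.last_pre _ hj]
        exact (hpre z j hj).symm) }
  exact ⟨W, Equiv.refl Z, F.isMap_toForest (S := MBranch W) fun z => (hE z).symm,
    fun R t => Iff.rfl⟩

theorem MLift {X Y : (MComonad.{u} σ k).Coalgebra} (g : X.A.toStruct ⟶ Y.A.toStruct)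
    (hg : (MBranch X).toForest.IsMap (MBranch Y).toForest (Struct.fn g)) :
    ∃ f : X ⟶ Y, f.f.hom = g := by
  -- The point is the only element of height zero, so maps of trees preserve it.
  have hpt : Struct.fn g X.A.pt = Y.A.pt :=
    MBranch_root Y (by rw [hg.ht, MBranch_ht, Mα_pt]; rfl)
  refine ⟨{ f := ⟨g, hpt⟩, h := PtStruct.Hom.ext (Struct.hom_ext fun x => ?_) }, rfl⟩
  apply MPath.ext
  change List.ofFn (fun j : Fin (Mα X x).val.length =>
      ((Mα X x).val[j].1, Struct.fn g ((Mα X x).pre (j + 1)).last)) =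
      (Mα Y (Struct.fn g x)).val
  rw [MPath.mapList_congr_last]
  have h := BranchSystem.branch_map hg x
  change rootedBranch _ _ = (rootedBranch _ _).map _ at h
  rw [← rootedBranch_map] at h
  exact (rootedBranch_inj.1 h).2.symm

theorem MBranch_hom {X Y : (MComonad.{u} σ k).Coalgebra} (f : X ⟶ Y)
    (x : X.A.toStruct.carrier) :
    (MBranch Y).branch (Struct.fn f.f.hom x) =
      ((MBranch X).branch x).map (Prod.map id (Struct.fn f.f.hom)) := by
  change rootedBranch _ _ = (rootedBranch _ _).map _
  rw [← rootedBranch_map, Mα_hom, f.f.map_pt]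

/-- The coalgebras of the modal comonad are tree-ordered structures. -/
def MForestCat (σ : FirstOrder.Language.{0, 0}) [σ.IsRelational] (k : ℕ) :
    ForestCat ((MComonad.{u} σ k).forget ⋙ forgetPt σ) (Option (σ.Relations 2)) True where
  forest X := (MBranch X).toForest
  isMap f := BranchSystem.isMap fun x => MBranch_hom f x
  hom_ext h := Comonad.Coalgebra.Hom.ext (PtStruct.Hom.ext (Struct.hom_ext h))
  lift g hg := MLift g hg
  comparable {X n R t} h i j := by
    have h' : MPath.Rel R fun i => Mα X (t i) := Struct.fn_rel X.a.hom R t h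
    match n, R, t, h', i, j with
    | 1, R, t, h', i, j => rw [Subsingleton.elim i j]; exact .inl (.refl _)
    | 2, R, t, h', i, j =>
      obtain ⟨b, hb⟩ := h'
      have h : (MBranch X).toForest.le (t 0) (t 1) := (MLe_iff X _ _).1 ⟨_, hb.symm⟩
      fin_cases i <;> fin_cases j
      · exact .inl (.refl _)
      · exact .inl h
      · exact .inr h
      · exact .inl (.refl _)
    | n + 3, R, t, h', i, j => exact h'.elim
  root _ X := ⟨⟨X.A.pt, by rw [MBranch_ht, Mα_pt]; rfl⟩,
    fun x y hx hy => (MBranch_root X hx).trans (MBranch_root X hy).symm⟩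
  pull X Z F π hπ hr := exists_MOver X F π hπ (hr trivial)

theorem MPosBisim_iff {X Y : (MComonad.{u} σ k).Coalgebra} :
    MPosBisim X Y ↔ ∃ r, (MForestCat σ k).GameRel X Y r := by
  rw [← ForestCat.posBisim_iff, MPosBisim]
  simp only [MLe_iff]
  rfl

end M

/-! ### Sets of pairs as positions of a positive game -/

/-- A set of pairs preserves the relations from left to right. -/
def PHom {τ : FirstOrder.Language.{0, 0}} (A B : Struct.{u} τ)
    (S : Set (A.carrier × B.carrier)) : Prop :=
  ∀ (n : ℕ) (R : τ.Relations n) (m : Fin n → A.carrier × B.carrier), (∀ i, m i ∈ S) →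
    RelMap R (fun i => (m i).1) → RelMap R fun i => (m i).2

theorem exists_prefix_max {α : Type u} {n : ℕ} (hn : n ≠ 0) {l : List α}
    {s : Fin n → List α} (h : ∀ i, s i <+: l) : ∃ j, ∀ i, s i <+: s j := by
  have : Nonempty (Fin n) := ⟨⟨0, Nat.pos_of_ne_zero hn⟩⟩
  obtain ⟨j, hj⟩ := Finite.exists_max fun i => (s i).length
  exact ⟨j, fun i => List.prefix_of_prefix_length_le (h i) (h j) (hj i)⟩

/-! ### The Ehrenfeucht–Fraïssé game -/

section EGame

variable {τ : FirstOrder.Language.{0, 0}} {k : ℕ}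

/-- A winning strategy for Duplicator in the positive Ehrenfeucht–Fraïssé game, as a set of
plays. -/
structure EGame (k : ℕ) (A B : Struct.{u} τ) (Q : List (A.carrier × B.carrier) → Prop) : Prop where
  nil : Q []
  init : ∀ {l m}, Q (l ++ [m]) → Q l
  forth : ∀ {l}, Q l → l.length < k → ∀ a, ∃ b, Q (l ++ [(a, b)])
  back : ∀ {l}, Q l → l.length < k → ∀ b, ∃ a, Q (l ++ [(a, b)])
  hom : ∀ {l}, Q l → PHom A B {m | m ∈ l}

/-- Duplicator wins the `j`-round game from the position given by a set of pairs. -/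
def EWin (A B : Struct.{u} τ) : ℕ → Set (A.carrier × B.carrier) → Prop
  | 0, S => PHom A B S
  | j + 1, S => PHom A B S ∧ (∀ a, ∃ b, EWin A B j (insert (a, b) S)) ∧
      ∀ b, ∃ a, EWin A B j (insert (a, b) S)

theorem EWin.hom {A B : Struct.{u} τ} {j : ℕ} {S : Set (A.carrier × B.carrier)}
    (h : EWin A B j S) : PHom A B S := by
  cases j with
  | zero => exact h
  | succ j => exact h.1

theorem setOf_mem_append_singleton {α : Type u} (l : List α) (m : α) :
    {x | x ∈ l ++ [m]} = insert m {x | x ∈ l} := by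
  ext x
  simp [or_comm]

theorem EGame.win {A B : Struct.{u} τ} {Q : List (A.carrier × B.carrier) → Prop}
    (h : EGame k A B Q) (j : ℕ) {l} (hl : Q l) (hk : l.length + j ≤ k) :
    EWin A B j {m | m ∈ l} := by
  induction j generalizing l with
  | zero => exact h.hom hl
  | succ j ih =>
    refine ⟨h.hom hl, fun a => ?_, fun b => ?_⟩
    · obtain ⟨b, hb⟩ := h.forth hl (by omega) a
      exact ⟨b, setOf_mem_append_singleton l _ ▸ ih hb (by simp; omega)⟩
    · obtain ⟨a, ha⟩ := h.back hl (by omega) b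
      exact ⟨a, setOf_mem_append_singleton l _ ▸ ih ha (by simp; omega)⟩

/-- The winning condition is imposed on every prefix, which makes closure under initial segments
immediate; it does not have to be derived from the longest position. -/
theorem EWin.game {A B : Struct.{u} τ} (h : EWin A B k ∅) :
    EGame k A B fun l => l.length ≤ k ∧
      ∀ l', l' <+: l → EWin A B (k - l'.length) {m | m ∈ l'} := by
  have ext : ∀ {l : List (A.carrier × B.carrier)} {m}, l.length < k →
      (∀ l', l' <+: l → EWin A B (k - l'.length) {m | m ∈ l'}) →
      EWin A B (k - (l.length + 1)) (insert m {m | m ∈ l}) → (l ++ [m]).length ≤ k ∧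
        ∀ l', l' <+: l ++ [m] → EWin A B (k - l'.length) {m | m ∈ l'} := by
    intro l m hk hl hm
    refine ⟨by simpa using hk, fun l' hl' => ?_⟩
    rcases List.prefix_concat_iff.1 hl' with rfl | hl'
    · rw [List.length_append, setOf_mem_append_singleton]
      exact hm
    · exact hl l' hl'
  refine ⟨⟨Nat.zero_le _, fun l' hl' => ?_⟩, fun {l m} hl => ⟨?_, fun l' hl' => ?_⟩,
    fun {l} hl hk a => ?_, fun {l} hl hk b => ?_, fun hl => (hl.2 _ List.prefix_rfl).hom⟩
  · rw [List.prefix_nil.1 hl']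
    simpa using h
  · have := hl.1
    rw [List.length_append] at this
    omega
  · exact hl.2 l' (hl'.trans (List.prefix_append _ _))
  · have hw := hl.2 _ List.prefix_rfl
    rw [show k - l.length = (k - (l.length + 1)) + 1 by omega] at hw
    obtain ⟨b, hb⟩ := hw.2.1 a
    exact ⟨b, ext hk hl.2 hb⟩
  · have hw := hl.2 _ List.prefix_rfl
    rw [show k - l.length = (k - (l.length + 1)) + 1 by omega] at hw
    obtain ⟨a, ha⟩ := hw.2.2 b
    exact ⟨a, ext hk hl.2 ha⟩

end EGame

/-! ### The Ehrenfeucht–Fraïssé game on co-free coalgebras -/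

section E

variable {τ : FirstOrder.Language.{0, 0}} [τ.IsRelational] {k : ℕ}

theorem ESeq.map_last_coext_id {A : Type u} (s : ESeq k A) :
    (ESeq.coext id s).val.map ESeq.last = s.val := by
  refine List.ext_getElem (by simp [ESeq.length_coext]) fun j h₁ h₂ => ?_
  rw [List.getElem_map, ESeq.getElem_coext]
  exact ESeq.last_pre s h₂

/-- The structure map of a co-free coalgebra lists the prefixes of a sequence, and taking last
elements recovers the sequence. So the forest order is the prefix order. -/
theorem Ecofree_le {A : Struct.{u} τ} (s t : ESeq k A.carrier) :
    ((EForestCat τ k).forest ((EComonad τ k).cofree.obj A)).le s t ↔ s.val <+: t.val := by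
  refine (ELe_iff ((EComonad τ k).cofree.obj A) s t).symm.trans ⟨fun h => ?_, fun h => ?_⟩
  · have h' : (ESeq.coext id s).val <+: (ESeq.coext id t).val := h
    have h' := h'.map ESeq.last
    rwa [ESeq.map_last_coext_id, ESeq.map_last_coext_id] at h'
  · exact ESeq.coext_prefix _ h

/-- Sequences are non-empty, so the truncated subtraction loses nothing: the roots are the sequences
of length one. -/
theorem Ecofree_ht {A : Struct.{u} τ} (s : ESeq k A.carrier) :
    ((EForestCat τ k).forest ((EComonad τ k).cofree.obj A)).ht s = s.val.length - 1 := by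
  change (unitLabel (ESeq.coext id s).val).length - 1 = _
  rw [unitLabel, List.length_map, ESeq.length_coext]

theorem Ecofree_par {A : Struct.{u} τ} (s t : ESeq k A.carrier) :
    ((EForestCat τ k).forest ((EComonad τ k).cofree.obj A)).par s t ↔
      ∃ a, t.val = s.val ++ [a] := by
  have hs := List.length_pos_of_ne_nil s.ne_nil
  have ht := List.length_pos_of_ne_nil t.ne_nil
  constructor
  · intro h
    obtain ⟨w, hw⟩ := (Ecofree_le s t).1 (Forest.le_of_par h)
    have h' := Forest.ht_of_par _ h
    rw [Ecofree_ht, Ecofree_ht, ← hw, List.length_append] at h'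
    obtain ⟨a, rfl⟩ := List.length_eq_one_iff.1 (by omega : w.length = 1)
    exact ⟨a, hw.symm⟩
  · rintro ⟨a, ha⟩
    refine Forest.par_of_comparable (.inl ((Ecofree_le s t).2 ⟨_, ha.symm⟩)) ?_
    rw [Ecofree_ht, Ecofree_ht, ha, List.length_append, List.length_singleton]
    omega

/-- Two sequences are related when they are the two sides of one play. A related tuple lies below
its greatest member, so its last elements are entries of a single play, to which `EGame.hom`
applies. -/
theorem EGame.gameRel {A B : Struct.{u} τ} {Q : List (A.carrier × B.carrier) → Prop}
    (h : EGame k A B Q) : (EForestCat τ k).GameRel ((EComonad τ k).cofree.obj A)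
      ((EComonad τ k).cofree.obj B) fun (s : ESeq k A.carrier) (t : ESeq k B.carrier) =>
        ∃ l, Q l ∧ s.val = l.map Prod.fst ∧ t.val = l.map Prod.snd := by
  refine ⟨fun _ => rfl, ?_, ?_, ?_, ?_, ?_, ?_, ?_⟩
  · rintro (s : ESeq k A.carrier) (t : ESeq k B.carrier) ⟨l, -, hs, ht⟩
    refine (Ecofree_ht s).trans (Eq.trans ?_ (Ecofree_ht t).symm)
    rw [hs, ht, List.length_map, List.length_map]
  · rintro (s : ESeq k A.carrier) (t : ESeq k B.carrier) (s' : ESeq k A.carrier)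
      (t' : ESeq k B.carrier) ⟨l, hl, hs, ht⟩ hs' ht'
    obtain ⟨a, ha⟩ := (Ecofree_par s' s).1 hs'
    obtain ⟨b, hb⟩ := (Ecofree_par t' t).1 ht'
    rw [ha] at hs
    rw [hb] at ht
    rcases List.eq_nil_or_concat l with rfl | ⟨l, m, rfl⟩
    · simp at hs
    · rw [List.concat_eq_append] at hl hs ht
      rw [List.map_append] at hs ht
      exact ⟨l, h.init hl, (List.append_inj' hs rfl).1, (List.append_inj' ht rfl).1⟩
  · rintro (s : ESeq k A.carrier) (t : ESeq k B.carrier) (s' : ESeq k A.carrier)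
      ⟨l, hl, hs, ht⟩ hs'
    obtain ⟨a, ha⟩ := (Ecofree_par s s').1 hs'
    have hk := s'.length_le
    rw [ha, hs, List.length_append, List.length_map, List.length_singleton] at hk
    obtain ⟨b, hb⟩ := h.forth hl hk a
    refine ⟨(⟨t.val ++ [b], by simp, by simpa [ht] using hk⟩ : ESeq k B.carrier),
      (Ecofree_par _ _).2 ⟨b, rfl⟩, _, hb, ?_, ?_⟩
    · rw [ha, hs, List.map_append]; rfl
    · simp [ht]
  · rintro (s : ESeq k A.carrier) (t : ESeq k B.carrier) (t' : ESeq k B.carrier)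
      ⟨l, hl, hs, ht⟩ ht'
    obtain ⟨b, hb⟩ := (Ecofree_par t t').1 ht'
    have hk := t'.length_le
    rw [hb, ht, List.length_append, List.length_map, List.length_singleton] at hk
    obtain ⟨a, ha⟩ := h.back hl hk b
    refine ⟨(⟨s.val ++ [a], by simp, by simpa [hs] using hk⟩ : ESeq k A.carrier),
      (Ecofree_par _ _).2 ⟨a, rfl⟩, _, ha, ?_, ?_⟩
    · simp [hs]
    · rw [hb, ht, List.map_append]; rfl
  · intro (s : ESeq k A.carrier) hs
    have hs : s.val.length - 1 = 0 := (Ecofree_ht s).symm.trans hs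
    have := List.length_pos_of_ne_nil s.ne_nil
    have hk := s.length_le
    obtain ⟨a, ha⟩ := List.length_eq_one_iff.1 (by omega : s.val.length = 1)
    obtain ⟨b, hb⟩ := h.forth h.nil (by simp; omega) a
    exact ⟨(⟨[b], by simp, by simp; omega⟩ : ESeq k B.carrier), Ecofree_ht _, _, hb, ha, rfl⟩
  · intro (t : ESeq k B.carrier) ht
    have ht : t.val.length - 1 = 0 := (Ecofree_ht t).symm.trans ht
    have := List.length_pos_of_ne_nil t.ne_nil
    have hk := t.length_le
    obtain ⟨b, hb⟩ := List.length_eq_one_iff.1 (by omega : t.val.length = 1)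
    obtain ⟨a, ha⟩ := h.back h.nil (by simp; omega) b
    exact ⟨(⟨[a], by simp, by simp; omega⟩ : ESeq k A.carrier), Ecofree_ht _, _, ha, rfl, hb⟩
  · intro n R (t : Fin n → ESeq k A.carrier) (t' : Fin n → ESeq k B.carrier) hmax ht
    have key : ∃ l, Q l ∧ ∃ m : Fin n → A.carrier × B.carrier, (∀ i, m i ∈ l) ∧
        (∀ i, (t i).last = (m i).1) ∧ (∀ i, (t' i).last = (m i).2) ∧
        ∀ i, (t' i).val <+: l.map Prod.snd := by
      -- Nullary symbols are preserved at the empty play.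
      by_cases hn : n = 0
      · subst hn
        exact ⟨[], h.nil, fun i => i.elim0, fun i => i.elim0, fun i => i.elim0, fun i => i.elim0,
          fun i => i.elim0⟩
      obtain ⟨j, ⟨l, hl, hs, hs'⟩, hi⟩ := hmax hn
      have hle : ∀ i, (t i).val <+: l.map Prod.fst := fun i => by
        rw [← hs]; exact (Ecofree_le _ _).1 (hi i).1
      have hle' : ∀ i, (t' i).val <+: l.map Prod.snd := fun i => by
        rw [← hs']; exact (Ecofree_le _ _).1 (hi i).2.1
      have hlen : ∀ i, (t i).val.length = (t' i).val.length := fun i => by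
        have h₁ := (Ecofree_ht (t i)).symm.trans ((hi i).2.2.trans (Ecofree_ht (t' i)))
        have := List.length_pos_of_ne_nil (t i).ne_nil
        have := List.length_pos_of_ne_nil (t' i).ne_nil
        omega
      have hlt : ∀ i, (t i).val.length - 1 < l.length := fun i => by
        have := List.length_pos_of_ne_nil (t i).ne_nil
        have := (hle i).length_le
        rw [List.length_map] at this
        omega
      -- A prefix of a side of the play ends in the entry whose index is its length minus one. Equal
      -- heights make this index the same on both sides.
      refine ⟨l, hl, fun i => l[(t i).val.length - 1]'(hlt i), fun i => List.getElem_mem _,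
        fun i => ?_, fun i => ?_, hle'⟩
      · rw [ESeq.last, List.getLast_eq_getElem, (hle i).getElem, List.getElem_map]
      · rw [ESeq.last, List.getLast_eq_getElem, (hle' i).getElem, List.getElem_map]
        simp only [hlen]
    obtain ⟨l, hl, m, hm, h₁, h₂, h₃⟩ := key
    refine ⟨fun i j => List.prefix_or_prefix_of_prefix (h₃ i) (h₃ j), ?_⟩
    have := h.hom hl n R m hm (by
      have h' : RelMap R fun i => (t i).last := ht.2
      simpa only [h₁] using h')
    simpa only [h₂] using this

/-- Nodes are non-empty sequences, so the empty play is added by hand and first moves are answered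
by the clauses for roots. For `EGame.hom`, each pair in a play ends some initial segment of it;
these segments form a comparable tuple whose last elements are the given ones. -/
theorem exists_EGame {A B : Struct.{u} τ} {r : ESeq k A.carrier → ESeq k B.carrier → Prop}
    (h : (EForestCat τ k).GameRel ((EComonad τ k).cofree.obj A)
      ((EComonad τ k).cofree.obj B) r) :
    EGame k A B fun l => l = [] ∨ ∃ s t, r s t ∧ s.val = l.map Prod.fst ∧
      t.val = l.map Prod.snd := by
  have init : ∀ {l : List (A.carrier × B.carrier)} {m}, (l ++ [m] = [] ∨ ∃ s t, r s t ∧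
      s.val = (l ++ [m]).map Prod.fst ∧ t.val = (l ++ [m]).map Prod.snd) →
      (l = [] ∨ ∃ s t, r s t ∧ s.val = l.map Prod.fst ∧ t.val = l.map Prod.snd) := by
    rintro l m (hl | ⟨s, t, hr, hs, ht⟩)
    · simp at hl
    by_cases hl : l = []
    · exact .inl hl
    have hk := s.length_le
    rw [hs, List.length_map, List.length_append] at hk
    refine .inr ⟨⟨l.map Prod.fst, by simpa using hl, by rw [List.length_map]; omega⟩,
      ⟨l.map Prod.snd, by simpa using hl, by rw [List.length_map]; omega⟩, h.par hr ?_ ?_, rfl, rfl⟩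
    · exact (Ecofree_par _ _).2 ⟨m.1, by simpa using hs⟩
    · exact (Ecofree_par _ _).2 ⟨m.2, by simpa using ht⟩
  have pre : ∀ {l l' : List (A.carrier × B.carrier)}, (l ++ l' = [] ∨ ∃ s t, r s t ∧
      s.val = (l ++ l').map Prod.fst ∧ t.val = (l ++ l').map Prod.snd) →
      (l = [] ∨ ∃ s t, r s t ∧ s.val = l.map Prod.fst ∧ t.val = l.map Prod.snd) := by
    intro l l' hl
    induction l' using List.reverseRecOn with
    | nil => rwa [List.append_nil] at hl
    | append_singleton l' m ih =>
      rw [← List.append_assoc] at hl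
      exact ih (init hl)
  refine ⟨.inl rfl, init, ?_, ?_, ?_⟩
  · rintro l (rfl | ⟨s, t, hr, hs, ht⟩) hk a
    · obtain ⟨t, ht, hr⟩ := h.root_forth (x := (⟨[a], by simp, hk⟩ : ESeq k A.carrier))
        (Ecofree_ht _)
      have ht : t.val.length - 1 = 0 := (Ecofree_ht t).symm.trans ht
      have := List.length_pos_of_ne_nil t.ne_nil
      obtain ⟨b, hb⟩ := List.length_eq_one_iff.1 (by omega : t.val.length = 1)
      exact ⟨b, .inr ⟨_, t, hr, rfl, hb⟩⟩
    · obtain ⟨t', ht', hr'⟩ := h.forth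
        (x' := (⟨s.val ++ [a], by simp, by simpa [hs] using hk⟩ : ESeq k A.carrier)) hr
        ((Ecofree_par _ _).2 ⟨a, rfl⟩)
      obtain ⟨b, hb⟩ := (Ecofree_par _ _).1 ht'
      exact ⟨b, .inr ⟨_, t', hr', by simp [hs], by simpa [ht] using hb⟩⟩
  · rintro l (rfl | ⟨s, t, hr, hs, ht⟩) hk b
    · obtain ⟨s, hs, hr⟩ := h.root_back (y := (⟨[b], by simp, hk⟩ : ESeq k B.carrier))
        (Ecofree_ht _)
      have hs : s.val.length - 1 = 0 := (Ecofree_ht s).symm.trans hs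
      have := List.length_pos_of_ne_nil s.ne_nil
      obtain ⟨a, ha⟩ := List.length_eq_one_iff.1 (by omega : s.val.length = 1)
      exact ⟨a, .inr ⟨s, _, hr, ha, rfl⟩⟩
    · obtain ⟨s', hs', hr'⟩ := h.back
        (y' := (⟨t.val ++ [b], by simp, by simpa [ht] using hk⟩ : ESeq k B.carrier)) hr
        ((Ecofree_par _ _).2 ⟨b, rfl⟩)
      obtain ⟨a, ha⟩ := (Ecofree_par _ _).1 hs'
      exact ⟨a, .inr ⟨s', _, hr', by simpa [hs] using ha, by simp [ht]⟩⟩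
  · intro l hl n R m hm hR
    have hm' : ∀ i, ∃ l₁ l₂, l = (l₁ ++ [m i]) ++ l₂ := fun i => by
      obtain ⟨l₁, l₂, e⟩ := List.append_of_mem (hm i)
      exact ⟨l₁, l₂, by simpa using e⟩
    choose l₁ l₂ hl' using hm'
    have hst : ∀ i, ∃ s t, r s t ∧ s.val = (l₁ i ++ [m i]).map Prod.fst ∧
        t.val = (l₁ i ++ [m i]).map Prod.snd := fun i =>
      (pre (hl' i ▸ hl)).resolve_left (by simp)
    choose s t hr hs ht using hst
    have hpre : ∀ i, l₁ i ++ [m i] <+: l := fun i => ⟨_, (hl' i).symm⟩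
    have hls : ∀ i, (s i).last = (m i).1 := fun i => by simp [ESeq.last, hs]
    have hlt : ∀ i, (t i).last = (m i).2 := fun i => by simp [ESeq.last, ht]
    have key := h.rel (R := R) (t := s) (t' := t) (fun hn => by
      obtain ⟨j, hj⟩ := exists_prefix_max hn hpre
      refine ⟨j, hr j, fun i => ⟨(Ecofree_le _ _).2 ?_, (Ecofree_le _ _).2 ?_, h.ht (hr i)⟩⟩
      · rw [hs, hs]; exact (hj i).map _
      · rw [ht, ht]; exact (hj i).map _) ⟨fun i j => by
        rw [hs, hs]
        exact (List.prefix_or_prefix_of_prefix (hpre i) (hpre j)).imp (fun h => h.map _)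
          fun h => h.map _, by simpa only [hls] using hR⟩
    have key : RelMap R fun i => (t i).last := key.2
    simpa only [hlt] using key

theorem EPosBisim_cofree_iff {A B : Struct.{u} τ} :
    EPosBisim ((EComonad τ k).cofree.obj A) ((EComonad τ k).cofree.obj B) ↔ EWin A B k ∅ := by
  rw [EPosBisim_iff]
  refine ⟨fun ⟨r, h⟩ => ?_, fun h => ⟨_, h.game.gameRel⟩⟩
  simpa using (exists_EGame h).win k (.inl rfl) (by simp)

end E

/-! ### First-order logic -/

section FO

variable {σ : FirstOrder.Language.{0, 0}} [σ.IsRelational]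

/-- `I` is the diagonal on both sides, so preserving it means that equal first components have equal
second components. Injectivity is not demanded, as inequations are not positive. -/
theorem PHom_J_iff {A B : Struct.{u} σ} {S : Set (A.carrier × B.carrier)} :
    PHom (J A) (J B) S ↔ PHom A B S ∧ ∀ p ∈ S, ∀ q ∈ S, p.1 = q.1 → p.2 = q.2 := by
  refine ⟨fun h => ⟨fun n R => h n (Sum.inl R), fun p hp q hq e => ?_⟩, fun h n R => ?_⟩
  · exact h 2 (Sum.inr IRel.I) ![p, q] (fun i => by fin_cases i <;> assumption) e
  · match n, R with
    | _, Sum.inl R => exact h.1 _ R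
    | _, Sum.inr IRel.I => exact fun m hm e => h.2 _ (hm 0) _ (hm 1) e

/-- Because `x` is fresh no value is overwritten, and the position grows by exactly the new pair. -/
theorem range_extendVal {A B : Type u} {V : Set ℕ} (v : V → A) (w : V → B) {x : ℕ} (hx : x ∉ V)
    (a : A) (b : B) :
    Set.range (fun y => (extendVal v x a y, extendVal w x b y)) =
      insert (a, b) (Set.range fun y => (v y, w y)) := by
  ext ⟨c, d⟩
  simp only [Set.mem_range, Set.mem_insert_iff, Prod.mk.injEq]
  constructor
  · rintro ⟨⟨y, hy⟩, rfl, rfl⟩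
    by_cases h : y = x
    · simp [extendVal, h]
    · exact .inr ⟨⟨y, (Set.mem_insert_iff.1 hy).resolve_left h⟩, by simp [extendVal, h]⟩
  · rintro (⟨rfl, rfl⟩ | ⟨⟨y, hy⟩, rfl, rfl⟩)
    · exact ⟨⟨x, Set.mem_insert _ _⟩, by simp [extendVal]⟩
    · have h : y ≠ x := fun h => hx (h ▸ hy)
      exact ⟨⟨y, Set.mem_insert_of_mem _ hy⟩, by simp [extendVal, h]⟩

/-- Here `x` may be rebound: the assignment loses a value while the position keeps the old pair.
Inclusion is enough. -/
theorem extendVal_mem {A B : Type u} {V : Set ℕ} {v : V → A} {w : V → B} {x : ℕ} {a : A} {b : B}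
    {S : Set (A × B)} (h : ∀ y, (v y, w y) ∈ S) (y : ↥(insert x V)) :
    (extendVal v x a y, extendVal w x b y) ∈ insert (a, b) S := by
  by_cases hy : (y : ℕ) = x
  · simp [extendVal, hy]
  · refine Set.mem_insert_of_mem _ ?_
    simpa [extendVal, hy] using h ⟨y, (Set.mem_insert_iff.1 y.2).resolve_left hy⟩

/-- An existential quantifier uses a forth move and a universal one a back move, each at the cost of
one round and one unit of quantifier rank. The position may contain more pairs than the assignments.
-/
theorem EWin.realize {A B : Struct.{u} σ} {V : Set ℕ} {φ : Formula.{u} σ V} (hφ : φ.NegFree)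
    {j : ℕ} (hj : φ.quantifierRank ≤ j) {S : Set (A.carrier × B.carrier)}
    (hS : EWin (J A) (J B) j S) {v : V → A.carrier} {w : V → B.carrier}
    (h : ∀ x, (v x, w x) ∈ S) (hv : φ.Realize v) : φ.Realize w := by
  induction φ generalizing j S with
  | eq x y => exact (PHom_J_iff.1 hS.hom).2 _ (h x) _ (h y) hv
  | rel R x => exact (PHom_J_iff.1 hS.hom).1 _ R (fun i => (v (x i), w (x i))) (fun i => h _) hv
  | neg => exact hφ.elim
  | conj ι φ ih =>
    exact fun i => ih i (hφ i) (le_trans (le_iSup (fun i => (φ i).quantifierRank) i) hj) hS h (hv i)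
  | disj ι φ ih =>
    obtain ⟨i, hi⟩ := hv
    exact ⟨i, ih i (hφ i) (le_trans (le_iSup (fun i => (φ i).quantifierRank) i) hj) hS h hi⟩
  | ex x φ ih =>
    change φ.quantifierRank + 1 ≤ _ at hj
    cases j with
    | zero => simp at hj
    | succ j =>
      obtain ⟨a, ha⟩ := hv
      obtain ⟨b, hb⟩ := hS.2.1 a
      exact ⟨b, ih hφ ((ENat.add_le_add_iff_right ENat.one_ne_top).1 (by simpa using hj)) hb
        (extendVal_mem h) ha⟩
  | all x φ ih =>
    change φ.quantifierRank + 1 ≤ _ at hj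
    cases j with
    | zero => simp at hj
    | succ j =>
      intro b
      obtain ⟨a, ha⟩ := hS.2.2 b
      exact ih hφ ((ENat.add_le_add_iff_right ENat.one_ne_top).1 (by simpa using hj)) ha
        (extendVal_mem h) (hv a)

/-- Positive first-order formulas of bounded quantifier rank. -/
def IsPosFO {V : Set ℕ} (φ : Formula.{u} σ V) (j : ℕ) : Prop :=
  φ.NegFree ∧ φ.IsFirstOrder ∧ φ.quantifierRank ≤ j

theorem exists_atoms [Finite (Σ n, σ.Relations n)] (V : Set ℕ) [Finite V] (j : ℕ) :
    ∃ (ι : Type) (_ : Finite ι) (Φ : ι → Formula.{u} σ V), (∀ i, IsPosFO (Φ i) j) ∧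
      ∀ (A B : Struct.{u} σ) (v : V → A.carrier) (w : V → B.carrier),
        (∀ i, (Φ i).Realize v → (Φ i).Realize w) →
          PHom (J A) (J B) (Set.range fun x => (v x, w x)) := by
  refine ⟨(V × V) ⊕ Σ R : (Σ n, σ.Relations n), (Fin R.1 → V), inferInstance,
    Sum.elim (fun p => .eq p.1 p.2) fun p => .rel p.1.2 p.2, ?_, fun A B v w h => ?_⟩
  · rintro (p | p)
    · exact ⟨trivial, trivial, bot_le⟩
    · exact ⟨trivial, trivial, bot_le⟩
  · refine PHom_J_iff.2 ⟨fun n R m hm hR => ?_, ?_⟩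
    · choose x hx using hm
      obtain rfl : (fun i => (v (x i), w (x i))) = m := funext hx
      exact h (.inr ⟨⟨n, R⟩, x⟩) hR
    · rintro _ ⟨x, rfl⟩ _ ⟨y, rfl⟩ e
      exact h (.inl (x, y)) e

/-- A finite family, chosen before the structures, decides the game. One more round adds, for each
subset `s` of the previous family, the formulas `∃ x ⋀ s` and `∀ x ⋁ s`; both stay first-order
because the family is finite. Finiteness of `V` supplies the fresh variable. -/
theorem exists_family [Finite (Σ n, σ.Relations n)] (j : ℕ) (V : Set ℕ) [Finite V] :
    ∃ (ι : Type) (_ : Finite ι) (Φ : ι → Formula.{u} σ V), (∀ i, IsPosFO (Φ i) j) ∧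
      ∀ (A B : Struct.{u} σ) (v : V → A.carrier) (w : V → B.carrier),
        (∀ i, (Φ i).Realize v → (Φ i).Realize w) →
          EWin (J A) (J B) j (Set.range fun x => (v x, w x)) := by
  induction j generalizing V with
  | zero => exact exists_atoms V 0
  | succ j ih =>
    obtain ⟨x, hx⟩ := (Set.toFinite V).exists_notMem
    have : Finite ↥(insert x V) := ((Set.toFinite V).insert x).to_subtype
    obtain ⟨ι₀, _, Φ₀, hΦ₀, h₀⟩ := exists_atoms.{u} (σ := σ) V (j + 1)
    obtain ⟨ι, _, Φ, hΦ, h⟩ := ih (insert x V)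
    refine ⟨ι₀ ⊕ Set ι ⊕ Set ι, inferInstance, Sum.elim Φ₀ (Sum.elim
      (fun s => .ex x (.conj (ULift.{u} s) fun i => Φ i.down))
      (fun s => .all x (.disj (ULift.{u} s) fun i => Φ i.down))), ?_, fun A B v w hvw => ?_⟩
    · rintro (i | s | s)
      · exact hΦ₀ i
      · refine ⟨fun i => (hΦ _).1, ⟨inferInstance, fun i => (hΦ _).2.1⟩, ?_⟩
        change (⨆ i, _) + 1 ≤ ((j + 1 : ℕ) : ℕ∞)
        rw [Nat.cast_add, Nat.cast_one]
        exact add_le_add_left (iSup_le fun i => (hΦ _).2.2) 1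
      · refine ⟨fun i => (hΦ _).1, ⟨inferInstance, fun i => (hΦ _).2.1⟩, ?_⟩
        change (⨆ i, _) + 1 ≤ ((j + 1 : ℕ) : ℕ∞)
        rw [Nat.cast_add, Nat.cast_one]
        exact add_le_add_left (iSup_le fun i => (hΦ _).2.2) 1
    · refine ⟨h₀ A B v w fun i => hvw (.inl i), fun a => ?_, fun b => ?_⟩
      -- The subset is that of all formulas true of `a`, so a witness `b` satisfies whatever `a`
      -- does.
      · obtain ⟨b, hb⟩ := hvw (.inr (.inl {i | (Φ i).Realize (extendVal v x a)}))
          ⟨a, fun i => i.down.2⟩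
        refine ⟨b, (congrArg (EWin (J A) (J B) j) (range_extendVal v w hx a b)).mp ?_⟩
        exact h A B _ _ fun i hi => hb ⟨i, hi⟩
      · by_contra hcon
        push Not at hcon
        -- If no `a` were a good answer, each `a` would satisfy some formula false of `b`. Then
        -- every `a` satisfies the disjunction of the formulas false of `b`, hence so does `b`,
        -- which is absurd.
        obtain ⟨i, hi⟩ := hvw (.inr (.inr {i | ¬ (Φ i).Realize (extendVal w x b)})) (fun a => by
          by_contra ha
          refine hcon a ((congrArg (EWin (J A) (J B) j) (range_extendVal v w hx a b)).mp ?_)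
          refine h A B _ _ fun i hi => ?_
          by_contra hi'
          exact ha ⟨⟨i, hi'⟩, hi⟩) b
        exact i.down.2 hi

theorem preserves_FO_iff [Finite (Σ n, σ.Relations n)] (k : ℕ) (A B : Struct.{u} σ) :
    Preserves (positive (FOk.{u} σ k)) A B ↔ EWin (J A) (J B) k ∅ := by
  constructor
  · intro h
    obtain ⟨ι, _, Φ, hΦ, hw⟩ := exists_family.{u} (σ := σ) k ∅
    have := hw A B (fun x => (Set.notMem_empty _ x.2).elim) (fun x => (Set.notMem_empty _ x.2).elim)
      fun i => h (Φ i) ⟨⟨(hΦ i).2.1, (hΦ i).2.2⟩, (hΦ i).1⟩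
    rwa [Set.range_eq_empty] at this
  · exact fun h φ hφ => h.realize hφ.2 hφ.1.2 fun x => (Set.notMem_empty _ x.2).elim

end FO

/-! ### The pebble game -/

section PGame

variable {k : ℕ}

/-- The moves in the left structure of a play of the pebble game. -/
def playL {A B : Type u} (l : List (Fin k × A × B)) : List (Fin k × A) :=
  l.map (Prod.map id Prod.fst)

/-- The moves in the right structure of a play of the pebble game. -/
def playR {A B : Type u} (l : List (Fin k × A × B)) : List (Fin k × B) :=
  l.map (Prod.map id Prod.snd)

theorem length_playL {A B : Type u} (l : List (Fin k × A × B)) : (playL l).length = l.length :=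
  List.length_map _

theorem length_playR {A B : Type u} (l : List (Fin k × A × B)) : (playR l).length = l.length :=
  List.length_map _

theorem playL_append {A B : Type u} (l l' : List (Fin k × A × B)) :
    playL (l ++ l') = playL l ++ playL l' := List.map_append

theorem playR_append {A B : Type u} (l l' : List (Fin k × A × B)) :
    playR (l ++ l') = playR l ++ playR l' := List.map_append

theorem playL_prefix {A B : Type u} {l l' : List (Fin k × A × B)} (h : l <+: l') :
    playL l <+: playL l' := h.map _

theorem playR_prefix {A B : Type u} {l l' : List (Fin k × A × B)} (h : l <+: l') :
    playR l <+: playR l' := h.map _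

/-- The pebble `p` lies on the pair `m` after a play. -/
def LiesOn {A B : Type u} (l : List (Fin k × A × B)) (p : Fin k) (m : A × B) : Prop :=
  ∃ l₁ l₂, l = (l₁ ++ [(p, m)]) ++ l₂ ∧ ∀ m' ∈ l₂, m'.1 ≠ p

theorem liesOn_append {A B : Type u} (l : List (Fin k × A × B)) (p : Fin k) (m : A × B) :
    LiesOn (l ++ [(p, m)]) p m :=
  ⟨l, [], by simp, by simp⟩

theorem LiesOn.append {A B : Type u} {l : List (Fin k × A × B)} {p q : Fin k} {m : A × B}
    (h : LiesOn l q m) (hq : q ≠ p) (m' : A × B) : LiesOn (l ++ [(p, m')]) q m := by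
  obtain ⟨l₁, l₂, rfl, h⟩ := h
  refine ⟨l₁, l₂ ++ [(p, m')], by simp, fun x hx e => ?_⟩
  rcases List.mem_append.1 hx with hx | hx
  · exact h x hx e
  · rw [List.mem_singleton.1 hx] at e
    exact hq e.symm

/-- The pairs of elements that carry the same pebble after a play. -/
def pebbled {A B : Type u} (l : List (Fin k × A × B)) : Set (A × B) := {m | ∃ p, LiesOn l p m}

variable {τ : FirstOrder.Language.{0, 0}}

/-- A winning strategy for Duplicator in the positive pebble game, as a set of plays. -/
structure PGame (k : ℕ) (A B : Struct.{u} τ)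
    (Q : List (Fin k × A.carrier × B.carrier) → Prop) : Prop where
  nil : Q []
  init : ∀ {l m}, Q (l ++ [m]) → Q l
  forth : ∀ {l}, Q l → ∀ p a, ∃ b, Q (l ++ [(p, a, b)])
  back : ∀ {l}, Q l → ∀ p b, ∃ a, Q (l ++ [(p, a, b)])
  hom : ∀ {l}, Q l → PHom A B (pebbled l)

end PGame

/-! ### The pebble game on co-free coalgebras -/

section P

variable {τ : FirstOrder.Language.{0, 0}} [τ.IsRelational] {k : ℕ}

theorem PSeq.map_last_coext_id {A : Type u} (s : PSeq k A) :
    (PSeq.coext id s).val.map (Prod.map id PSeq.last) = s.val := by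
  refine List.ext_getElem (by simp [PSeq.length_coext]) fun j h₁ h₂ => ?_
  rw [List.getElem_map, PSeq.getElem_coext _ _ _ _ h₂]
  exact Prod.ext rfl (congrArg Prod.snd (PSeq.lastMove_pre s h₂) :)

theorem Pcofree_le {A : Struct.{u} τ} (s t : PSeq k A.carrier) :
    ((PForestCat τ k).forest ((PComonad τ k).cofree.obj A)).le s t ↔ s.val <+: t.val := by
  refine (PLe_iff ((PComonad τ k).cofree.obj A) s t).symm.trans ⟨fun h => ?_, fun h => ?_⟩
  · have h' : (PSeq.coext id s).val <+: (PSeq.coext id t).val := h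
    have h' := h'.map (Prod.map id PSeq.last)
    rwa [PSeq.map_last_coext_id, PSeq.map_last_coext_id] at h'
  · exact PSeq.coext_prefix _ h

theorem Pcofree_ht {A : Struct.{u} τ} (s : PSeq k A.carrier) :
    ((PForestCat τ k).forest ((PComonad τ k).cofree.obj A)).ht s = s.val.length - 1 := by
  change (PSeq.coext id s).val.length - 1 = _
  rw [PSeq.length_coext]

theorem Pcofree_lab {A : Struct.{u} τ} (s : PSeq k A.carrier) :
    ((PForestCat τ k).forest ((PComonad τ k).cofree.obj A)).lab s = s.lastMove.1 :=
  congrArg Prod.fst (PSeq.lastMove_coext id s)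

theorem Pcofree_par {A : Struct.{u} τ} (s t : PSeq k A.carrier) :
    ((PForestCat τ k).forest ((PComonad τ k).cofree.obj A)).par s t ↔
      ∃ a, t.val = s.val ++ [a] := by
  have hs := List.length_pos_of_ne_nil s.ne_nil
  have ht := List.length_pos_of_ne_nil t.ne_nil
  constructor
  · intro h
    obtain ⟨w, hw⟩ := (Pcofree_le s t).1 (Forest.le_of_par h)
    have h' := Forest.ht_of_par _ h
    rw [Pcofree_ht, Pcofree_ht, ← hw, List.length_append] at h'
    obtain ⟨a, rfl⟩ := List.length_eq_one_iff.1 (by omega : w.length = 1)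
    exact ⟨a, hw.symm⟩
  · rintro ⟨a, ha⟩
    refine Forest.par_of_comparable (.inl ((Pcofree_le s t).2 ⟨_, ha.symm⟩)) ?_
    rw [Pcofree_ht, Pcofree_ht, ha, List.length_append, List.length_singleton]
    omega

theorem PSeq.lastMove_of_eq {A : Type u} {s : PSeq k A} {l m} (h : s.val = l ++ [m]) :
    s.lastMove = m := by
  simp [PSeq.lastMove, h]

theorem Pcofree_root {A : Struct.{u} τ} {s : PSeq k A.carrier}
    (h : ((PForestCat τ k).forest ((PComonad τ k).cofree.obj A)).ht s = 0) :
    ∃ a, s.val = [(s.lastMove.1, a)] := by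
  have h : s.val.length - 1 = 0 := (Pcofree_ht s).symm.trans h
  have := List.length_pos_of_ne_nil s.ne_nil
  obtain ⟨⟨p, a⟩, ha⟩ := List.length_eq_one_iff.1 (by omega : s.val.length = 1)
  exact ⟨a, by rw [PSeq.lastMove_of_eq (l := []) ha]; exact ha⟩

/-- The initial segment of a play that corresponds to a prefix of one of its two sides. -/
theorem exists_take_of_prefix {A B : Type u} {l : List (Fin k × A × B)} {s : PSeq k A}
    {t : PSeq k B} (hs : s.val <+: playL l) (ht : t.val <+: playR l)
    (e : s.val.length = t.val.length) : ∃ l₁ p m, l₁ ++ [(p, m)] <+: l ∧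
      s.val = playL (l₁ ++ [(p, m)]) ∧ t.val = playR (l₁ ++ [(p, m)]) := by
  have hs' : s.val = playL (l.take s.val.length) := by
    rw [playL, List.map_take]
    exact List.prefix_iff_eq_take.1 hs
  have ht' : t.val = playR (l.take s.val.length) := by
    rw [playR, List.map_take, e]
    exact List.prefix_iff_eq_take.1 ht
  rcases List.eq_nil_or_concat (l.take s.val.length) with h | ⟨l₁, ⟨p, m⟩, h⟩
  · rw [h] at hs'
    exact (s.ne_nil hs').elim
  · rw [List.concat_eq_append] at h
    exact ⟨l₁, p, m, h ▸ List.take_prefix _ _, h ▸ hs', h ▸ ht'⟩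

/-- As for `EGame.gameRel`, with the pebble condition in addition: it says that the pebbles of a
related tuple are still in place at the end of the longest play, so the last elements form pebbled
pairs. -/
theorem PGame.gameRel {A B : Struct.{u} τ} {Q : List (Fin k × A.carrier × B.carrier) → Prop}
    (h : PGame k A B Q) : (PForestCat τ k).GameRel ((PComonad τ k).cofree.obj A)
      ((PComonad τ k).cofree.obj B) fun (s : PSeq k A.carrier) (t : PSeq k B.carrier) =>
        ∃ l, Q l ∧ s.val = playL l ∧ t.val = playR l := by
  refine ⟨?_, ?_, ?_, ?_, ?_, ?_, ?_, ?_⟩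
  · rintro (s : PSeq k A.carrier) (t : PSeq k B.carrier) ⟨l, -, hs, ht⟩
    refine (Pcofree_lab s).trans (Eq.trans ?_ (Pcofree_lab t).symm)
    rcases List.eq_nil_or_concat l with rfl | ⟨l, m, rfl⟩
    · exact (s.ne_nil hs).elim
    · rw [List.concat_eq_append] at hs ht
      rw [playL_append] at hs
      rw [playR_append] at ht
      rw [PSeq.lastMove_of_eq hs, PSeq.lastMove_of_eq ht]
      rfl
  · rintro (s : PSeq k A.carrier) (t : PSeq k B.carrier) ⟨l, -, hs, ht⟩
    refine (Pcofree_ht s).trans (Eq.trans ?_ (Pcofree_ht t).symm)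
    rw [hs, ht, length_playL, length_playR]
  · rintro (s : PSeq k A.carrier) (t : PSeq k B.carrier) (s' : PSeq k A.carrier)
      (t' : PSeq k B.carrier) ⟨l, hl, hs, ht⟩ hs' ht'
    obtain ⟨a, ha⟩ := (Pcofree_par s' s).1 hs'
    obtain ⟨b, hb⟩ := (Pcofree_par t' t).1 ht'
    rw [ha] at hs
    rw [hb] at ht
    rcases List.eq_nil_or_concat l with rfl | ⟨l, m, rfl⟩
    · simp [playL] at hs
    · rw [List.concat_eq_append] at hl hs ht
      rw [playL_append] at hs
      rw [playR_append] at ht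
      exact ⟨l, h.init hl, (List.append_inj' hs rfl).1, (List.append_inj' ht rfl).1⟩
  · rintro (s : PSeq k A.carrier) (t : PSeq k B.carrier) (s' : PSeq k A.carrier)
      ⟨l, hl, hs, ht⟩ hs'
    obtain ⟨⟨p, a⟩, ha⟩ := (Pcofree_par s s').1 hs'
    obtain ⟨b, hb⟩ := h.forth hl p a
    refine ⟨(⟨t.val ++ [(p, b)], by simp⟩ : PSeq k B.carrier),
      (Pcofree_par _ _).2 ⟨(p, b), rfl⟩, _, hb, ?_, ?_⟩
    · rw [ha, hs, playL_append]; rfl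
    · rw [playR_append, ← ht]; rfl
  · rintro (s : PSeq k A.carrier) (t : PSeq k B.carrier) (t' : PSeq k B.carrier)
      ⟨l, hl, hs, ht⟩ ht'
    obtain ⟨⟨p, b⟩, hb⟩ := (Pcofree_par t t').1 ht'
    obtain ⟨a, ha⟩ := h.back hl p b
    refine ⟨(⟨s.val ++ [(p, a)], by simp⟩ : PSeq k A.carrier),
      (Pcofree_par _ _).2 ⟨(p, a), rfl⟩, _, ha, ?_, ?_⟩
    · rw [playL_append, ← hs]; rfl
    · rw [hb, ht, playR_append]; rfl
  · intro (s : PSeq k A.carrier) hs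
    obtain ⟨a, ha⟩ := Pcofree_root hs
    obtain ⟨b, hb⟩ := h.forth h.nil s.lastMove.1 a
    exact ⟨(⟨[(s.lastMove.1, b)], by simp⟩ : PSeq k B.carrier), Pcofree_ht _, _, hb, ha, rfl⟩
  · intro (t : PSeq k B.carrier) ht
    obtain ⟨b, hb⟩ := Pcofree_root ht
    obtain ⟨a, ha⟩ := h.back h.nil t.lastMove.1 b
    exact ⟨(⟨[(t.lastMove.1, a)], by simp⟩ : PSeq k A.carrier), Pcofree_ht _, _, ha, rfl, hb⟩
  · intro n R (t : Fin n → PSeq k A.carrier) (t' : Fin n → PSeq k B.carrier) hmax ht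
    have hact : PSeq.Active t := ht.2.1
    have hR : RelMap R fun i => (t i).last := ht.2.2
    have key : ∃ l, Q l ∧ ∃ (l₁ : Fin n → List (Fin k × A.carrier × B.carrier))
        (p : Fin n → Fin k) (m : Fin n → A.carrier × B.carrier),
        (∀ i, l₁ i ++ [(p i, m i)] <+: l) ∧ (∀ i, (t i).val = playL (l₁ i ++ [(p i, m i)])) ∧
        (∀ i, (t' i).val = playR (l₁ i ++ [(p i, m i)])) ∧
        (n ≠ 0 → ∃ j, l₁ j ++ [(p j, m j)] = l) := by
      by_cases hn : n = 0
      · subst hn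
        exact ⟨[], h.nil, fun i => i.elim0, fun i => i.elim0, fun i => i.elim0, fun i => i.elim0,
          fun i => i.elim0, fun i => i.elim0, fun h => (h rfl).elim⟩
      obtain ⟨j, ⟨l, hl, hs, hs'⟩, hi⟩ := hmax hn
      have hlen : ∀ i, (t i).val.length = (t' i).val.length := fun i => by
        have h₁ := (Pcofree_ht (t i)).symm.trans ((hi i).2.2.trans (Pcofree_ht (t' i)))
        have := List.length_pos_of_ne_nil (t i).ne_nil
        have := List.length_pos_of_ne_nil (t' i).ne_nil
        omega
      have hex := fun i => exists_take_of_prefix (hs ▸ (Pcofree_le _ _).1 (hi i).1)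
        (hs' ▸ (Pcofree_le _ _).1 (hi i).2.1) (hlen i)
      choose l₁ p m h₁ h₂ h₃ using hex
      refine ⟨l, hl, l₁, p, m, h₁, h₂, h₃, fun _ => ⟨j, (h₁ j).eq_of_length ?_⟩⟩
      have e := congrArg List.length (hs.symm.trans (h₂ j))
      rw [length_playL, length_playL] at e
      exact e.symm
    obtain ⟨l, hl, l₁, p, m, hpre, hL, hR', hmx⟩ := key
    have hmL : ∀ i, (t i).lastMove = (p i, (m i).1) := fun i =>
      PSeq.lastMove_of_eq ((hL i).trans (playL_append _ _))
    have hmR : ∀ i, (t' i).lastMove = (p i, (m i).2) := fun i =>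
      PSeq.lastMove_of_eq ((hR' i).trans (playR_append _ _))
    have hlastL : ∀ i, (t i).last = (m i).1 := fun i => congrArg Prod.snd (hmL i)
    have hlastR : ∀ i, (t' i).last = (m i).2 := fun i => congrArg Prod.snd (hmR i)
    refine ⟨fun i j => ?_, ?_, ?_⟩
    · rw [hR', hR']
      exact (List.prefix_or_prefix_of_prefix (hpre i) (hpre j)).imp playR_prefix playR_prefix
    -- Both sides of a play move the same pebbles, so `t'` is active because `t` is.
    · intro i j w hw x hx
      change (t' i).val ++ w = (t' j).val at hw
      rw [hmR]
      have hle : (l₁ i ++ [(p i, m i)]).length ≤ (l₁ j ++ [(p j, m j)]).length := by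
        have := congrArg List.length hw
        rw [List.length_append, hR', hR', length_playR, length_playR] at this
        omega
      obtain ⟨w', hw'⟩ := List.prefix_of_prefix_length_le (hpre i) (hpre j) hle
      rw [hR', hR', ← hw', playR_append _ w', List.append_cancel_left_eq] at hw
      subst hw
      obtain ⟨x', hx', rfl⟩ := List.mem_map.1 hx
      have := hact i j (playL w') (by rw [hL, hL, ← hw', playL_append _ w']) _
        (List.mem_map_of_mem hx')
      rwa [hmL] at this
    · simp only [hlastR]
      refine h.hom hl n R m (fun i => ?_) (by simpa only [hlastL] using hR)
      obtain ⟨w, hw⟩ := hpre i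
      refine ⟨p i, l₁ i, w, hw.symm, fun x hx => ?_⟩
      -- `t j` is the whole left side of `l`, so activity rules out any later move of the pebble `p
      -- i` in `l`.
      obtain ⟨j, hj⟩ := hmx i.pos.ne'
      have := hact i j (playL w) (by rw [hL, hL, hj, ← hw, playL_append _ w]) _
        (List.mem_map_of_mem hx)
      rwa [hmL] at this

/-- For `PGame.hom`, a pebbled pair is represented by the initial segment that ends with the move
placing its pebble. The pebble is not moved afterwards, so these segments form an active tuple. -/
theorem exists_PGame {A B : Struct.{u} τ} {r : PSeq k A.carrier → PSeq k B.carrier → Prop}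
    (h : (PForestCat τ k).GameRel ((PComonad τ k).cofree.obj A)
      ((PComonad τ k).cofree.obj B) r) :
    PGame k A B fun l => l = [] ∨ ∃ s t, r s t ∧ s.val = playL l ∧ t.val = playR l := by
  have init : ∀ {l : List (Fin k × A.carrier × B.carrier)} {m}, (l ++ [m] = [] ∨ ∃ s t, r s t ∧
      s.val = playL (l ++ [m]) ∧ t.val = playR (l ++ [m])) →
      (l = [] ∨ ∃ s t, r s t ∧ s.val = playL l ∧ t.val = playR l) := by
    rintro l m (hl | ⟨s, t, hr, hs, ht⟩)
    · simp at hl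
    by_cases hl : l = []
    · exact .inl hl
    refine .inr ⟨⟨playL l, by simpa [playL] using hl⟩, ⟨playR l, by simpa [playR] using hl⟩,
      h.par hr ?_ ?_, rfl, rfl⟩
    · exact (Pcofree_par _ _).2 ⟨_, hs.trans (playL_append _ _)⟩
    · exact (Pcofree_par _ _).2 ⟨_, ht.trans (playR_append _ _)⟩
  have pre : ∀ {l l' : List (Fin k × A.carrier × B.carrier)}, (l ++ l' = [] ∨ ∃ s t, r s t ∧
      s.val = playL (l ++ l') ∧ t.val = playR (l ++ l')) →
      (l = [] ∨ ∃ s t, r s t ∧ s.val = playL l ∧ t.val = playR l) := by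
    intro l l' hl
    induction l' using List.reverseRecOn with
    | nil => rwa [List.append_nil] at hl
    | append_singleton l' m ih =>
      rw [← List.append_assoc] at hl
      exact ih (init hl)
  have hlab : ∀ {s : PSeq k A.carrier} {t : PSeq k B.carrier}, r s t →
      s.lastMove.1 = t.lastMove.1 := fun {s t} hr =>
    (Pcofree_lab s).symm.trans ((h.lab hr).trans (Pcofree_lab t))
  refine ⟨.inl rfl, init, ?_, ?_, ?_⟩
  · rintro l (rfl | ⟨s, t, hr, hs, ht⟩) p a
    · obtain ⟨t, ht, hr⟩ := h.root_forth (x := (⟨[(p, a)], by simp⟩ : PSeq k A.carrier))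
        (Pcofree_ht _)
      obtain ⟨b, hb⟩ := Pcofree_root ht
      rw [← hlab hr] at hb
      exact ⟨b, .inr ⟨_, t, hr, rfl, hb⟩⟩
    · obtain ⟨t', ht', hr'⟩ := h.forth
        (x' := (⟨s.val ++ [(p, a)], by simp⟩ : PSeq k A.carrier)) hr
        ((Pcofree_par _ _).2 ⟨_, rfl⟩)
      obtain ⟨⟨p', b⟩, hb⟩ := (Pcofree_par _ _).1 ht'
      -- The relation respects labels, so Duplicator answers with Spoiler's pebble.
      have e := hlab hr'
      rw [PSeq.lastMove_of_eq rfl, PSeq.lastMove_of_eq hb] at e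
      change p = p' at e
      subst e
      exact ⟨b, .inr ⟨_, t', hr', by rw [playL_append, ← hs]; rfl, by
        rw [playR_append, ← ht]; exact hb⟩⟩
  · rintro l (rfl | ⟨s, t, hr, hs, ht⟩) p b
    · obtain ⟨s, hs, hr⟩ := h.root_back (y := (⟨[(p, b)], by simp⟩ : PSeq k B.carrier))
        (Pcofree_ht _)
      obtain ⟨a, ha⟩ := Pcofree_root hs
      rw [hlab hr] at ha
      exact ⟨a, .inr ⟨s, _, hr, ha, rfl⟩⟩
    · obtain ⟨s', hs', hr'⟩ := h.back
        (y' := (⟨t.val ++ [(p, b)], by simp⟩ : PSeq k B.carrier)) hr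
        ((Pcofree_par _ _).2 ⟨_, rfl⟩)
      obtain ⟨⟨p', a⟩, ha⟩ := (Pcofree_par _ _).1 hs'
      have e := hlab hr'
      rw [PSeq.lastMove_of_eq rfl, PSeq.lastMove_of_eq ha] at e
      change p' = p at e
      subst e
      exact ⟨a, .inr ⟨s', _, hr', by rw [playL_append, ← hs]; exact ha, by
        rw [playR_append, ← ht]; rfl⟩⟩
  · intro l hl n R m hm hR
    choose p l₁ l₂ hl' hp using hm
    have hst : ∀ i, ∃ s t, r s t ∧ s.val = playL (l₁ i ++ [(p i, m i)]) ∧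
        t.val = playR (l₁ i ++ [(p i, m i)]) := fun i =>
      (pre (hl' i ▸ hl)).resolve_left (by simp)
    choose s t hr hs ht using hst
    have hpre : ∀ i, l₁ i ++ [(p i, m i)] <+: l := fun i => ⟨_, (hl' i).symm⟩
    have hmL : ∀ i, (s i).lastMove = (p i, (m i).1) := fun i =>
      PSeq.lastMove_of_eq ((hs i).trans (playL_append _ _))
    have hls : ∀ i, (s i).last = (m i).1 := fun i => congrArg Prod.snd (hmL i)
    have hlt : ∀ i, (t i).last = (m i).2 := fun i =>
      congrArg Prod.snd (PSeq.lastMove_of_eq ((ht i).trans (playR_append _ _)))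
    have key := h.rel (R := R) (t := s) (t' := t) (fun hn => by
      obtain ⟨j, hj⟩ := exists_prefix_max hn hpre
      refine ⟨j, hr j, fun i => ⟨(Pcofree_le _ _).2 ?_, (Pcofree_le _ _).2 ?_, h.ht (hr i)⟩⟩
      · rw [hs, hs]; exact playL_prefix (hj i)
      · rw [ht, ht]; exact playR_prefix (hj i)) ⟨fun i j => by
        rw [hs, hs]
        exact (List.prefix_or_prefix_of_prefix (hpre i) (hpre j)).imp playL_prefix playL_prefix,
        fun i j w hw x hx => by
          rw [hmL]
          have hpj : (s j).val <+: playL l := hs j ▸ playL_prefix (hpre j)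
          obtain ⟨w', hw'⟩ := hpj
          rw [← hw, hs, hl' i, playL_append _ (l₂ i), List.append_assoc,
            List.append_cancel_left_eq] at hw'
          have hx' : x ∈ playL (l₂ i) := hw' ▸ List.mem_append_left _ hx
          obtain ⟨x', hx'', rfl⟩ := List.mem_map.1 hx'
          exact hp i x' hx'',
        by simpa only [hls] using hR⟩
    have key : RelMap R fun i => (t i).last := key.2.2
    simpa only [hlt] using key

theorem PPosBisim_cofree_iff {A B : Struct.{u} τ} :
    PPosBisim ((PComonad τ k).cofree.obj A) ((PComonad τ k).cofree.obj B) ↔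
      ∃ Q, PGame k A B Q := by
  rw [PPosBisim_iff]
  exact ⟨fun ⟨_, h⟩ => ⟨_, exists_PGame h⟩, fun ⟨_, h⟩ => ⟨_, h.gameRel⟩⟩

end P

/-! ### Infinitary logic with finitely many variables -/

section L

variable {σ : FirstOrder.Language.{0, 0}} {k : ℕ}

/-- A pair of assignments of the same variables. -/
structure Pos (A B : Type u) where
  V : Set ℕ
  v : V → A
  w : V → B

namespace Pos

/-- Reassign a variable on both sides. -/
def push {A B : Type u} (P : Pos A B) (x : ℕ) (a : A) (b : B) : Pos A B :=
  ⟨insert x P.V, extendVal P.v x a, extendVal P.w x b⟩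

/-- The empty assignments. -/
def empty (A B : Type u) : Pos A B :=
  ⟨∅, fun x => (Set.notMem_empty _ x.2).elim, fun x => (Set.notMem_empty _ x.2).elim⟩

/-- The assignments after a play of the pebble game. -/
def ofPlay {A B : Type u} (l : List (Fin k × A × B)) : Pos A B :=
  l.foldl (fun P m => P.push m.1 m.2.1 m.2.2) (empty A B)

theorem ofPlay_append {A B : Type u} (l : List (Fin k × A × B)) (p : Fin k) (a : A) (b : B) :
    ofPlay (l ++ [(p, a, b)]) = (ofPlay l).push p a b := by
  simp [ofPlay]

/-- The variable `x` is assigned the pair `m`. -/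
def Assigns {A B : Type u} (P : Pos A B) (x : ℕ) (m : A × B) : Prop :=
  ∃ h : x ∈ P.V, P.v ⟨x, h⟩ = m.1 ∧ P.w ⟨x, h⟩ = m.2

theorem assigns_push {A B : Type u} (P : Pos A B) (x : ℕ) (a : A) (b : B) :
    (P.push x a b).Assigns x (a, b) :=
  ⟨Set.mem_insert _ _, by simp [push, extendVal], by simp [push, extendVal]⟩

theorem Assigns.push {A B : Type u} {P : Pos A B} {x y : ℕ} {m : A × B} (h : P.Assigns y m)
    (hy : y ≠ x) (a : A) (b : B) : (P.push x a b).Assigns y m := by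
  obtain ⟨hy', h₁, h₂⟩ := h
  exact ⟨Set.mem_insert_of_mem _ hy', by simpa [Pos.push, extendVal, hy] using h₁,
    by simpa [Pos.push, extendVal, hy] using h₂⟩

/-- The pebble `p` acts as the variable of index `p`, and its last value survives the moves of other
pebbles. -/
theorem assigns_ofPlay {A B : Type u} (l₁ l₂ : List (Fin k × A × B)) {p : Fin k} {m : A × B}
    (h : ∀ m' ∈ l₂, m'.1 ≠ p) : (ofPlay ((l₁ ++ [(p, m)]) ++ l₂)).Assigns p m := by
  induction l₂ using List.reverseRecOn with
  | nil =>
    rw [List.append_nil, ofPlay_append]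
    exact assigns_push _ _ _ _
  | append_singleton l₂ m' ih =>
    obtain ⟨p', a, b⟩ := m'
    rw [← List.append_assoc, ofPlay_append]
    refine (ih fun m' hm' => h m' (List.mem_append_left _ hm')).push (fun e => ?_) a b
    exact h (p', a, b) (by simp) (Fin.ext e.symm)

/-- All positive formulas in `k` variables are preserved from left to right. -/
def Preserved {A B : Struct.{u} σ} (k : ℕ) (P : Pos A.carrier B.carrier) : Prop :=
  ∀ φ : Formula.{u} σ P.V, φ.NegFree → φ.vars ⊆ Set.Iio k → φ.Realize P.v → φ.Realize P.w

/-- If every `b` failed, choose for each a formula true of `a` and false of `b`. The existential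
quantification of their conjunction, indexed by `B`, is preserved, and its witness in `B` satisfies
the formula chosen against itself. -/
theorem Preserved.forth {A B : Struct.{u} σ} {P : Pos A.carrier B.carrier}
    (h : P.Preserved (σ := σ) k) {x : ℕ} (hx : x < k) (a : A.carrier) :
    ∃ b, (P.push x a b).Preserved (σ := σ) k := by
  by_contra hcon
  have hcon : ∀ b : B.carrier, ∃ φ : Formula.{u} σ (insert x P.V), φ.NegFree ∧
      φ.vars ⊆ Set.Iio k ∧ φ.Realize (extendVal P.v x a) ∧ ¬ φ.Realize (extendVal P.w x b) := by
    intro b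
    by_contra hb
    refine hcon ⟨b, fun φ h₁ h₂ h₃ => ?_⟩
    by_contra h₄
    exact hb ⟨φ, h₁, h₂, h₃, h₄⟩
  choose φ h₁ h₂ h₃ h₄ using hcon
  obtain ⟨b, hb⟩ := h (.ex x (.conj B.carrier φ)) h₁
    (Set.insert_subset hx (Set.iUnion_subset h₂)) ⟨a, h₃⟩
  exact h₄ b (hb b)

/-- Dual to `Preserved.forth`: for each `a` choose a formula true of `a` and false of `b`, and
quantify universally over their disjunction, indexed by `A`. -/
theorem Preserved.back {A B : Struct.{u} σ} {P : Pos A.carrier B.carrier}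
    (h : P.Preserved (σ := σ) k) {x : ℕ} (hx : x < k) (b : B.carrier) :
    ∃ a, (P.push x a b).Preserved (σ := σ) k := by
  by_contra hcon
  have hcon : ∀ a : A.carrier, ∃ φ : Formula.{u} σ (insert x P.V), φ.NegFree ∧
      φ.vars ⊆ Set.Iio k ∧ φ.Realize (extendVal P.v x a) ∧ ¬ φ.Realize (extendVal P.w x b) := by
    intro a
    by_contra ha
    refine hcon ⟨a, fun φ h₁ h₂ h₃ => ?_⟩
    by_contra h₄
    exact ha ⟨φ, h₁, h₂, h₃, h₄⟩
  choose φ h₁ h₂ h₃ h₄ using hcon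
  obtain ⟨a, ha⟩ := h (.all x (.disj A.carrier φ)) h₁
    (Set.insert_subset hx (Set.iUnion_subset h₂)) (fun a => ⟨a, h₃ a⟩) b
  exact h₄ a ha

theorem Preserved.hom [σ.IsRelational] {A B : Struct.{u} σ} {P : Pos A.carrier B.carrier}
    (h : P.Preserved (σ := σ) k) {S : Set (A.carrier × B.carrier)}
    (hS : ∀ m ∈ S, ∃ x < k, P.Assigns x m) : PHom (J A) (J B) S := by
  refine PHom_J_iff.2 ⟨fun n R m hm hR => ?_, fun m hm m' hm' e => ?_⟩
  · have hx := fun i => hS _ (hm i)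
    choose x hx hxV hv hw using hx
    have := h (.rel R fun i => ⟨x i, hxV i⟩) trivial (Set.range_subset_iff.2 hx) (by
      change RelMap R fun i => P.v ⟨x i, hxV i⟩
      simpa only [hv] using hR)
    change RelMap R fun i => P.w ⟨x i, hxV i⟩ at this
    simpa only [hw] using this
  · obtain ⟨x, hx, hxV, hv, hw⟩ := hS _ hm
    obtain ⟨y, hy, hyV, hv', hw'⟩ := hS _ hm'
    have : P.w ⟨x, hxV⟩ = P.w ⟨y, hyV⟩ := h (.eq ⟨x, hxV⟩ ⟨y, hyV⟩) trivial
      (Set.insert_subset hx (Set.singleton_subset_iff.2 hy)) (by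
        change P.v ⟨x, hxV⟩ = P.v ⟨y, hyV⟩
        rw [hv, hv', e])
    rw [← hw, ← hw', this]

end Pos

variable [σ.IsRelational]

/-- Duplicator keeps all positive formulas in `k` variables preserved, at every prefix of the play
so that closure under initial segments is immediate. -/
theorem PGame.of_preserved {A B : Struct.{u} σ}
    (h : (Pos.empty A.carrier B.carrier).Preserved (σ := σ) k) :
    PGame k (J A) (J B) fun l : List (Fin k × A.carrier × B.carrier) =>
      ∀ l', l' <+: l → (Pos.ofPlay l').Preserved (σ := σ) k := by
  refine ⟨fun l' hl' => ?_, fun {l m} hl l' hl' => hl l' (hl'.trans (List.prefix_append _ _)),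
    fun {l} hl p a => ?_, fun {l} hl p b => ?_, fun {l} hl => ?_⟩
  · rw [List.prefix_nil.1 hl']
    exact h
  · obtain ⟨b, hb⟩ := (hl l List.prefix_rfl).forth p.2 a
    refine ⟨b, fun l' hl' => ?_⟩
    rcases List.prefix_concat_iff.1 hl' with rfl | hl'
    · exact (Pos.ofPlay_append l p a b).symm ▸ hb
    · exact hl l' hl'
  · obtain ⟨a, ha⟩ := (hl l List.prefix_rfl).back p.2 b
    refine ⟨a, fun l' hl' => ?_⟩
    rcases List.prefix_concat_iff.1 hl' with rfl | hl'
    · exact (Pos.ofPlay_append l p a b).symm ▸ ha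
    · exact hl l' hl'
  · refine (hl l List.prefix_rfl).hom ?_
    rintro m ⟨p, l₁, l₂, rfl, hp⟩
    exact ⟨p, p.2, Pos.assigns_ofPlay l₁ l₂ hp⟩

theorem liesOn_extendVal {A B : Type u} {V : Set ℕ} {v : V → A} {w : V → B}
    {l : List (Fin k × A × B)} (h : ∀ x : V, ∃ p : Fin k, (p : ℕ) = x ∧ LiesOn l p (v x, w x))
    (p : Fin k) (a : A) (b : B) (x : ↥(insert (p : ℕ) V)) :
    ∃ q : Fin k, (q : ℕ) = x ∧
      LiesOn (l ++ [(p, a, b)]) q (extendVal v p a x, extendVal w p b x) := by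
  by_cases hx : (x : ℕ) = p
  · exact ⟨p, hx.symm, by simpa [extendVal, hx] using liesOn_append l p (a, b)⟩
  · obtain ⟨q, hq, h⟩ := h ⟨x, (Set.mem_insert_iff.1 x.2).resolve_left hx⟩
    refine ⟨q, hq, ?_⟩
    simpa [extendVal, hx] using h.append (fun e => hx (hq.symm.trans (congrArg Fin.val e))) (a, b)

/-- A quantifier over `x` is a move of the pebble `x`. Rebinding `x` removes its old pair from the
position, so the invariant says which pebble carries which value; mere membership in a set of pairs
would not be stable. -/
theorem PGame.realize {A B : Struct.{u} σ} {Q : List (Fin k × A.carrier × B.carrier) → Prop}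
    (hQ : PGame k (J A) (J B) Q) {V : Set ℕ} {φ : Formula.{u} σ V} (hφ : φ.NegFree)
    (hk : φ.vars ⊆ Set.Iio k) {l} (hl : Q l) {v : V → A.carrier} {w : V → B.carrier}
    (h : ∀ x : V, ∃ p : Fin k, (p : ℕ) = x ∧ LiesOn l p (v x, w x))
    (hv : φ.Realize v) : φ.Realize w := by
  have hmem : ∀ x, (v x, w x) ∈ pebbled l := fun x => let ⟨p, _, h⟩ := h x; ⟨p, h⟩
  induction φ generalizing l with
  | eq x y => exact (PHom_J_iff.1 (hQ.hom hl)).2 _ (hmem x) _ (hmem y) hv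
  | rel R x =>
    exact (PHom_J_iff.1 (hQ.hom hl)).1 _ R (fun i => (v (x i), w (x i))) (fun i => hmem _) hv
  | neg => exact hφ.elim
  | conj ι φ ih =>
    exact fun i => ih i (hφ i) ((Set.subset_iUnion _ i).trans hk) hl h (hv i) hmem
  | disj ι φ ih =>
    obtain ⟨i, hi⟩ := hv
    exact ⟨i, ih i (hφ i) ((Set.subset_iUnion (fun i => (φ i).vars) i).trans hk) hl h hi hmem⟩
  | ex x φ ih =>
    obtain ⟨a, ha⟩ := hv
    have hx : x < k := hk (Set.mem_insert _ _)
    obtain ⟨b, hb⟩ := hQ.forth hl ⟨x, hx⟩ a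
    have h' := liesOn_extendVal h ⟨x, hx⟩ a b
    exact ⟨b, ih hφ ((Set.subset_insert _ _).trans hk) hb h' ha fun y =>
      let ⟨p, _, h⟩ := h' y; ⟨p, h⟩⟩
  | all x φ ih =>
    intro b
    have hx : x < k := hk (Set.mem_insert _ _)
    obtain ⟨a, ha⟩ := hQ.back hl ⟨x, hx⟩ b
    have h' := liesOn_extendVal h ⟨x, hx⟩ a b
    exact ih hφ ((Set.subset_insert _ _).trans hk) ha h' (hv a) fun y =>
      let ⟨p, _, h⟩ := h' y; ⟨p, h⟩

theorem preserves_LL_iff (k : ℕ) (A B : Struct.{u} σ) :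
    Preserves (positive (LLk.{u} σ k)) A B ↔ ∃ Q, PGame k (J A) (J B) Q :=
  ⟨fun h => ⟨_, PGame.of_preserved fun φ h₁ h₂ => h φ ⟨h₂, h₁⟩⟩,
    fun ⟨_, hQ⟩ _ hφ => hQ.realize hφ.2 hφ.1 hQ.nil fun x => (Set.notMem_empty _ x.2).elim⟩

end L

/-! ### The modal game -/

section MGame

variable {σ : FirstOrder.Language.{0, 0}}

/-- Duplicator wins the positive `j`-round simulation game from the given positions. -/
def MWin (A B : Struct.{u} σ) : ℕ → A.carrier → B.carrier → Prop
  | 0, a, b => ∀ P : σ.Relations 1, RelMap P ![a] → RelMap P ![b]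
  | j + 1, a, b => (∀ P : σ.Relations 1, RelMap P ![a] → RelMap P ![b]) ∧
      ∀ R : σ.Relations 2, (∀ a', RelMap R ![a, a'] → ∃ b', RelMap R ![b, b'] ∧ MWin A B j a' b') ∧
        ∀ b', RelMap R ![b, b'] → ∃ a', RelMap R ![a, a'] ∧ MWin A B j a' b'

theorem MWin.unary {A B : Struct.{u} σ} {j : ℕ} {a : A.carrier} {b : B.carrier}
    (h : MWin A B j a b) (P : σ.Relations 1) : RelMap P ![a] → RelMap P ![b] := by
  cases j with
  | zero => exact h P
  | succ j => exact h.1 P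

theorem MWin.holds {A B : Struct.{u} σ} {φ : ModalFormula σ} (hφ : φ.NegFree) {j : ℕ}
    (hj : φ.depth ≤ j) {a : A.carrier} {b : B.carrier} (h : MWin A B j a b) (ha : φ.Holds a) :
    φ.Holds b := by
  induction φ generalizing j a b with
  | var P => exact h.unary P ha
  | top => trivial
  | bot => exact ha
  | neg => exact hφ.elim
  | and φ ψ ih ih' =>
    exact ⟨ih hφ.1 ((le_max_left _ _).trans hj) h ha.1,
      ih' hφ.2 ((le_max_right _ _).trans hj) h ha.2⟩
  | or φ ψ ih ih' =>
    exact ha.imp (ih hφ.1 ((le_max_left _ _).trans hj) h)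
      (ih' hφ.2 ((le_max_right _ _).trans hj) h)
  | dia R φ ih =>
    change φ.depth + 1 ≤ j at hj
    obtain ⟨j, rfl⟩ : ∃ i, j = i + 1 := ⟨j - 1, by omega⟩
    obtain ⟨a', ha', h₁⟩ := ha
    obtain ⟨b', hb', h₂⟩ := (h.2 R).1 a' ha'
    exact ⟨b', hb', ih hφ (by omega) h₂ h₁⟩
  | box R φ ih =>
    change φ.depth + 1 ≤ j at hj
    obtain ⟨j, rfl⟩ : ∃ i, j = i + 1 := ⟨j - 1, by omega⟩
    intro b' hb'
    obtain ⟨a', ha', h₂⟩ := (h.2 R).2 b' hb'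
    exact ih hφ (by omega) h₂ (ha a' ha')

/-- Positive modal formulas of bounded depth. -/
def IsPosML (φ : ModalFormula σ) (j : ℕ) : Prop := φ.NegFree ∧ φ.depth ≤ j

/-- Modal formulas only have binary connectives, so finite conjunctions are assembled by induction
on the set. -/
theorem exists_modal_conj {ι : Type} {Φ : ι → ModalFormula σ} {j : ℕ} (hΦ : ∀ i, IsPosML (Φ i) j)
    {s : Set ι} (hs : s.Finite) : ∃ φ : ModalFormula σ, IsPosML φ j ∧
      ∀ (A : Struct.{u} σ) (a : A.carrier), φ.Holds a ↔ ∀ i ∈ s, (Φ i).Holds a := by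
  induction s, hs using Set.Finite.induction_on with
  | empty => exact ⟨.top, ⟨trivial, Nat.zero_le _⟩, fun A a => by simp [ModalFormula.Holds]⟩
  | @insert i s _ _ ih =>
    obtain ⟨φ, h, h'⟩ := ih
    exact ⟨.and (Φ i) φ, ⟨⟨(hΦ i).1, h.1⟩, max_le (hΦ i).2 h.2⟩,
      fun A a => by simp [ModalFormula.Holds, h']⟩

theorem exists_modal_disj {ι : Type} {Φ : ι → ModalFormula σ} {j : ℕ} (hΦ : ∀ i, IsPosML (Φ i) j)
    {s : Set ι} (hs : s.Finite) : ∃ φ : ModalFormula σ, IsPosML φ j ∧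
      ∀ (A : Struct.{u} σ) (a : A.carrier), φ.Holds a ↔ ∃ i ∈ s, (Φ i).Holds a := by
  induction s, hs using Set.Finite.induction_on with
  | empty => exact ⟨.bot, ⟨trivial, Nat.zero_le _⟩, fun A a => by simp [ModalFormula.Holds]⟩
  | @insert i s _ _ ih =>
    obtain ⟨φ, h, h'⟩ := ih
    exact ⟨.or (Φ i) φ, ⟨⟨(hΦ i).1, h.1⟩, max_le (hΦ i).2 h.2⟩,
      fun A a => by simp [ModalFormula.Holds, h']⟩

/-- The modal form of `exists_family`. A move to `a'` is answered by means of a diamond over the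
conjunction of what holds at `a'`, and a move to `b'` by means of a box over the disjunction of what
fails at `b'`. -/
theorem exists_modal_family [Finite (σ.Relations 1)] [Finite (σ.Relations 2)] (j : ℕ) :
    ∃ (ι : Type) (_ : Finite ι) (Φ : ι → ModalFormula σ), (∀ i, IsPosML (Φ i) j) ∧
      ∀ (A B : Struct.{u} σ) (a : A.carrier) (b : B.carrier),
        (∀ i, (Φ i).Holds a → (Φ i).Holds b) → MWin A B j a b := by
  induction j with
  | zero =>
    exact ⟨σ.Relations 1, inferInstance, .var, fun P => ⟨trivial, le_rfl⟩, fun A B a b h => h⟩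
  | succ j ih =>
    obtain ⟨ι, _, Φ, hΦ, h⟩ := ih
    choose C hC hC' using fun s : Set ι => exists_modal_conj.{u} hΦ s.toFinite
    choose D hD hD' using fun s : Set ι => exists_modal_disj.{u} hΦ s.toFinite
    refine ⟨σ.Relations 1 ⊕ (σ.Relations 2 × Set ι) ⊕ (σ.Relations 2 × Set ι), inferInstance,
      Sum.elim .var (Sum.elim (fun p => .dia p.1 (C p.2)) fun p => .box p.1 (D p.2)), ?_,
      fun A B a b hab => ⟨fun P => hab (.inl P), fun R => ⟨fun a' ha' => ?_, fun b' hb' => ?_⟩⟩⟩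
    · rintro (P | p | p)
      · exact ⟨trivial, Nat.zero_le _⟩
      · exact ⟨(hC p.2).1, Nat.succ_le_succ (hC p.2).2⟩
      · exact ⟨(hD p.2).1, Nat.succ_le_succ (hD p.2).2⟩
    · obtain ⟨b', hb', hb⟩ := hab (.inr (.inl (R, {i | (Φ i).Holds a'})))
        ⟨a', ha', (hC' _ A a').2 fun i hi => hi⟩
      exact ⟨b', hb', h A B a' b' ((hC' _ B b').1 hb)⟩
    · by_contra hcon
      push Not at hcon
      obtain ⟨i, hi, hi'⟩ := (hD' _ B b').1 (hab (.inr (.inr (R, {i | ¬ (Φ i).Holds b'})))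
        (fun a' ha' => (hD' _ A a').2 (by
          by_contra h'
          refine hcon a' ha' (h A B a' b' fun i hi => ?_)
          by_contra hi'
          exact h' ⟨i, hi', hi⟩)) b' hb')
      exact hi hi'

theorem preserves_ML_iff [Finite (Σ n, σ.Relations n)] (k : ℕ) (A B : PtStruct.{u} σ) :
    PreservesModal (positiveModal (MLk σ k)) A B ↔ MWin A.toStruct B.toStruct k A.pt B.pt := by
  have hfin : ∀ n, Finite (σ.Relations n) := fun n =>
    Finite.of_injective (fun R => (⟨n, R⟩ : Σ n, σ.Relations n)) sigma_mk_injective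
  constructor
  · intro h
    obtain ⟨ι, _, Φ, hΦ, hw⟩ := exists_modal_family.{u} (σ := σ) k
    exact hw _ _ _ _ fun i => h (Φ i) ⟨(hΦ i).2, (hΦ i).1⟩
  · exact fun h φ hφ => h.holds hφ.2 hφ.1

end MGame

/-! ### The modal game on co-free coalgebras -/

section M

variable {σ : FirstOrder.Language.{0, 0}} {k : ℕ}

/-- The list of prefixes is the value at `s` of the co-free structure map. That `s` can be recovered
from it identifies the tree order with the prefix order. -/
theorem MPath.map_pre {A : PtStruct.{u} σ} (s : MPath k A) :
    (List.ofFn fun j : Fin s.val.length => (s.val[j].1, s.pre (j + 1))).map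
      (Prod.map id MPath.last) = s.val := by
  refine List.ext_getElem (by simp) fun j h₁ h₂ => ?_
  rw [List.getElem_map, List.getElem_ofFn]
  exact Prod.ext rfl (congrArg Prod.snd (Prod.ext rfl (MPath.last_pre s h₂) :
    (s.val[j].1, (s.pre (j + 1)).last) = s.val[j]))

theorem MPath.pre_prefix {A : PtStruct.{u} σ} {s t : MPath k A} (h : s.val <+: t.val) :
    (List.ofFn fun j : Fin s.val.length => (s.val[j].1, s.pre (j + 1))) <+:
      List.ofFn fun j : Fin t.val.length => (t.val[j].1, t.pre (j + 1)) := by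
  refine List.prefix_iff_getElem.2 ⟨by simpa using h.length_le, fun j hj => ?_⟩
  have hj : j < s.val.length := by simpa using hj
  rw [List.getElem_ofFn, List.getElem_ofFn]
  have h₁ : s.pre (j + 1) = t.pre (j + 1) := MPath.ext (take_eq_of_prefix h hj)
  have h₂ : s.val[j] = t.val[j]'(hj.trans_le h.length_le) := h.getElem hj
  simp [h₁, h₂]

/-- The path that extends a given path by one step. -/
def MPath.snoc {A : PtStruct.{u} σ} (s : MPath k A) (hs : s.val.length < k) (R : σ.Relations 2)
    (b : A.toStruct.carrier) (hR : RelMap R ![s.last, b]) : MPath k A where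
  val := s.val ++ [(R, b)]
  length_le := by rw [List.length_append]; exact hs
  rel j hj := by
    by_cases h : j < s.val.length
    · rw [List.take_append_of_le_length h.le]
      simpa only [List.getElem_append_left h] using s.rel j h
    · rw [List.length_append, List.length_singleton] at hj
      obtain rfl : j = s.val.length := by omega
      simpa [MPath.last] using hR

theorem MPath.step_snoc {A : PtStruct.{u} σ} (s : MPath k A) (hs : s.val.length < k)
    (R : σ.Relations 2) (b : A.toStruct.carrier) (hR : RelMap R ![s.last, b]) :
    Step R s (s.snoc hs R b hR) := ⟨b, rfl⟩

theorem MPath.last_snoc {A : PtStruct.{u} σ} (s : MPath k A) (hs : s.val.length < k)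
    (R : σ.Relations 2) (b : A.toStruct.carrier) (hR : RelMap R ![s.last, b]) :
    (s.snoc hs R b hR).last = b := by
  simp [snoc, last, endPt]

theorem MPath.Step.length {A : PtStruct.{u} σ} {R : σ.Relations 2} {s t : MPath k A}
    (h : Step R s t) : t.val.length = s.val.length + 1 := by
  obtain ⟨b, hb⟩ := h
  simp [hb]

theorem MPath.Step.unique {A : PtStruct.{u} σ} {R R' : σ.Relations 2} {s s' t : MPath k A}
    (h : Step R s t) (h' : Step R' s' t) : s = s' := by
  obtain ⟨b, hb⟩ := h
  obtain ⟨b', hb'⟩ := h'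
  exact MPath.ext (List.append_inj' (hb.symm.trans hb') rfl).1

/-- The pairs of paths that arise when Duplicator plays by a winning strategy. -/
inductive MPlay (k : ℕ) (A B : PtStruct.{u} σ) : MPath k A → MPath k B → Prop
  | nil : MPlay k A B MPath.nil MPath.nil
  | step {R : σ.Relations 2} {s s' : MPath k A} {t t' : MPath k B} : MPlay k A B s t →
      MPath.Step R s s' → MPath.Step R t t' →
      MWin A.toStruct B.toStruct (k - s'.val.length) s'.last t'.last → MPlay k A B s' t'

theorem MPlay.length {A B : PtStruct.{u} σ} {s : MPath k A} {t : MPath k B}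
    (h : MPlay k A B s t) : s.val.length = t.val.length := by
  induction h with
  | nil => rfl
  | step _ hs ht _ ih => rw [hs.length, ht.length, ih]

theorem MPlay.win {A B : PtStruct.{u} σ} (h₀ : MWin A.toStruct B.toStruct k A.pt B.pt)
    {s : MPath k A} {t : MPath k B} (h : MPlay k A B s t) :
    MWin A.toStruct B.toStruct (k - s.val.length) s.last t.last := by
  cases h with
  | nil => exact h₀
  | step _ _ _ h => exact h

theorem rootedBranch_getLast {X : Type u} (r : X) (l : List (σ.Relations 2 × X)) (R : σ.Relations 2)
    (x : X) (h) : ((rootedBranch r (l ++ [(R, x)])).getLast h).1 = some R := by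
  simp [rootedBranch]

variable [σ.IsRelational]

theorem Mcofree_le {A : PtStruct.{u} σ} (s t : MPath k A) :
    ((MForestCat σ k).forest ((MComonad σ k).cofree.obj A)).le s t ↔ s.val <+: t.val := by
  refine (MLe_iff ((MComonad σ k).cofree.obj A) s t).symm.trans ⟨fun h => ?_, fun h => ?_⟩
  · have h' := h.map (Prod.map id MPath.last)
    exact (MPath.map_pre s) ▸ (MPath.map_pre t) ▸ h'
  · exact MPath.pre_prefix h

theorem Mcofree_ht {A : PtStruct.{u} σ} (s : MPath k A) :
    ((MForestCat σ k).forest ((MComonad σ k).cofree.obj A)).ht s = s.val.length :=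
  (MBranch_ht ((MComonad σ k).cofree.obj A) s).trans (MPath.length_mapList _ s)

theorem Mcofree_par {A : PtStruct.{u} σ} (s t : MPath k A) :
    ((MForestCat σ k).forest ((MComonad σ k).cofree.obj A)).par s t ↔
      ∃ R, MPath.Step R s t := by
  constructor
  · intro h
    obtain ⟨w, hw⟩ := (Mcofree_le s t).1 (Forest.le_of_par h)
    have h' := Forest.ht_of_par _ h
    rw [Mcofree_ht, Mcofree_ht, ← hw, List.length_append] at h'
    obtain ⟨⟨R, a⟩, rfl⟩ := List.length_eq_one_iff.1 (by omega : w.length = 1)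
    exact ⟨R, a, hw.symm⟩
  · rintro ⟨R, h⟩
    refine Forest.par_of_comparable (.inl ((Mcofree_le s t).2 ?_)) ?_
    · obtain ⟨a, ha⟩ := h
      exact ⟨_, ha.symm⟩
    · rw [Mcofree_ht, Mcofree_ht, h.length]

theorem Mcofree_lab {A : PtStruct.{u} σ} {R : σ.Relations 2} {s t : MPath k A}
    (h : MPath.Step R s t) :
    ((MForestCat σ k).forest ((MComonad σ k).cofree.obj A)).lab t = some R := by
  have h₁ := MPath.map_pre t
  obtain ⟨b, hb⟩ := h
  conv_rhs at h₁ => rw [hb]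
  obtain ⟨l, l', hl, -, hl'⟩ := List.map_eq_append_iff.1 h₁
  obtain ⟨⟨R', x⟩, l'', rfl, h₂, h₃⟩ := List.map_eq_cons_iff.1 hl'
  rw [List.map_eq_nil_iff] at h₃
  subst h₃
  simp only [Prod.map_apply, id, Prod.mk.injEq] at h₂
  obtain ⟨rfl, -⟩ := h₂
  have key : ∀ (l₀ : List (σ.Relations 2 × MPath k A)) (h₀), l₀ = l ++ [(R', x)] →
      ((rootedBranch (MPath.nil : MPath k A) l₀).getLast h₀).1 = some R' := by
    rintro _ h₀ rfl
    exact rootedBranch_getLast _ _ _ _ _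
  exact key _ _ hl

/-- Winning positions give the moves and the unary symbols. A binary symbol holds only of a path and
its extension by one step with that label, and related paths have equal last labels. -/
theorem MPlay.gameRel {A B : PtStruct.{u} σ} (h₀ : MWin A.toStruct B.toStruct k A.pt B.pt) :
    (MForestCat σ k).GameRel ((MComonad σ k).cofree.obj A) ((MComonad σ k).cofree.obj B)
      (MPlay k A B) := by
  have hlab : ∀ {s : MPath k A} {t : MPath k B}, MPlay k A B s t →
      ((MForestCat σ k).forest ((MComonad σ k).cofree.obj A)).lab s =
        ((MForestCat σ k).forest ((MComonad σ k).cofree.obj B)).lab t := by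
    rintro s t h
    cases h with
    | nil => rfl
    | step _ hs ht _ => exact (Mcofree_lab hs).trans (Mcofree_lab ht).symm
  have hpar : ∀ {s s' : MPath k A} {t t' : MPath k B} {R R' : σ.Relations 2}, MPlay k A B s t →
      MPath.Step R s' s → MPath.Step R' t' t → MPlay k A B s' t' := by
    intro s s' t t' R R' h hs ht
    cases h with
    | nil =>
      obtain ⟨a, ha⟩ := hs
      simp [MPath.nil] at ha
    | step h hs' ht' _ =>
      rw [hs.unique hs', ht.unique ht']
      exact h
  have hroot : ∀ {A : PtStruct.{u} σ} {s : MPath k A},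
      ((MForestCat σ k).forest ((MComonad σ k).cofree.obj A)).ht s = 0 → s = MPath.nil := by
    intro A s hs
    exact MPath.ext (List.length_eq_zero_iff.1 ((Mcofree_ht s).symm.trans hs))
  refine ⟨hlab, ?_, ?_, ?_, ?_, ?_, ?_, ?_⟩
  · intro (s : MPath k A) (t : MPath k B) h
    exact (Mcofree_ht s).trans (h.length.trans (Mcofree_ht t).symm)
  · intro (s : MPath k A) (t : MPath k B) (s' : MPath k A) (t' : MPath k B) h hs ht
    obtain ⟨R, hs⟩ := (Mcofree_par s' s).1 hs
    obtain ⟨R', ht⟩ := (Mcofree_par t' t).1 ht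
    exact hpar h hs ht
  · intro (s : MPath k A) (t : MPath k B) (s' : MPath k A) h hs
    obtain ⟨R, hs⟩ := (Mcofree_par s s').1 hs
    have hk := s'.length_le
    rw [hs.length] at hk
    have hw := h.win h₀
    -- A round is left because the longer path `s'` still has length at most `k`.
    rw [show k - s.val.length = (k - (s.val.length + 1)) + 1 by omega] at hw
    obtain ⟨b, hb, hb'⟩ := (hw.2 R).1 s'.last (MPath.rel_of_step hs)
    have hk' : t.val.length < k := by rw [← h.length]; exact hk
    refine ⟨t.snoc hk' R b hb, (Mcofree_par _ _).2 ⟨R, t.step_snoc hk' R b hb⟩,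
      h.step hs (t.step_snoc hk' R b hb) ?_⟩
    rw [t.last_snoc, hs.length]
    exact hb'
  · intro (s : MPath k A) (t : MPath k B) (t' : MPath k B) h ht
    obtain ⟨R, ht⟩ := (Mcofree_par t t').1 ht
    have hk := t'.length_le
    rw [ht.length, ← h.length] at hk
    have hw := h.win h₀
    rw [show k - s.val.length = (k - (s.val.length + 1)) + 1 by omega] at hw
    obtain ⟨a, ha, ha'⟩ := (hw.2 R).2 t'.last (MPath.rel_of_step ht)
    refine ⟨s.snoc hk R a ha, (Mcofree_par _ _).2 ⟨R, s.step_snoc hk R a ha⟩,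
      h.step (s.step_snoc hk R a ha) ht ?_⟩
    rw [s.last_snoc, (s.step_snoc hk R a ha).length]
    exact ha'
  · intro (s : MPath k A) hs
    rw [hroot hs]
    exact ⟨(MPath.nil : MPath k B), Mcofree_ht _, .nil⟩
  · intro (t : MPath k B) ht
    rw [hroot ht]
    exact ⟨(MPath.nil : MPath k A), Mcofree_ht _, .nil⟩
  · intro n R (t : Fin n → MPath k A) (t' : Fin n → MPath k B) hmax ht
    have ht : MPath.Rel R t := ht
    change MPath.Rel R t'
    -- Symbols of other arities are false on paths.
    match n, R, t, t', hmax, ht with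
    | 1, P, t, t', hmax, ht =>
      obtain ⟨j, hj, -⟩ := hmax one_ne_zero
      rw [Subsingleton.elim j 0] at hj
      exact (hj.win h₀).unary P ht
    | 2, R, t, t', hmax, ht =>
      have ht : MPath.Step R (t 0) (t 1) := ht
      change MPath.Step R (t' 0) (t' 1)
      obtain ⟨j, hj, hi⟩ := hmax two_ne_zero
      have hlen : ∀ i, (t i).val.length = (t' i).val.length := fun i =>
        (Mcofree_ht (t i)).symm.trans ((hi i).2.2.trans (Mcofree_ht (t' i)))
      have hl := ht.length
      -- The greatest of the two paths is the longer one.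
      obtain rfl : j = 1 := by
        have := ((Mcofree_le _ _).1 (hi 1).1).length_le
        by_contra hne
        obtain rfl : j = 0 := by omega
        omega
      have hp : ((MForestCat σ k).forest ((MComonad σ k).cofree.obj B)).par (t' 0) (t' 1) :=
        Forest.par_of_comparable (.inl (hi 0).2.1) (by
          rw [Mcofree_ht, Mcofree_ht, ← hlen, ← hlen, hl])
      obtain ⟨R', hR'⟩ := (Mcofree_par _ _).1 hp
      have e := (Mcofree_lab ht).symm.trans ((hlab hj).trans (Mcofree_lab hR'))
      rw [Option.some.inj e]
      exact hR'

/-- Positions are the end points of related paths. Since the relation respects labels, Duplicator's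
step is along the same binary symbol as Spoiler's. -/
theorem MWin.of_gameRel {A B : PtStruct.{u} σ} {r : MPath k A → MPath k B → Prop}
    (h : (MForestCat σ k).GameRel ((MComonad σ k).cofree.obj A)
      ((MComonad σ k).cofree.obj B) r) (j : ℕ) {s : MPath k A} {t : MPath k B} (hr : r s t)
    (hj : s.val.length + j ≤ k) : MWin A.toStruct B.toStruct j s.last t.last := by
  induction j generalizing s t with
  | zero =>
    exact fun P hP => h.rel (R := P) (t := fun _ => s) (t' := fun _ => t)
      (fun _ => ⟨0, hr, fun _ => ⟨.refl _, .refl _, h.ht hr⟩⟩) hP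
  | succ j ih =>
    have hlen : s.val.length = t.val.length :=
      (Mcofree_ht s).symm.trans ((h.ht hr).trans (Mcofree_ht t))
    refine ⟨(ih hr (by omega)).unary, fun R => ⟨fun a ha => ?_, fun b hb => ?_⟩⟩
    · have hk : s.val.length < k := by omega
      have hs := s.step_snoc hk R a ha
      obtain ⟨t', ht', hr'⟩ := h.forth hr ((Mcofree_par _ _).2 ⟨R, hs⟩)
      obtain ⟨R', hR'⟩ := (Mcofree_par _ _).1 ht'
      obtain rfl := Option.some.inj
        ((Mcofree_lab hs).symm.trans ((h.lab hr').trans (Mcofree_lab hR')))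
      have hw := ih hr' (by rw [hs.length]; omega)
      rw [s.last_snoc] at hw
      exact ⟨_, MPath.rel_of_step hR', hw⟩
    · have hk : t.val.length < k := by omega
      have ht := t.step_snoc hk R b hb
      obtain ⟨s', hs', hr'⟩ := h.back hr ((Mcofree_par _ _).2 ⟨R, ht⟩)
      obtain ⟨R', hR'⟩ := (Mcofree_par _ _).1 hs'
      obtain rfl := Option.some.inj
        ((Mcofree_lab hR').symm.trans ((h.lab hr').trans (Mcofree_lab ht)))
      have hw := ih hr' (by rw [hR'.length]; omega)
      rw [t.last_snoc] at hw
      exact ⟨_, MPath.rel_of_step hR', hw⟩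

theorem MPosBisim_cofree_iff {A B : PtStruct.{u} σ} :
    MPosBisim ((MComonad σ k).cofree.obj A) ((MComonad σ k).cofree.obj B) ↔
      MWin A.toStruct B.toStruct k A.pt B.pt := by
  rw [MPosBisim_iff]
  refine ⟨fun ⟨r, h⟩ => ?_, fun h => ⟨_, MPlay.gameRel h⟩⟩
  obtain ⟨t, ht, hr⟩ := h.root_forth (x := (MPath.nil : MPath k A)) (Mcofree_ht _)
  have e : t = (MPath.nil : MPath k B) :=
    MPath.ext (List.length_eq_zero_iff.1 ((Mcofree_ht t).symm.trans ht))
  rw [e] at hr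
  exact MWin.of_gameRel h k hr (by simp [MPath.nil])

end M

end GameComonad

/-! ### The three equivalences -/

open GameComonad in
theorem mainTheorem2 (σ : FirstOrder.Language.{0, 0}) [σ.IsRelational]
    [Finite (Σ n, σ.Relations n)] :
    (∀ (k : ℕ) (A B : Struct.{u} σ),
      Preserves (positive (FOk.{u} σ k)) A B ↔
        EPosBisim ((EComonad (addI σ) k).cofree.obj (J A))
          ((EComonad (addI σ) k).cofree.obj (J B))) ∧
    (∀ (k : ℕ), 0 < k → ∀ (A B : Struct.{u} σ),
      Preserves (positive (LLk.{u} σ k)) A B ↔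
        PPosBisim ((PComonad (addI σ) k).cofree.obj (J A))
          ((PComonad (addI σ) k).cofree.obj (J B))) ∧
    ((∀ n, 2 < n → IsEmpty (σ.Relations n)) → ∀ (k : ℕ) (A B : PtStruct.{u} σ),
      PreservesModal (positiveModal (MLk σ k)) A B ↔
        MPosBisim ((MComonad σ k).cofree.obj A) ((MComonad σ k).cofree.obj B)) :=
  ⟨fun k A B => (preserves_FO_iff k A B).trans EPosBisim_cofree_iff.symm,
    fun k _ A B => (preserves_LL_iff k A B).trans PPosBisim_cofree_iff.symm,
    fun _ k A B => (preserves_ML_iff k A B).trans MPosBisim_cofree_iff.symm⟩
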